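/- Fix $0<\varepsilon<1$, $\kappa>0$. Write $\lg=\log_2$ and, for $n\ge 2$, $\Delta=\lceil \lg^{\varepsilon} n\rceil$. Let $\mathcal L$ be a set of $n\ge 2$ horizontal segments in rank space: the $y$-coordinates of the segments are $1,\dots,n$, and each of $1,\dots,2n$ is the $x$-coordinate of exactly one of the $2n$ endpoints. Let $\mathcal L$ be partitioned into $\Delta$ horizontal slabs, that is, each segment is assigned a slab in $\{1,\dots,\Delta\}$ that is non-decreasing in its $y$-coordinate. A segment with left endpoint $x_l$ and right endpoint $x_r$ crosses the vertical line at $i$ if $x_l\le i\le x_r$. Consider the following operations, for $0\le i\le 2n$ unless stated otherwise: * $\textsf{slab-select}(i,j)$: the slab containing the $j$th segment, by increasing $y$-coordinate, among the segments crossing the vertical line at $i$ (for $j$ from $1$ to the number of these segments); * $\textsf{slab-rank}(i,j)$: the number of segments in slabs $1,\dots,j$ that cross the vertical line at $i$ ($0\le j\le\Delta$); * $\textsf{endpoint-select}(k,i)$: the $x$-coordinate of the $i$th endpoint, by increasing $x$-coordinate, among the endpoints of the segments in slab $k$ ($1\le k\le\Delta$, and $i$ from $1$ to the number of these endpoints);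 * $\textsf{endpoint-rank}(k,i)$: the number of endpoints of segments in slab $k$ with $x$-coordinate at most $i$ ($1\le k\le\Delta$). The model is the word RAM with words of logarithmic size: any word size $w$ with $2n<2^w$ and $w\le\kappa\lg n$, and unit cost for reading a memory word, for conditional jumps, and for arithmetic, bitwise, shift and comparison operations on words. Then there are a program for each of the four operations, a number $T$ and a constant $C$, all depending only on $\varepsilon$ and $\kappa$, such that for all such $n$, $w$, $\mathcal L$ and slab partitions there is a data structure, stored in consecutive memory words, that occupies at most $$2n\lg\lg^{\varepsilon} n + C n$$ bits and with which each program, given the arguments of its operation, returns the correct answer in at most $T$ steps. The programs only read the data structure, and use a constant number of registers in addition. The same holds if crossing is understood as $x_l\le i<x_r$. -/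

import Mathlib

namespace SlabRep

/-! ### The word RAM

Registers and memory cells hold `w`-bit words. A program is a fixed finite list of instructions
over finitely many registers; every executed instruction costs one unit of time. A query reads the
words of the stored data structure but does not modify them. -/

/-- Binary word operations (arithmetic is modulo `2 ^ w`, division and comparison are unsigned). -/
inductive BinOp where
  | add | sub | mul | div | mod | and | or | xor | shl | shr | lt | eq

/-- The value of a binary operation; comparisons yield `1` or `0`. -/
def BinOp.eval {w : ℕ} : BinOp → BitVec w → BitVec w → BitVec w
  | .add, x, y => x + y
  | .sub, x, y => x - y
  | .mul, x, y => x * y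
  | .div, x, y => x / y
  | .mod, x, y => x % y
  | .and, x, y => x &&& y
  | .or, x, y => x ||| y
  | .xor, x, y => x ^^^ y
  | .shl, x, y => x <<< y
  | .shr, x, y => x >>> y
  | .lt, x, y => if x < y then 1 else 0
  | .eq, x, y => if x = y then 1 else 0

/-- Instructions; `d`, `a`, `b` are register numbers. -/
inductive Instr where
  /-- `R[d] := c` (modulo `2 ^ w`) -/
  | const (d c : ℕ)
  /-- `R[d] := R[a] o R[b]` -/
  | op (o : BinOp) (d a b : ℕ)
  /-- `R[d] := M[R[a]]` -/
  | load (d a : ℕ)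
  /-- jump to the instruction with number `target` if `R[a] = 0` -/
  | jumpZero (a target : ℕ)

abbrev Program := List Instr

structure State (w : ℕ) where
  pc : ℕ
  reg : ℕ → BitVec w

/-- One step of `P` on the memory `M`. The machine has halted, and remains as it is, once the
program counter does not point to an instruction. Reading outside of `M` yields `0`. -/
def step {w : ℕ} (P : Program) (M : List (BitVec w)) (σ : State w) : State w :=
  match P[σ.pc]? with
  | none => σ
  | some (.const d c) => ⟨σ.pc + 1, Function.update σ.reg d (BitVec.ofNat w c)⟩
  | some (.op o d a b) => ⟨σ.pc + 1, Function.update σ.reg d (o.eval (σ.reg a) (σ.reg b))⟩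
  | some (.load d a) => ⟨σ.pc + 1, Function.update σ.reg d (M.getD (σ.reg a).toNat 0)⟩
  | some (.jumpZero a target) => ⟨if σ.reg a = 0 then target else σ.pc + 1, σ.reg⟩

/-- At the start, the two arguments are in the registers `0` and `1`, all others contain `0`. -/
def initState (w a b : ℕ) : State w :=
  ⟨0, fun r => if r = 0 then BitVec.ofNat w a else if r = 1 then BitVec.ofNat w b else 0⟩

/-- Started with arguments `a`, `b` on the memory `M`, the program `P` halts within `T` steps
with `z` in register `0`. -/
def ComputesWithin {w : ℕ} (P : Program) (M : List (BitVec w)) (T a b z : ℕ) : Prop :=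
  ∃ t ≤ T, P.length ≤ ((step P M)^[t] (initState w a b)).pc ∧
    (((step P M)^[t] (initState w a b)).reg 0).toNat = z

/-! ### Segments and slabs -/

/-- `n` horizontal segments in rank space: the segment `s : Fin n` has `y`-coordinate `s + 1` and
spans the `x`-coordinates from `left s` to `right s`; each of `1, …, 2 * n` is the `x`-coordinate
of exactly one endpoint. -/
structure Segments (n : ℕ) where
  left : Fin n → ℕ
  right : Fin n → ℕ
  left_lt_right : ∀ s, left s < right s
  bijOn : Set.BijOn (Sum.elim left right) Set.univ (Set.Icc 1 (2 * n))

/-- Whether a segment crosses the vertical line through its own right endpoint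
(`closed`) or not (`halfOpen`). -/
inductive Convention where
  | closed | halfOpen

variable {n : ℕ}

/-- The segment `s` crosses the vertical line through `x`-coordinate `i`. -/
def Segments.Crosses (L : Segments n) (i : ℕ) (s : Fin n) : Convention → Prop
  | .closed => L.left s ≤ i ∧ i ≤ L.right s
  | .halfOpen => L.left s ≤ i ∧ i < L.right s

/-- The endpoints are `.inl s` (left) and `.inr s` (right) for `s : Fin n`. -/
def Segments.x (L : Segments n) (e : Fin n ⊕ Fin n) : ℕ := Sum.elim L.left L.right e

/-- The segment to which an endpoint belongs. -/
def segmentOf (e : Fin n ⊕ Fin n) : Fin n := Sum.elim id id e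

/-- A partition of the segments into horizontal slabs `1, …, Δ`, numbered by increasing `y`;
`slab s` is the slab that contains the segment `s`. -/
structure IsSlabPartition (Δ : ℕ) (slab : Fin n → ℕ) : Prop where
  mono : Monotone slab
  mem : ∀ s, slab s ∈ Set.Icc 1 Δ

/-- The four operations. -/
inductive Op where
  | slabSelect | slabRank | endpointSelect | endpointRank

/-- `IsAnswer L v Δ slab o a b z`: the operation `o` is defined on the arguments `(a, b)` and its
value is `z`. -/
def IsAnswer (L : Segments n) (v : Convention) (Δ : ℕ) (slab : Fin n → ℕ) :
    Op → ℕ → ℕ → ℕ → Prop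
  -- the slab `k` of the `j`th segment by `y` among the segments that cross the line at `i`
  | .slabSelect, i, j, k => i ≤ 2 * n ∧
      ∃ s, L.Crosses i s v ∧ {t | L.Crosses i t v ∧ t ≤ s}.ncard = j ∧ slab s = k
  -- the number of segments in the slabs `1, …, j` that cross the line at `i`
  | .slabRank, i, j, m => i ≤ 2 * n ∧ j ≤ Δ ∧
      {s | L.Crosses i s v ∧ slab s ∈ Set.Icc 1 j}.ncard = m
  -- the `x`-coordinate of the `i`th endpoint by `x` among the endpoints in slab `k`
  | .endpointSelect, k, i, p => k ∈ Set.Icc 1 Δ ∧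
      ∃ e, slab (segmentOf e) = k ∧
        {f | slab (segmentOf f) = k ∧ L.x f ≤ L.x e}.ncard = i ∧ L.x e = p
  -- the number of endpoints in slab `k` with `x`-coordinate at most `i`
  | .endpointRank, k, i, m => k ∈ Set.Icc 1 Δ ∧ i ≤ 2 * n ∧
      {e | slab (segmentOf e) = k ∧ L.x e ≤ i}.ncard = m

end SlabRep

/-! Listing the endpoints by x-coordinate as letters, `2 * slab` for a left and `2 * slab + 1` for a
right one, turns the operations into rank and select questions about a string over some 2Δ letters
(`IsSeq`, `Spec`, `spec_of_isAnswer`): the segments crossing the line at i are counted by the left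
endpoints up to i minus the right endpoints already passed. The string takes 2n⌈lg(2Δ+2)⌉ bits,
which gives the main term; all else has to fit into O(n) bits.

A block is one memory word. It holds G letters and, above them, for every letter a counter of u =
O(lg lg n) bits relative to the start of a superblock of f blocks. As Δ is a power of lg n with
exponent below 1, the counters take o(lg n) bits, less than one bit per letter of the block. A
superblock has enough letters to pay for O(Δ) further words. Functions of five arguments of (lg n)/8
bits are tabulated, and a word is cut into K = O(1) pieces of this length, so that the rank
operations need a bounded number of lookups (`IsTableMemory.endpointRank`,
`IsTableMemory.slabRank`).

For slab-select, the cumulative counts `openCount` at the start of a superblock are Δ+1 sorted keys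
of full word length. They are searched in constant time as in a fusion tree: only the positions of
the bits at which successive keys branch are kept, a blind descent finds a leaf, and comparing the
query with this one key corrects the result (`exists_isLeaf`, `IsLeaf.lt_iff`,
`IsTableMemory.search`). Inside a superblock the counts change by less than 2^u, so the remaining
decision depends only on distances truncated at 2^u - 1 (`truncated_sum`), and these fit into one
table argument.

For endpoint-select, the string is cut into units of f³ blocks, and the unit of every t-th endpoint
of each slab is recorded. If the wanted endpoint lies in the unit of the sample before it, three
levels of fan-out f lead to its block (`IsTableMemory.node_spec`, `IsTableMemory.blockSelect`).
Otherwise it is among the t endpoints of the slab that follow this unit, and their positions are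
stored outright.

The programs are straight-line, conditionals being products with 0 or 1, so the time is the program
length. The parameters fit once n exceeds a constant (`IsLarge.valid`, `IsLarge.space`,
`exists_forall_mul_slabs_le`). Below it, each letter gets a whole word and a program of fixed length
scans them all; the first word tells the two formats apart. -/

namespace SlabRep

/-! ### Straight-line programs from expressions -/

/-- Expressions over the two arguments and the memory. -/
inductive Expr where
  | arg0 | arg1
  | lit (c : ℕ)
  | op (o : BinOp) (x y : Expr)
  | ld (x : Expr)

namespace Expr

instance : Add Expr := ⟨.op .add⟩
instance : Sub Expr := ⟨.op .sub⟩
instance : Mul Expr := ⟨.op .mul⟩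
instance : Div Expr := ⟨.op .div⟩
instance : Mod Expr := ⟨.op .mod⟩

def eval {w : ℕ} (M : List (BitVec w)) (a b : BitVec w) : Expr → BitVec w
  | arg0 => a
  | arg1 => b
  | lit c => BitVec.ofNat w c
  | op o x y => o.eval (eval M a b x) (eval M a b y)
  | ld x => M.getD (eval M a b x).toNat 0

/-- Code that computes an expression into register `d`, using the registers from `d` on. -/
def code : Expr → ℕ → Program
  | arg0, d => [.op .or d 0 0]
  | arg1, d => [.op .or d 1 1]
  | lit c, d => [.const d c]
  | op o x y, d => code x d ++ code y (d + 1) ++ [.op o d d (d + 1)]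
  | ld x, d => code x d ++ [.load d d]

/-- Registers 0 and 1 keep the arguments until the last instruction, which copies the result from
register 2. -/
def compile (e : Expr) : Program := e.code 2 ++ [.op .or 0 2 2]

end Expr

theorem step_of_getElem? {w : ℕ} {P : Program} {M : List (BitVec w)} {pre post : Program}
    {ins : Instr} {r : ℕ → BitVec w} (hP : P = pre ++ ins :: post) :
    step P M ⟨pre.length, r⟩ = match ins with
      | .const d c => ⟨pre.length + 1, Function.update r d (BitVec.ofNat w c)⟩
      | .op o d a b => ⟨pre.length + 1, Function.update r d (o.eval (r a) (r b))⟩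
      | .load d a => ⟨pre.length + 1, Function.update r d (M.getD (r a).toNat 0)⟩
      | .jumpZero a target => ⟨if r a = 0 then target else pre.length + 1, r⟩ := by
  have h : P[pre.length]? = some ins := by simp [hP]
  unfold step
  simp only [h]
  cases ins <;> rfl

/-- Induction on `e`. Code at level `d` leaves the registers below `d` alone, so a first operand
survives in register `d` while the second is computed from `d + 1` on; `2 ≤ d` protects the
arguments. -/
theorem run_code {w : ℕ} (M : List (BitVec w)) (a b : BitVec w) (P : Program) (e : Expr) :
    ∀ (d : ℕ) (pre post : Program) (r : ℕ → BitVec w), 2 ≤ d → P = pre ++ e.code d ++ post →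
      r 0 = a → r 1 = b →
      ∃ r', (step P M)^[(e.code d).length] ⟨pre.length, r⟩ = ⟨pre.length + (e.code d).length, r'⟩ ∧
        r' d = e.eval M a b ∧ ∀ k < d, r' k = r k := by
  induction e with
  | arg0 =>
    intro d pre post r hd hP h0 h1
    refine ⟨_, by
      simp only [Expr.code, List.length_singleton, Function.iterate_one]
      rw [step_of_getElem? (pre := pre) (post := post) (by simpa [Expr.code] using hP)],
      by simp [BinOp.eval, h0, Expr.eval], fun k hk => by simp [hk.ne]⟩
  | arg1 =>
    intro d pre post r hd hP h0 h1
    refine ⟨_, by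
      simp only [Expr.code, List.length_singleton, Function.iterate_one]
      rw [step_of_getElem? (pre := pre) (post := post) (by simpa [Expr.code] using hP)],
      by simp [BinOp.eval, h1, Expr.eval], fun k hk => by simp [hk.ne]⟩
  | lit c =>
    intro d pre post r hd hP h0 h1
    refine ⟨_, by
      simp only [Expr.code, List.length_singleton, Function.iterate_one]
      rw [step_of_getElem? (pre := pre) (post := post) (by simpa [Expr.code] using hP)],
      by simp [Expr.eval], fun k hk => by simp [hk.ne]⟩
  | op o x y ihx ihy =>
    intro d pre post r hd hP h0 h1
    obtain ⟨r₁, h₁, hv₁, hk₁⟩ := ihx d pre (y.code (d + 1) ++ [.op o d d (d + 1)] ++ post) r hd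
      (by simpa [Expr.code] using hP) h0 h1
    obtain ⟨r₂, h₂, hv₂, hk₂⟩ := ihy (d + 1) (pre ++ x.code d) ([.op o d d (d + 1)] ++ post) r₁
      (by omega) (by simpa [Expr.code] using hP) (by rw [hk₁ 0 (by omega), h0])
      (by rw [hk₁ 1 (by omega), h1])
    refine ⟨Function.update r₂ d (o.eval (r₂ d) (r₂ (d + 1))), ?_, ?_, ?_⟩
    · have e3 : ((Expr.op o x y).code d).length
          = 1 + ((y.code (d + 1)).length + (x.code d).length) := by
        simp [Expr.code]; omega
      rw [List.length_append] at h₂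
      rw [e3, Function.iterate_add_apply, Function.iterate_add_apply, h₁, h₂]
      have := step_of_getElem? (M := M) (pre := pre ++ x.code d ++ y.code (d + 1)) (post := post)
        (ins := .op o d d (d + 1)) (r := r₂) (P := P) (by simpa [Expr.code] using hP)
      simp only [List.length_append] at this
      rw [Function.iterate_one, this]
      simp only [State.mk.injEq, and_true]
      omega
    · simp [Expr.eval, hv₂, hk₂ d (by omega), hv₁]
    · intro k hk
      rw [Function.update_of_ne hk.ne, hk₂ k (by omega), hk₁ k hk]
  | ld x ihx =>
    intro d pre post r hd hP h0 h1
    obtain ⟨r₁, h₁, hv₁, hk₁⟩ := ihx d pre ([.load d d] ++ post) r hd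
      (by simpa [Expr.code] using hP) h0 h1
    refine ⟨Function.update r₁ d (M.getD (r₁ d).toNat 0), ?_, ?_, ?_⟩
    · have e3 : ((Expr.ld x).code d).length = 1 + (x.code d).length := by
        simp [Expr.code]; omega
      rw [e3, Function.iterate_add_apply, h₁]
      have := step_of_getElem? (M := M) (pre := pre ++ x.code d) (post := post)
        (ins := .load d d) (r := r₁) (P := P) (by simpa [Expr.code] using hP)
      simp only [List.length_append] at this
      rw [Function.iterate_one, this]
      simp only [State.mk.injEq, and_true]
      omega
    · simp [Expr.eval, hv₁]
    · intro k hk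
      rw [Function.update_of_ne hk.ne, hk₁ k hk]

/-- There are no jumps, so the number of steps is the length of the code, whatever the memory and
the word size. -/
theorem computesWithin_compile {w : ℕ} (M : List (BitVec w)) (e : Expr) (T a b : ℕ)
    (hT : e.compile.length ≤ T) :
    ComputesWithin e.compile M T a b (e.eval M (BitVec.ofNat w a) (BitVec.ofNat w b)).toNat := by
  obtain ⟨r, h, hv, -⟩ := run_code M (BitVec.ofNat w a) (BitVec.ofNat w b) e.compile e 2 []
    [.op .or 0 2 2] (initState w a b).reg le_rfl (by simp [Expr.compile]) (by simp [initState])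
    (by simp [initState])
  have hs := step_of_getElem? (M := M) (pre := e.code 2) (post := [])
        (ins := .op .or 0 2 2) (r := r) (P := e.compile) (by simp [Expr.compile])
  have hl : e.compile.length = 1 + (e.code 2).length := by
    simp [Expr.compile]; omega
  simp only [List.length_nil, zero_add] at h
  have : (step e.compile M)^[e.compile.length] (initState w a b)
      = ⟨(e.code 2).length + 1, Function.update r 0 (BinOp.or.eval (r 2) (r 2))⟩ := by
    rw [hl, Function.iterate_add_apply]
    have : initState w a b = ⟨0, (initState w a b).reg⟩ := rfl
    rw [this, h, Function.iterate_one, hs]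
  refine ⟨e.compile.length, hT, ?_, ?_⟩
  · rw [this, hl]; simp; omega
  · rw [this]; simp [BinOp.eval, hv]

/-- The expression `e` has the value `x`. -/
def Ev {w : ℕ} (M : List (BitVec w)) (a b : BitVec w) (e : Expr) (x : ℕ) : Prop :=
  (e.eval M a b).toNat = x

namespace Ev

variable {w : ℕ} {M : List (BitVec w)} {a b : BitVec w} {e f g : Expr} {x y z : ℕ}

theorem lt (h : Ev M a b e x) : x < 2 ^ w := h ▸ BitVec.isLt _

theorem congr (h : Ev M a b e x) (hxy : x = y) : Ev M a b e y := hxy ▸ h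

theorem arg0 (h : x < 2 ^ w) : Ev M (BitVec.ofNat w x) b .arg0 x := by
  simp [Ev, Expr.eval, Nat.mod_eq_of_lt h]

theorem arg1 (h : x < 2 ^ w) : Ev M a (BitVec.ofNat w x) .arg1 x := by
  simp [Ev, Expr.eval, Nat.mod_eq_of_lt h]

theorem lit (h : x < 2 ^ w) : Ev M a b (.lit x) x := by
  simp [Ev, Expr.eval, Nat.mod_eq_of_lt h]

theorem add (he : Ev M a b e x) (hf : Ev M a b f y) (h : x + y < 2 ^ w) :
    Ev M a b (e + f) (x + y) := by
  change ((e.eval M a b) + (f.eval M a b)).toNat = _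
  rw [BitVec.toNat_add, he, hf, Nat.mod_eq_of_lt h]

theorem sub (he : Ev M a b e x) (hf : Ev M a b f y) (h : y ≤ x) :
    Ev M a b (e - f) (x - y) := by
  change ((e.eval M a b) - (f.eval M a b)).toNat = _
  rw [BitVec.toNat_sub_of_le (by rw [BitVec.le_def, he, hf]; exact h), he, hf]

theorem mul (he : Ev M a b e x) (hf : Ev M a b f y) (h : x * y < 2 ^ w) :
    Ev M a b (e * f) (x * y) := by
  change ((e.eval M a b) * (f.eval M a b)).toNat = _
  rw [BitVec.toNat_mul, he, hf, Nat.mod_eq_of_lt h]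

theorem div (he : Ev M a b e x) (hf : Ev M a b f y) : Ev M a b (e / f) (x / y) := by
  change ((e.eval M a b) / (f.eval M a b)).toNat = _
  rw [BitVec.toNat_udiv, he, hf]

theorem mod (he : Ev M a b e x) (hf : Ev M a b f y) : Ev M a b (e % f) (x % y) := by
  change ((e.eval M a b) % (f.eval M a b)).toNat = _
  rw [BitVec.toNat_umod, he, hf]

theorem or (he : Ev M a b e x) (hf : Ev M a b f y) : Ev M a b (.op .or e f) (x ||| y) := by
  change ((e.eval M a b) ||| (f.eval M a b)).toNat = _
  rw [BitVec.toNat_or, he, hf]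

theorem xor (he : Ev M a b e x) (hf : Ev M a b f y) : Ev M a b (.op .xor e f) (x ^^^ y) := by
  change ((e.eval M a b) ^^^ (f.eval M a b)).toNat = _
  rw [BitVec.toNat_xor, he, hf]

theorem shl (he : Ev M a b e x) (hf : Ev M a b f y) (h : x * 2 ^ y < 2 ^ w) :
    Ev M a b (.op .shl e f) (x * 2 ^ y) := by
  change ((e.eval M a b) <<< (f.eval M a b)).toNat = _
  rw [BitVec.shiftLeft_eq', BitVec.toNat_shiftLeft, he, hf, Nat.shiftLeft_eq, Nat.mod_eq_of_lt h]

theorem shr (he : Ev M a b e x) (hf : Ev M a b f y) : Ev M a b (.op .shr e f) (x / 2 ^ y) := by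
  change ((e.eval M a b) >>> (f.eval M a b)).toNat = _
  rw [BitVec.ushiftRight_eq', BitVec.toNat_ushiftRight, he, hf, Nat.shiftRight_eq_div_pow]

theorem ltOp (hw : 0 < w) (he : Ev M a b e x) (hf : Ev M a b f y) :
    Ev M a b (.op .lt e f) (if x < y then 1 else 0) := by
  change (if (e.eval M a b) < (f.eval M a b) then (1 : BitVec w) else 0).toNat = _
  have : (e.eval M a b) < (f.eval M a b) ↔ x < y := by rw [BitVec.lt_def, he, hf]
  simp only [this]
  split <;> simp [hw]

theorem eqOp (hw : 0 < w) (he : Ev M a b e x) (hf : Ev M a b f y) :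
    Ev M a b (.op .eq e f) (if x = y then 1 else 0) := by
  change (if (e.eval M a b) = (f.eval M a b) then (1 : BitVec w) else 0).toNat = _
  have : (e.eval M a b) = (f.eval M a b) ↔ x = y := by rw [← BitVec.toNat_inj, he, hf]
  simp only [this]
  split <;> simp [hw]

theorem ld (he : Ev M a b e x) (hx : (M.getD x 0).toNat = y) : Ev M a b (.ld e) y := by
  change (M.getD (e.eval M a b).toNat 0).toNat = y
  rw [he, hx]

end Ev

/-! ### Branch-free conditionals, sums and disjunctions -/

namespace Expr

/-- `if c = 0 then f else e` for a condition with value `0` or `1`. -/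
def ite (c e f : Expr) : Expr := c * e + (lit 1 - c) * f

/-- Truncated subtraction. -/
def tsub (e f : Expr) : Expr := op .lt f e * (e - f)

def min (e f : Expr) : Expr := ite (op .lt e f) e f

def sum (F : ℕ → Expr) : ℕ → Expr
  | 0 => lit 0
  | k + 1 => sum F k + F k

def bor (F : ℕ → Expr) : ℕ → Expr
  | 0 => lit 0
  | k + 1 => op .or (bor F k) (F k)

end Expr

namespace Ev

variable {w : ℕ} {M : List (BitVec w)} {a b : BitVec w} {e f g : Expr} {x y z : ℕ}

theorem mul_zero_left (he : Ev M a b e 0) (f : Expr) : Ev M a b (e * f) 0 :=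
  (he.mul (f := f) rfl (by simp)).congr (Nat.zero_mul _)

theorem one_sub (hw : 0 < w) {p : Prop} [Decidable p] (he : Ev M a b e (if p then 1 else 0)) :
    Ev M a b (.lit 1 - e) (if p then 0 else 1) :=
  ((Ev.lit (Nat.one_lt_two_pow hw.ne')).sub he (by split <;> simp)).congr (by split <;> simp)

/-- Both branches are executed, but the rejected one is multiplied by 0. Nothing is required of it:
it may overflow or read outside of the data structure. -/
theorem ite (hw : 0 < w) {p : Prop} [Decidable p] (hc : Ev M a b e (if p then 1 else 0))
    (hf : p → Ev M a b f x) (hg : ¬ p → Ev M a b g x) : Ev M a b (Expr.ite e f g) x := by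
  have h1 := one_sub hw hc
  by_cases hp : p
  · rw [if_pos hp] at hc h1
    have := (hf hp).lt
    exact ((hc.mul (hf hp) (by simpa)).add (mul_zero_left h1 g) (by simpa)).congr (by simp)
  · rw [if_neg hp] at hc h1
    have := (hg hp).lt
    exact ((mul_zero_left hc f).add (h1.mul (hg hp) (by simpa)) (by simpa)).congr (by simp)

theorem tsub (hw : 0 < w) (he : Ev M a b e x) (hf : Ev M a b f y) :
    Ev M a b (Expr.tsub e f) (x - y) := by
  have h := ltOp hw hf he
  by_cases hp : y < x
  · rw [if_pos hp] at h
    exact (h.mul (he.sub hf hp.le) (by have := he.lt; omega)).congr (by simp)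
  · rw [if_neg hp] at h
    exact (mul_zero_left h _).congr (by omega)

theorem min (hw : 0 < w) (he : Ev M a b e x) (hf : Ev M a b f y) :
    Ev M a b (Expr.min e f) (min x y) :=
  ite hw (ltOp hw he hf) (fun h => he.congr (by omega)) (fun h => hf.congr (by omega))

theorem sum {F : ℕ → Expr} {φ : ℕ → ℕ} {k : ℕ} (h : ∀ i < k, Ev M a b (F i) (φ i))
    (hb : ∑ i ∈ Finset.range k, φ i < 2 ^ w) :
    Ev M a b (Expr.sum F k) (∑ i ∈ Finset.range k, φ i) := by
  induction k with
  | zero => exact (Ev.lit (by positivity)).congr (by simp)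
  | succ k ih =>
    rw [Finset.sum_range_succ] at hb ⊢
    exact (ih (fun i hi => h i (by omega)) (by omega)).add (h k (by omega)) hb

/-- The value is characterised by its bits, since the disjunction collects sets of branchings found
in the pieces of a long word. -/
theorem testBit_bor {F : ℕ → Expr} {φ : ℕ → ℕ} {k : ℕ} (h : ∀ i < k, Ev M a b (F i) (φ i)) :
    ∃ x, Ev M a b (Expr.bor F k) x ∧ ∀ e, x.testBit e = true ↔ ∃ i < k, (φ i).testBit e = true := by
  induction k with
  | zero => exact ⟨0, Ev.lit (by positivity), by simp⟩
  | succ k ih =>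
    obtain ⟨x, hx, hb⟩ := ih fun i hi => h i (by omega)
    refine ⟨_, hx.or (h k (by omega)), fun e => ?_⟩
    rw [Nat.testBit_or, Bool.or_eq_true, hb]
    constructor
    · rintro (⟨i, hi, h⟩ | h)
      · exact ⟨i, by omega, h⟩
      · exact ⟨k, by omega, h⟩
    · rintro ⟨i, hi, h'⟩
      rcases Nat.lt_succ_iff_lt_or_eq.1 hi with hi | rfl
      · exact Or.inl ⟨i, hi, h'⟩
      · exact Or.inr h'

end Ev

end SlabRep

namespace SlabRep

/-! ### Packing small numbers into one -/

def digit (u x i : ℕ) : ℕ := x / 2 ^ (u * i) % 2 ^ u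

def pack (u : ℕ) (f : ℕ → ℕ) (n : ℕ) : ℕ := ∑ i ∈ Finset.range n, f i * 2 ^ (u * i)

theorem digit_lt (u x i : ℕ) : digit u x i < 2 ^ u := Nat.mod_lt _ (by positivity)

theorem pack_succ (u : ℕ) (f : ℕ → ℕ) (n : ℕ) :
    pack u f (n + 1) = pack u f n + f n * 2 ^ (u * n) := Finset.sum_range_succ _ _

theorem pack_congr {u n : ℕ} {f g : ℕ → ℕ} (h : ∀ i < n, f i = g i) : pack u f n = pack u g n :=
  Finset.sum_congr rfl fun i hi => by rw [h i (Finset.mem_range.1 hi)]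

/-- No bound on the digits is needed: carries matter only when digits are read back. -/
theorem pack_add (u : ℕ) (f g : ℕ → ℕ) (n : ℕ) :
    pack u f n + pack u g n = pack u (fun i => f i + g i) n := by
  simp [pack, add_mul, Finset.sum_add_distrib]

theorem sum_pack (u : ℕ) (f : ℕ → ℕ → ℕ) (n k : ℕ) :
    ∑ t ∈ Finset.range k, pack u (f t) n = pack u (fun i => ∑ t ∈ Finset.range k, f t i) n := by
  simp only [pack, Finset.sum_mul]
  exact Finset.sum_comm

theorem pack_lt {u n : ℕ} {f : ℕ → ℕ} (h : ∀ i < n, f i < 2 ^ u) : pack u f n < 2 ^ (u * n) := by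
  induction n with
  | zero => simp [pack]
  | succ n ih =>
    have h1 := ih fun i hi => h i (by omega)
    have h2 : (f n + 1) * 2 ^ (u * n) ≤ 2 ^ u * 2 ^ (u * n) :=
      Nat.mul_le_mul_right _ (h n (by omega))
    rw [pack_succ, Nat.mul_succ, pow_add, mul_comm (2 ^ (u * n))]
    rw [Nat.add_mul] at h2
    omega

theorem pack_mod {u n o : ℕ} {f : ℕ → ℕ} (h : ∀ i < n, f i < 2 ^ u) (ho : o ≤ n) :
    pack u f n % 2 ^ (u * o) = pack u f o := by
  induction n, ho using Nat.le_induction with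
  | base => exact Nat.mod_eq_of_lt (pack_lt h)
  | succ n hn ih =>
    rw [pack_succ]
    have : 2 ^ (u * o) ∣ f n * 2 ^ (u * n) :=
      Dvd.dvd.mul_left (pow_dvd_pow 2 (Nat.mul_le_mul_left u hn)) _
    obtain ⟨d, hd⟩ := this
    rw [hd, Nat.add_mul_mod_self_left, ih fun i hi => h i (by omega)]

theorem digit_eq_zero {u x i : ℕ} (h : x < 2 ^ (u * i)) : digit u x i = 0 := by
  simp [digit, Nat.div_eq_of_lt h]

theorem digit_mod {u x i o : ℕ} (h : i < o) : digit u (x % 2 ^ (u * o)) i = digit u x i := by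
  obtain ⟨d, rfl⟩ := Nat.exists_eq_add_of_lt h
  have : u * (i + d + 1) = u * i + (u + u * d) := by ring
  unfold digit
  rw [this, pow_add, Nat.mod_mul_right_div_self, Nat.mod_mod_of_dvd]
  rw [pow_add]
  exact Dvd.intro _ rfl

theorem digit_pack {u n i : ℕ} {f : ℕ → ℕ} (h : ∀ i < n, f i < 2 ^ u) (hi : i < n) :
    digit u (pack u f n) i = f i := by
  rw [← digit_mod (Nat.lt_succ_self i), pack_mod h hi, pack_succ, digit,
    Nat.add_mul_div_right _ _ (by positivity), Nat.div_eq_of_lt (pack_lt fun j hj => h j (by omega)),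
    zero_add, Nat.mod_eq_of_lt (h i hi)]

theorem digit_pack_of_le {u n i : ℕ} {f : ℕ → ℕ} (h : ∀ i < n, f i < 2 ^ u) (hi : n ≤ i) :
    digit u (pack u f n) i = 0 :=
  digit_eq_zero ((pack_lt h).trans_le (Nat.pow_le_pow_right two_pos (Nat.mul_le_mul_left u hi)))

/-- The `t`th group of `c` digits. -/
def chunk (u c x t : ℕ) : ℕ := x / 2 ^ (t * (u * c)) % 2 ^ (u * c)

theorem chunk_lt (u c x t : ℕ) : chunk u c x t < 2 ^ (u * c) := Nat.mod_lt _ (by positivity)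

theorem digit_chunk {u c x t p : ℕ} (h : p < c) :
    digit u (chunk u c x t) p = digit u x (t * c + p) := by
  rw [chunk, digit_mod h, digit, digit, Nat.div_div_eq_div_mul, ← pow_add]
  congr 3
  ring

/-- This assembles a count over a whole word from table lookups for groups of `c` digits. -/
theorem sum_count_chunk (Q : ℕ → Prop) [DecidablePred Q] (u c x k : ℕ) :
    ∑ t ∈ Finset.range k, Nat.count (fun p => Q (digit u (chunk u c x t) p)) c
      = Nat.count (fun p => Q (digit u x p)) (k * c) := by
  induction k with
  | zero => simp
  | succ k ih =>
    rw [Finset.sum_range_succ, ih, Nat.succ_mul, Nat.count_add]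
    congr 1
    rw [Nat.count_eq_card_filter_range, Nat.count_eq_card_filter_range]
    congr 1
    ext p
    simp only [Finset.mem_filter, Finset.mem_range]
    refine and_congr_right fun hp => ?_
    rw [digit_chunk hp]

theorem count_congr {P Q : ℕ → Prop} [DecidablePred P] [DecidablePred Q] {n : ℕ}
    (h : ∀ i < n, (P i ↔ Q i)) : Nat.count P n = Nat.count Q n := by
  rw [Nat.count_eq_card_filter_range, Nat.count_eq_card_filter_range]
  congr 1
  ext p
  simp only [Finset.mem_filter, Finset.mem_range]
  exact and_congr_right (h p)

theorem count_of_le {P : ℕ → Prop} [DecidablePred P] {m n : ℕ} (hmn : m ≤ n)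
    (h : ∀ i, m ≤ i → i < n → ¬ P i) : Nat.count P n = Nat.count P m := by
  induction n, hmn using Nat.le_induction with
  | base => rfl
  | succ n hn ih =>
    rw [Nat.count_succ, ih fun i hi hi' => h i hi (by omega), if_neg (h n hn (by omega)), add_zero]

theorem count_le (P : ℕ → Prop) [DecidablePred P] (n : ℕ) : Nat.count P n ≤ n := by
  rw [Nat.count_eq_card_filter_range]
  exact (Finset.card_filter_le _ _).trans (by simp)

theorem count_sub_le (P : ℕ → Prop) [DecidablePred P] (m n : ℕ) :
    Nat.count P n - Nat.count P m ≤ n - m := by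
  rcases le_total m n with h | h
  · obtain ⟨d, rfl⟩ := Nat.exists_eq_add_of_le h
    rw [Nat.count_add]
    have := count_le (fun k => P (m + k)) d
    omega
  · have := Nat.count_monotone P h
    omega

theorem count_lt_eq {n m : ℕ} : Nat.count (fun k => k < m) n = min n m := by
  induction n with
  | zero => simp
  | succ n ih => rw [Nat.count_succ, ih]; split <;> omega

/-- The number of initial indices that satisfy a condition true exactly below `m`. -/
theorem count_eq_of_iff_lt {P : ℕ → Prop} [DecidablePred P] {n m : ℕ} (hm : m ≤ n)
    (h : ∀ k < n, (P k ↔ k < m)) : Nat.count P n = m := by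
  rw [count_congr h, count_lt_eq]; omega

/-- The number whose binary digits below `r` are given by `P`. -/
def bits (P : ℕ → Prop) [DecidablePred P] (r : ℕ) : ℕ := pack 1 (fun i => if P i then 1 else 0) r

theorem testBit_eq_digit (x i : ℕ) : x.testBit i = true ↔ digit 1 x i = 1 := by
  rw [Nat.testBit_eq_decide_div_mod_eq]; simp [digit]

theorem bits_lt (P : ℕ → Prop) [DecidablePred P] (r : ℕ) : bits P r < 2 ^ r := by
  have := pack_lt (u := 1) (n := r) (f := fun i => if P i then 1 else 0)
    (fun i _ => by split <;> norm_num)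
  simpa [bits] using this

theorem testBit_bits (P : ℕ → Prop) [DecidablePred P] (r i : ℕ) :
    (bits P r).testBit i = true ↔ i < r ∧ P i := by
  have hf : ∀ i < r, (if P i then 1 else 0) < 2 ^ 1 := fun i _ => by split <;> norm_num
  rw [testBit_eq_digit, bits]
  by_cases hi : i < r
  · rw [digit_pack hf hi]; simp [hi]
  · rw [digit_pack_of_le hf (not_lt.1 hi)]; simp [hi]

theorem testBit_chunk (c x t e : ℕ) :
    (chunk 1 c x t).testBit e = true ↔ e < c ∧ x.testBit (t * c + e) = true := by
  by_cases he : e < c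
  · rw [testBit_eq_digit, digit_chunk he, ← testBit_eq_digit]; simp [he]
  · have := chunk_lt 1 c x t
    rw [one_mul] at this
    rw [Nat.testBit_lt_two_pow (this.trans_le (Nat.pow_le_pow_right two_pos (not_lt.1 he)))]
    simp [he]

end SlabRep

namespace SlabRep

/-! ### Searching among few long keys -/

/-- Division by `2 ^ e` keeps the prefix above the lowest `e` bits, so lengths of symmetric
differences translate into common prefixes. -/
theorem size_xor_le_iff {x y e : ℕ} : (x ^^^ y).size ≤ e ↔ x / 2 ^ e = y / 2 ^ e := by
  rw [Nat.size_le]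
  constructor
  · intro h
    have := Nat.xor_div_two_pow (a := x) (b := y) (n := e)
    rw [Nat.div_eq_of_lt h] at this
    exact Nat.xor_eq_zero_iff.1 this.symm
  · intro h
    have := Nat.xor_div_two_pow (a := x) (b := y) (n := e)
    rw [h, Nat.xor_self] at this
    exact (Nat.div_eq_zero_iff_lt (by positivity)).1 this

/-- The positions (plus one) of the highest bits in which successive keys differ. -/
def branch (y : ℕ → ℕ) (p : ℕ) : ℕ := (y p ^^^ y (p + 1)).size

/-- `i` is a leaf reached by a search that only inspects the branching bits: the inspected bit is
`σ p` at the branching between the keys `p` and `p + 1`. -/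
def IsLeaf (d : ℕ → ℕ) (σ : ℕ → Prop) (r i : ℕ) : Prop :=
  i ≤ r ∧
  (∀ p, i ≤ p → p < r → 0 < d p → (∀ l, i ≤ l → l < p → d l < d p) → ¬ σ p) ∧
  ∀ p < i, 0 < d p → (∀ l, p < l → l < i → d l < d p) → σ p

variable {y : ℕ → ℕ} {r : ℕ}

theorem div_eq_of_branch_le (e : ℕ) {i j : ℕ} (hij : i ≤ j)
    (h : ∀ l, i ≤ l → l < j → branch y l ≤ e) : y i / 2 ^ e = y j / 2 ^ e := by
  induction j, hij using Nat.le_induction with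
  | base => rfl
  | succ j hj ih =>
    rw [ih fun l hl hl' => h l hl (by omega)]
    exact size_xor_le_iff.1 (h j hj (by omega))

/-- By monotonicity the prefixes of the intermediate keys are squeezed between two equal ones. -/
theorem branch_le_of_div_eq (hy : Monotone y) {e i j l : ℕ} (h : y i / 2 ^ e = y j / 2 ^ e)
    (hil : i ≤ l) (hlj : l < j) : branch y l ≤ e := by
  rw [branch, size_xor_le_iff]
  have h1 := Nat.div_le_div_right (c := 2 ^ e) (hy hil)
  have h2 := Nat.div_le_div_right (c := 2 ^ e) (hy (Nat.le_succ l))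
  have h3 := Nat.div_le_div_right (c := 2 ^ e) (hy (show l + 1 ≤ j by omega))
  simp only [Nat.succ_eq_add_one] at h2
  omega

/-- The two keys agree above bit `e` and differ there; as they are in order, the first has the 0. -/
theorem branch_split (hy : Monotone y) {p e : ℕ} (h : branch y p = e + 1) :
    ∃ a, y p / 2 ^ e = 2 * a ∧ y (p + 1) / 2 ^ e = 2 * a + 1 := by
  have h1 : y p / 2 ^ (e + 1) = y (p + 1) / 2 ^ (e + 1) := size_xor_le_iff.1 h.le
  have h2 : y p / 2 ^ e ≠ y (p + 1) / 2 ^ e := fun h' => by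
    have := size_xor_le_iff.2 h'
    rw [← branch] at this
    omega
  have h3 := Nat.div_le_div_right (c := 2 ^ e) (hy (Nat.le_succ p))
  rw [pow_succ, ← Nat.div_div_eq_div_mul, ← Nat.div_div_eq_div_mul] at h1
  refine ⟨y p / 2 ^ e / 2, ?_, ?_⟩ <;> simp only [Nat.succ_eq_add_one] at h3 <;> omega

theorem testBit_iff_div (q e : ℕ) : q.testBit e = true ↔ q / 2 ^ e % 2 = 1 := by
  rw [Nat.testBit_eq_decide_div_mod_eq]; simp

/-- `x` and `z` part at bit `e`, and there `q` goes with `x`; the higher bits of the two differences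
are equal. -/
theorem xor_lt_xor_of_div {q x z e a : ℕ} (hx : x / 2 ^ e = a) (hz : z / 2 ^ e ≠ a)
    (ha : a / 2 = z / 2 ^ e / 2) (hq : q / 2 ^ e % 2 = a % 2) : q ^^^ x < q ^^^ z := by
  have h2 : (q ^^^ x) / 2 ^ e < (q ^^^ z) / 2 ^ e := by
    rw [Nat.xor_div_two_pow, Nat.xor_div_two_pow, hx]
    generalize z / 2 ^ e = c at *
    generalize q / 2 ^ e = s at *
    have e1 : (s ^^^ a) / 2 = (s ^^^ c) / 2 := by
      have h1 := Nat.xor_div_two_pow (a := s) (b := a) (n := 1)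
      have h2 := Nat.xor_div_two_pow (a := s) (b := c) (n := 1)
      simp only [pow_one] at h1 h2
      rw [h1, h2, ha]
    have e2 : (s ^^^ a) % 2 = (s + a) % 2 := by
      have := Nat.xor_mod_two_eq (m := s) (n := a)
      exact this
    have e3 : (s ^^^ c) % 2 = (s + c) % 2 := Nat.xor_mod_two_eq
    omega
  by_contra h
  exact absurd (Nat.div_le_div_right (c := 2 ^ e) (not_lt.1 h)) (by omega)

/-- A key with the least symmetric difference to `q` is a leaf: if `q` disagreed with it at one of
the inspected branchings, the key just across that branching would be closer to `q`. -/
theorem exists_isLeaf (hy : Monotone y) (q r : ℕ) :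
    ∃ i, IsLeaf (branch y) (fun p => q.testBit (branch y p - 1) = true) r i := by
  obtain ⟨i, hi, hmin⟩ := Finset.exists_min_image (Finset.range (r + 1)) (fun i => q ^^^ y i)
    ⟨0, by simp⟩
  simp only [Finset.mem_range] at hi hmin
  refine ⟨i, by omega, fun p hip hpr hd hl hb => ?_, fun p hpi hd hl => ?_⟩
  · obtain ⟨e, he⟩ := Nat.exists_eq_succ_of_ne_zero hd.ne'
    simp only [Nat.succ_eq_add_one] at he
    obtain ⟨a, ha, ha'⟩ := branch_split hy he
    have h1 := div_eq_of_branch_le (y := y) e hip fun l hl1 hl2 => by have := hl l hl1 hl2; omega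
    simp only [he, Nat.add_sub_cancel, testBit_iff_div] at hb
    have := xor_lt_xor_of_div (q := q) (x := y (p + 1)) (z := y i) ha' (by omega) (by omega)
      (by omega)
    exact absurd (hmin (p + 1) (by omega)) (by omega)
  · obtain ⟨e, he⟩ := Nat.exists_eq_succ_of_ne_zero hd.ne'
    simp only [Nat.succ_eq_add_one] at he
    obtain ⟨a, ha, ha'⟩ := branch_split hy he
    have h1 := div_eq_of_branch_le (y := y) e (show p + 1 ≤ i from hpi) fun l hl1 hl2 => by
      have := hl l (by omega) hl2; omega
    rw [he, Nat.add_sub_cancel, testBit_iff_div]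
    by_contra hb
    have := xor_lt_xor_of_div (q := q) (x := y p) (z := y i) ha (by omega) (by omega) (by omega)
    exact absurd (hmin p (by omega)) (by omega)

/-- No key shares a longer prefix with `q` than a leaf does, although the descent ignores all other
bits. Otherwise the highest branching between the leaf and the better key `j` lies in the prefix
common to `q` and `j`; there `q` has the bit of `j`, so the descent would have turned towards `j`.
-/
theorem IsLeaf.div_eq (hy : Monotone y) {q i : ℕ}
    (h : IsLeaf (branch y) (fun p => q.testBit (branch y p - 1) = true) r i) {j e : ℕ} (hj : j ≤ r)
    (hq : q / 2 ^ e = y j / 2 ^ e) : q / 2 ^ e = y i / 2 ^ e := by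
  obtain ⟨hi, hright, hleft⟩ := h
  by_contra hne
  have key : ∀ p E, branch y p = E + 1 → e ≤ E → q / 2 ^ E = y j / 2 ^ E := by
    intro p E _ hE
    obtain ⟨s, rfl⟩ := Nat.exists_eq_add_of_le hE
    rw [pow_add, ← Nat.div_div_eq_div_mul, ← Nat.div_div_eq_div_mul, hq]
  rcases lt_trichotomy i j with hij | rfl | hij
  · -- the first of the highest branchings from `i` to `j`
    have hex : ∃ p, i ≤ p ∧ p < j ∧ (∀ l, i ≤ l → l < p → branch y l < branch y p) ∧
        ∀ l, i ≤ l → l < j → branch y l ≤ branch y p := by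
      obtain ⟨p0, hp0, hmax⟩ := Finset.exists_max_image (Finset.Ico i j) (branch y)
        ⟨i, by simp [hij]⟩
      simp only [Finset.mem_Ico] at hp0 hmax
      classical
      have hP : ∃ p, i ≤ p ∧ p < j ∧ branch y p = branch y p0 := ⟨p0, hp0.1, hp0.2, rfl⟩
      obtain ⟨h1, h2, h3⟩ := Nat.find_spec hP
      refine ⟨Nat.find hP, h1, h2, fun l hl hl' => ?_, fun l hl hl' => (hmax l ⟨hl, hl'⟩).trans h3.ge⟩
      have := Nat.find_min hP hl'
      have h5 := hmax l ⟨hl, by omega⟩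
      rw [h3]
      exact lt_of_le_of_ne h5 fun h => this ⟨hl, by omega, h⟩
    obtain ⟨p, hip, hpj, hp, hmax⟩ := hex
    have hgt : e < branch y p := by
      by_contra hle
      exact hne (hq.trans (div_eq_of_branch_le e hij.le fun l h1 h2 => by
        have := hmax l h1 h2; omega).symm)
    obtain ⟨E, hE⟩ := Nat.exists_eq_succ_of_ne_zero (show branch y p ≠ 0 by omega)
    simp only [Nat.succ_eq_add_one] at hE
    obtain ⟨a, ha, ha'⟩ := branch_split hy hE
    have h1 := div_eq_of_branch_le (y := y) (E + 1) (show p ≤ j from hpj.le) fun l h1 h2 => by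
      have := hmax l (by omega) h2; omega
    have h2 := key p E hE (by omega)
    have h3 := Nat.div_le_div_right (c := 2 ^ E) (hy (show p + 1 ≤ j from hpj))
    rw [pow_succ, ← Nat.div_div_eq_div_mul, ← Nat.div_div_eq_div_mul] at h1
    refine hright p hip (by omega) (by omega) hp ?_
    simp only [hE, Nat.add_sub_cancel, testBit_iff_div]
    omega
  · exact hne hq
  · have hex : ∃ p, j ≤ p ∧ p < i ∧ (∀ l, p < l → l < i → branch y l < branch y p) ∧
        ∀ l, j ≤ l → l < i → branch y l ≤ branch y p := by
      obtain ⟨p0, hp0, hmax⟩ := Finset.exists_max_image (Finset.Ico j i) (branch y)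
        ⟨j, by simp [hij]⟩
      simp only [Finset.mem_Ico] at hp0 hmax
      classical
      -- The index is reversed so that `Nat.find` yields the last of the highest branchings, the one
      -- visible from the leaf on its right.
      have hP : ∃ p, j ≤ i - 1 - p ∧ p < i ∧ branch y (i - 1 - p) = branch y p0 :=
        ⟨i - 1 - p0, by omega, by omega, by congr 1; omega⟩
      obtain ⟨h1, h2, h3⟩ := Nat.find_spec hP
      refine ⟨i - 1 - Nat.find hP, h1, by omega, fun l hl hl' => ?_,
        fun l hl hl' => (hmax l ⟨hl, hl'⟩).trans h3.ge⟩
      have := Nat.find_min hP (m := i - 1 - l) (by omega)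
      have h5 := hmax l ⟨by omega, by omega⟩
      rw [h3]
      refine lt_of_le_of_ne h5 fun h => this ⟨by omega, by omega, ?_⟩
      rw [← h]; congr 1; omega
    obtain ⟨p, hjp, hpi, hp, hmax⟩ := hex
    have hgt : e < branch y p := by
      by_contra hle
      exact hne (hq.trans (div_eq_of_branch_le e hij.le fun l h1 h2 => by
        have := hmax l h1 h2; omega))
    obtain ⟨E, hE⟩ := Nat.exists_eq_succ_of_ne_zero (show branch y p ≠ 0 by omega)
    simp only [Nat.succ_eq_add_one] at hE
    obtain ⟨a, ha, ha'⟩ := branch_split hy hE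
    have h1 := div_eq_of_branch_le (y := y) (E + 1) (show j ≤ p from hjp) fun l h1 h2 => by
      have := hmax l (by omega) (by omega); omega
    have h2 := key p E hE (by omega)
    have h3 := Nat.div_le_div_right (c := 2 ^ E) (hy (show j ≤ p from hjp))
    rw [pow_succ, ← Nat.div_div_eq_div_mul, ← Nat.div_div_eq_div_mul] at h1
    have := hleft p hpi (by omega) hp
    simp only [hE, Nat.add_sub_cancel, testBit_iff_div] at this
    omega

/-- The number of keys below `q`, given the leaf `i` for `q`, the lengths `d`, for which
branchings the length of the symmetric difference of `q` and the key `i` is at least the length `d`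
of the branching, and whether this key is below `q`. -/
theorem IsLeaf.lt_iff (hy : Monotone y) {q i : ℕ}
    (h : IsLeaf (branch y) (fun p => q.testBit (branch y p - 1) = true) r i) {j : ℕ} (hj : j ≤ r) :
    y j < q ↔ (y i < q ∧ (j ≤ i ∨ ∀ l, i ≤ l → l < j → branch y l ≤ (q ^^^ y i).size)) ∨
      (¬ y i < q ∧ j < i ∧ ¬ ∀ l, j ≤ l → l < i → branch y l ≤ (q ^^^ y i).size) := by
  set s := (q ^^^ y i).size with hs
  have hqs : q / 2 ^ s = y i / 2 ^ s := size_xor_le_iff.1 hs.ge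
  have hbelow : ∀ e, s = e + 1 → q / 2 ^ e ≠ y i / 2 ^ e := by
    intro e he h'
    have := size_xor_le_iff.2 h'
    omega
  have hsplit : ∀ e x, x / 2 ^ (e + 1) = x / 2 ^ e / 2 := fun e x => by
    rw [pow_succ, ← Nat.div_div_eq_div_mul]
  have hdiv := fun e => IsLeaf.div_eq hy h (e := e) hj
  have hs0 : s = 0 → q = y i := fun h0 => by simpa [h0] using hqs
  by_cases hlt : y i < q
  · simp only [hlt, true_and, not_true_eq_false, false_and, or_false]
    rcases le_or_gt j i with hji | hij
    · simp only [hji, true_or, iff_true]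
      exact (hy hji).trans_lt hlt
    · simp only [not_le.2 hij, false_or]
      constructor
      · intro hjq l h1 h2
        have h3 := Nat.div_le_div_right (c := 2 ^ s) (hy hij.le)
        have h4 := Nat.div_le_div_right (c := 2 ^ s) hjq.le
        exact branch_le_of_div_eq hy (j := j) (by omega) h1 h2
      · intro hall
        by_contra hjq
        have h1 := div_eq_of_branch_le s hij.le hall
        rcases Nat.eq_zero_or_eq_succ_pred s with h0 | h0
        · have := hs0 h0; omega
        · rw [Nat.succ_eq_add_one] at h0
          set e := s.pred
          -- At bit `e = s - 1` the query has 1 and the leaf's key 0. A key `y j ≥ q` with the same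
          -- prefix above has 1 there too, hence agrees with `q` further than the leaf does,
          -- contrary to `IsLeaf.div_eq`.
          have h2 := hbelow e h0
          rw [h0] at h1 hqs
          rw [hsplit, hsplit] at h1 hqs
          have h3 := Nat.div_le_div_right (c := 2 ^ e) hlt.le
          have h4 := Nat.div_le_div_right (c := 2 ^ e) (not_lt.1 hjq)
          exact h2 (hdiv e (by omega))
  · simp only [hlt, false_and, not_false_eq_true, true_and, false_or]
    rw [not_lt] at hlt
    constructor
    · intro hjq
      have hji : j < i := by
        by_contra hji
        have := hy (not_lt.1 hji)
        omega
      refine ⟨hji, fun hall => ?_⟩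
      have h1 := div_eq_of_branch_le s hji.le hall
      rcases Nat.eq_zero_or_eq_succ_pred s with h0 | h0
      · have := hs0 h0
        rw [h0] at h1
        simp at h1
        omega
      · rw [Nat.succ_eq_add_one] at h0
        set e := s.pred
        have h2 := hbelow e h0
        rw [h0] at h1 hqs
        rw [hsplit, hsplit] at h1 hqs
        have h3 := Nat.div_le_div_right (c := 2 ^ e) hlt
        have h4 := Nat.div_le_div_right (c := 2 ^ e) hjq.le
        exact h2 (hdiv e (by omega))
    · rintro ⟨hji, hall⟩
      by_contra hjq
      refine hall fun l h1 h2 => ?_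
      have h3 := Nat.div_le_div_right (c := 2 ^ s) (hy hji.le)
      have h4 := Nat.div_le_div_right (c := 2 ^ s) (not_lt.1 hjq)
      exact branch_le_of_div_eq hy (j := i) (by omega) h1 h2

end SlabRep

namespace SlabRep

/-! ### The sequence of endpoints -/

/-- Among the first `x` entries of `c`, those that belong to slab `k`. -/
def cntSlab (c : ℕ → ℕ) (k x : ℕ) : ℕ := Nat.count (fun p => c p / 2 = k) x

/-- Among the first `x` entries of `c`, the left endpoints in the slabs `1, …, j`. -/
def cntLeft (c : ℕ → ℕ) (j x : ℕ) : ℕ :=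
  Nat.count (fun p => c p % 2 = 0 ∧ 1 ≤ c p / 2 ∧ c p / 2 ≤ j) x

/-- Among the first `x` entries of `c`, the right endpoints in the slabs `1, …, j`. -/
def cntRight (c : ℕ → ℕ) (j x : ℕ) : ℕ :=
  Nat.count (fun p => c p % 2 = 1 ∧ 1 ≤ c p / 2 ∧ c p / 2 ≤ j) x

/-- Right endpoints below this coordinate end before the vertical line at `i`. -/
def Convention.bound : Convention → ℕ → ℕ
  | .closed, i => i
  | .halfOpen, i => i + 1

def rank (c : ℕ → ℕ) (v : Convention) (i j : ℕ) : ℕ :=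
  cntLeft c j (i + 1) - cntRight c j (v.bound i)

/-- `c` describes the endpoints by increasing `x`-coordinate, as `2 * slab` for left endpoints and
`2 * slab + 1` for right endpoints, and is `0` elsewhere. -/
structure IsSeq (n Δ : ℕ) (c : ℕ → ℕ) : Prop where
  zero : c 0 = 0
  eq_zero : ∀ p, 2 * n < p → c p = 0
  le : ∀ p, c p ≤ 2 * Δ + 1
  count_right_le : ∀ k x, 1 ≤ k → Nat.count (fun p => c p = 2 * k + 1) x ≤
    Nat.count (fun p => c p = 2 * k) x

/-- The operations in terms of the sequence of endpoints. -/
def Spec (n Δ : ℕ) (c : ℕ → ℕ) (v : Convention) : Op → ℕ → ℕ → ℕ → Prop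
  | .slabSelect, i, j, k => i ≤ 2 * n ∧ 1 ≤ j ∧ j ≤ 2 * n ∧ 1 ≤ k ∧ k ≤ Δ ∧
      rank c v i (k - 1) < j ∧ j ≤ rank c v i k
  | .slabRank, i, j, m => i ≤ 2 * n ∧ j ≤ Δ ∧ rank c v i j = m
  | .endpointSelect, k, i, p => 1 ≤ k ∧ k ≤ Δ ∧ 1 ≤ i ∧ i ≤ 2 * n ∧ p ≤ 2 * n ∧
      cntSlab c k p + 1 = i ∧ cntSlab c k (p + 1) = i
  | .endpointRank, k, i, m => 1 ≤ k ∧ k ≤ Δ ∧ i ≤ 2 * n ∧ cntSlab c k (i + 1) = m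

variable {n : ℕ}

def endpointCode (slab : Fin n → ℕ) (e : Fin n ⊕ Fin n) : ℕ :=
  Sum.elim (fun s => 2 * slab s) (fun s => 2 * slab s + 1) e

open Classical in
noncomputable def Segments.seq (L : Segments n) (slab : Fin n → ℕ) (p : ℕ) : ℕ :=
  if h : ∃ e, L.x e = p then endpointCode slab h.choose else 0

theorem Segments.x_injective (L : Segments n) : Function.Injective L.x :=
  Set.injOn_univ.1 L.bijOn.injOn

theorem Segments.seq_x (L : Segments n) (slab : Fin n → ℕ) (e : Fin n ⊕ Fin n) :
    L.seq slab (L.x e) = endpointCode slab e := by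
  have h : ∃ e', L.x e' = L.x e := ⟨e, rfl⟩
  rw [Segments.seq, dif_pos h, L.x_injective h.choose_spec]

theorem Segments.x_mem (L : Segments n) (e : Fin n ⊕ Fin n) : 1 ≤ L.x e ∧ L.x e ≤ 2 * n :=
  L.bijOn.mapsTo (Set.mem_univ e)

theorem Segments.exists_of_seq_ne_zero {L : Segments n} {slab : Fin n → ℕ} {p : ℕ}
    (h : L.seq slab p ≠ 0) : ∃ e, L.x e = p := by
  by_contra hp
  exact h (dif_neg hp)

/-- The hypothesis `¬ Q 0` discards positions without an endpoint, which carry 0. -/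
theorem Segments.count_seq (L : Segments n) (slab : Fin n → ℕ) (Q : ℕ → Prop) [DecidablePred Q]
    (h0 : ¬ Q 0) (x : ℕ) : Nat.count (fun p => Q (L.seq slab p)) x =
      {e | Q (endpointCode slab e) ∧ L.x e < x}.ncard := by
  rw [Nat.count_eq_card_filter_range, ← Set.ncard_coe_finset,
    ← Set.ncard_image_of_injective _ L.x_injective]
  congr 1
  ext p
  simp only [Finset.coe_filter, Finset.mem_range, Set.mem_ofPred_eq, Set.mem_image]
  constructor
  · rintro ⟨hp, hQ⟩
    obtain ⟨e, rfl⟩ := Segments.exists_of_seq_ne_zero (L := L) (slab := slab) (p := p)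
      (fun h => h0 (h ▸ hQ))
    exact ⟨e, ⟨by rwa [L.seq_x] at hQ, hp⟩, rfl⟩
  · rintro ⟨e, ⟨hQ, hx⟩, rfl⟩
    exact ⟨hx, by rwa [L.seq_x]⟩

theorem Segments.count_left (L : Segments n) (slab : Fin n → ℕ) (Q : ℕ → Prop) [DecidablePred Q]
    (h0 : ¬ Q 0) (x : ℕ) : Nat.count (fun p => L.seq slab p % 2 = 0 ∧ Q (L.seq slab p / 2)) x =
      {s | Q (slab s) ∧ L.left s < x}.ncard := by
  rw [L.count_seq slab (fun q => q % 2 = 0 ∧ Q (q / 2)) (by simpa using h0),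
    ← Set.ncard_image_of_injective {s | Q (slab s) ∧ L.left s < x} Sum.inl_injective]
  congr 1
  ext e
  cases e <;> simp [endpointCode, Segments.x, Nat.add_mod]

theorem Segments.count_right (L : Segments n) (slab : Fin n → ℕ) (Q : ℕ → Prop) [DecidablePred Q]
    (x : ℕ) : Nat.count (fun p => L.seq slab p % 2 = 1 ∧ Q (L.seq slab p / 2)) x =
      {s | Q (slab s) ∧ L.right s < x}.ncard := by
  rw [L.count_seq slab (fun q => q % 2 = 1 ∧ Q (q / 2)) (by simp),
    ← Set.ncard_image_of_injective {s | Q (slab s) ∧ L.right s < x} Sum.inr_injective]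
  congr 1
  ext e
  have h2 : ∀ a, (2 * a + 1) / 2 = a := fun a => by omega
  cases e <;> simp [endpointCode, Segments.x, Nat.add_mod, h2]

theorem Segments.isSeq (L : Segments n) {Δ : ℕ} {slab : Fin n → ℕ} (h : IsSlabPartition Δ slab) :
    IsSeq n Δ (L.seq slab) := by
  have hc : ∀ e, 2 ≤ endpointCode slab e ∧ endpointCode slab e ≤ 2 * Δ + 1 := by
    intro e
    cases e with
    | inl s => have := h.mem s; simp only [Set.mem_Icc] at this; simp [endpointCode]; omega
    | inr s => have := h.mem s; simp only [Set.mem_Icc] at this; simp [endpointCode]; omega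
  refine ⟨?_, ?_, ?_, ?_⟩
  · by_contra h0
    obtain ⟨e, he⟩ := Segments.exists_of_seq_ne_zero h0
    have := (L.x_mem e).1
    omega
  · intro p hp
    by_contra h0
    obtain ⟨e, he⟩ := Segments.exists_of_seq_ne_zero h0
    have := (L.x_mem e).2
    omega
  · intro p
    by_cases h0 : L.seq slab p = 0
    · omega
    · obtain ⟨e, rfl⟩ := Segments.exists_of_seq_ne_zero h0
      rw [L.seq_x]
      exact (hc e).2
  · intro k x hk
    have h1 := L.count_left slab (fun q => q = k) (by omega) x
    have h2 := L.count_right slab (fun q => q = k) x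
    rw [count_congr (Q := fun p => L.seq slab p % 2 = 1 ∧ L.seq slab p / 2 = k)
      (fun i _ => by omega), h2, count_congr (P := fun p => L.seq slab p = 2 * k)
      (Q := fun p => L.seq slab p % 2 = 0 ∧ L.seq slab p / 2 = k) (fun i _ => by omega), h1]
    refine Set.ncard_le_ncard (fun s hs => ⟨hs.1, (L.left_lt_right s).trans hs.2⟩)
      (Set.toFinite _)

/-- A segment that has ended has also begun, so the difference of the two counts is the count of a
set difference. The convention only decides whether a right endpoint at `i` itself is already past.
-/
theorem Segments.rank_seq (L : Segments n) (slab : Fin n → ℕ) (v : Convention) (i j : ℕ) :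
    rank (L.seq slab) v i j = {s | L.Crosses i s v ∧ slab s ∈ Set.Icc 1 j}.ncard := by
  rw [rank, cntLeft, cntRight, L.count_left slab (fun q => 1 ≤ q ∧ q ≤ j) (by omega),
    L.count_right slab (fun q => 1 ≤ q ∧ q ≤ j), ← Set.ncard_sdiff _ (Set.toFinite _)]
  · congr 1
    ext s
    have := L.left_lt_right s
    cases v <;> simp only [Set.mem_sdiff, Set.mem_ofPred_eq, Segments.Crosses, Set.mem_Icc,
      Convention.bound] <;> omega
  · intro s hs
    have := L.left_lt_right s
    simp only [Set.mem_ofPred_eq] at hs ⊢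
    refine ⟨hs.1, ?_⟩
    cases v <;> simp only [Convention.bound] at hs <;> omega

theorem Segments.cntSlab_seq (L : Segments n) (slab : Fin n → ℕ) {k : ℕ} (hk : 1 ≤ k) (x : ℕ) :
    cntSlab (L.seq slab) k x = {e | slab (segmentOf e) = k ∧ L.x e < x}.ncard := by
  rw [cntSlab, L.count_seq slab (fun q => q / 2 = k) (by simp; omega)]
  congr 1
  ext e
  have h2 : ∀ a, (2 * a + 1) / 2 = a := fun a => by omega
  cases e <;> simp [endpointCode, segmentOf, h2]

/-- Slabs are monotone in y. Therefore the slab of the `j`th crossing segment is where the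
cumulative count over slabs first reaches `j`, and individual y-coordinates are not needed. -/
theorem spec_of_isAnswer {L : Segments n} {v : Convention} {Δ : ℕ} {slab : Fin n → ℕ}
    (h : IsSlabPartition Δ slab) {o : Op} {a b z : ℕ} (ho : IsAnswer L v Δ slab o a b z) :
    Spec n Δ (L.seq slab) v o a b z := by
  cases o with
  | slabSelect =>
    obtain ⟨hi, s, hs, hj, hz⟩ := ho
    have hm := h.mem s
    rw [hz, Set.mem_Icc] at hm
    refine ⟨hi, ?_, ?_, hm.1, hm.2, ?_, ?_⟩
    · rw [← hj, Nat.one_le_iff_ne_zero]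
      exact Set.ncard_ne_zero_of_mem (a := s) ⟨hs, le_rfl⟩ (Set.toFinite _)
    · rw [← hj]
      refine (Set.ncard_le_card _).trans ?_
      simp; omega
    · rw [L.rank_seq, ← hj]
      refine Set.ncard_lt_ncard ⟨fun t ht => ⟨ht.1, ?_⟩, fun hsub => ?_⟩ (Set.toFinite _)
      · by_contra hlt
        have h1 := h.mono (not_le.1 hlt).le
        have h2 := ht.2
        rw [Set.mem_Icc] at h2
        omega
      · have h2 := (hsub ⟨hs, le_rfl⟩).2
        rw [Set.mem_Icc] at h2
        omega
    · rw [L.rank_seq, ← hj]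
      refine Set.ncard_le_ncard (fun t ht => ⟨ht.1, ?_⟩) (Set.toFinite _)
      have h1 := h.mono ht.2
      have h2 := h.mem t
      rw [Set.mem_Icc] at h2 ⊢
      omega
  | slabRank =>
    obtain ⟨hi, hj, hm⟩ := ho
    exact ⟨hi, hj, by rw [L.rank_seq, hm]⟩
  | endpointSelect =>
    obtain ⟨hk, e, he, hi, hp⟩ := ho
    rw [Set.mem_Icc] at hk
    have h1 : cntSlab (L.seq slab) a (z + 1) = b := by
      rw [L.cntSlab_seq slab hk.1, ← hi, ← hp]
      simp only [Nat.lt_succ_iff]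
    have h2 : cntSlab (L.seq slab) a z + 1 = b := by
      rw [← h1, cntSlab, cntSlab, Nat.count_succ, if_pos]
      rw [← hp, L.seq_x, ← he]
      have h2 : ∀ a, (2 * a + 1) / 2 = a := fun a => by omega
      cases e <;> simp [endpointCode, segmentOf, h2]
    have hx := L.x_mem e
    refine ⟨hk.1, hk.2, by omega, ?_, by omega, h2, h1⟩
    rw [← hi]
    refine (Set.ncard_le_card _).trans ?_
    simp; omega
  | endpointRank =>
    obtain ⟨hk, hi, hm⟩ := ho
    rw [Set.mem_Icc] at hk
    refine ⟨hk.1, hk.2, hi, ?_⟩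
    rw [L.cntSlab_seq slab hk.1, ← hm]
    simp only [Nat.lt_succ_iff]

end SlabRep

namespace SlabRep

/-! ### Monotonicity and bounds of the counts -/

section Counting

variable {n Δ : ℕ} {c : ℕ → ℕ}

theorem count_restrict (P : ℕ → Prop) [DecidablePred P] {x m : ℕ} (h : x ≤ m) :
    Nat.count (fun p => p < x ∧ P p) m = Nat.count P x := by
  rw [count_of_le h (fun i hi _ => by omega)]
  exact count_congr fun i hi => by simp [hi]

theorem cntLeft_succ (c : ℕ → ℕ) (j x : ℕ) :
    cntLeft c (j + 1) x = cntLeft c j x + Nat.count (fun p => c p = 2 * (j + 1)) x := by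
  unfold cntLeft
  induction x with
  | zero => simp
  | succ x ih => simp only [Nat.count_succ, ih]; split_ifs <;> omega

theorem cntRight_succ (c : ℕ → ℕ) (j x : ℕ) :
    cntRight c (j + 1) x = cntRight c j x + Nat.count (fun p => c p = 2 * (j + 1) + 1) x := by
  unfold cntRight
  induction x with
  | zero => simp
  | succ x ih => simp only [Nat.count_succ, ih]; split_ifs <;> omega

theorem cntSlab_eq (c : ℕ → ℕ) (k x : ℕ) : cntSlab c k x =
    Nat.count (fun p => c p = 2 * k) x + Nat.count (fun p => c p = 2 * k + 1) x := by
  unfold cntSlab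
  induction x with
  | zero => simp
  | succ x ih => simp only [Nat.count_succ, ih]; split_ifs <;> omega

theorem cntLeft_zero (c : ℕ → ℕ) (x : ℕ) : cntLeft c 0 x = 0 :=
  (count_of_le (Nat.zero_le x) fun i _ _ => by omega).trans (Nat.count_zero _)

theorem cntRight_zero (c : ℕ → ℕ) (x : ℕ) : cntRight c 0 x = 0 :=
  (count_of_le (Nat.zero_le x) fun i _ _ => by omega).trans (Nat.count_zero _)

theorem Convention.bound_le (v : Convention) (i : ℕ) : v.bound i ≤ i + 1 := by
  cases v <;> simp [Convention.bound]

theorem Convention.le_bound (v : Convention) (i : ℕ) : i ≤ v.bound i := by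
  cases v <;> simp [Convention.bound]

theorem IsSeq.cntRight_le (h : IsSeq n Δ c) (j : ℕ) {x y : ℕ} (hxy : x ≤ y) :
    cntRight c j x ≤ cntLeft c j y := by
  refine le_trans ?_ (Nat.count_monotone _ hxy)
  change _ ≤ cntLeft c j x
  induction j with
  | zero => rw [cntRight_zero]; omega
  | succ j ih =>
    rw [cntLeft_succ, cntRight_succ]
    have := h.count_right_le (j + 1) x (by omega)
    omega

/-- A further slab adds its left endpoints before `y` and removes its right endpoints before `x`,
which are no more, since left endpoints come first. The case `x = y` concerns `openCount`, the case
`x = v.bound i`, `y = i + 1` concerns `rank`. -/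
theorem IsSeq.diff_mono (h : IsSeq n Δ c) {x y : ℕ} (hxy : x ≤ y) :
    Monotone fun j => cntLeft c j y - cntRight c j x := by
  refine monotone_nat_of_le_succ fun j => ?_
  have h1 := h.cntRight_le j hxy
  have h2 := h.count_right_le (j + 1) x (by omega)
  have h3 := Nat.count_monotone (fun p => c p = 2 * (j + 1)) hxy
  simp only [cntLeft_succ, cntRight_succ]
  omega

theorem IsSeq.rank_mono (h : IsSeq n Δ c) (v : Convention) (i : ℕ) : Monotone (rank c v i) :=
  h.diff_mono (v.bound_le i)

theorem IsSeq.count_le_two_mul (h : IsSeq n Δ c) (P : ℕ → Prop) [DecidablePred P] (hP : ¬ P 0)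
    (x : ℕ) : Nat.count (fun p => P (c p)) x ≤ 2 * n := by
  have h1 : Nat.count (fun p => P (c p)) x ≤ Nat.count (fun p => P (c p)) (2 * n + 1 + x) :=
    Nat.count_monotone _ (by omega)
  rw [count_of_le (m := 2 * n + 1) (n := 2 * n + 1 + x) (by omega) fun i hi _ => by
    rw [h.eq_zero i (by omega)]; exact hP] at h1
  refine h1.trans ?_
  rw [add_comm, Nat.count_add]
  have h2 := SlabRep.count_le (fun k => P (c (1 + k))) (2 * n)
  have h3 : Nat.count (fun p => P (c p)) 1 = 0 := by
    simp [Nat.count_succ, h.zero, hP]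
  omega

theorem IsSeq.cntSlab_le (h : IsSeq n Δ c) {k : ℕ} (hk : 1 ≤ k) (x : ℕ) :
    cntSlab c k x ≤ 2 * n := h.count_le_two_mul (fun q => q / 2 = k) (by omega) x

theorem IsSeq.cntLeft_le (h : IsSeq n Δ c) (j x : ℕ) : cntLeft c j x ≤ 2 * n :=
  h.count_le_two_mul (fun q => q % 2 = 0 ∧ 1 ≤ q / 2 ∧ q / 2 ≤ j) (by omega) x

theorem cntSlab_mono (c : ℕ → ℕ) (k : ℕ) : Monotone (cntSlab c k) := Nat.count_monotone _

end Counting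

/-! ### Few segments: scanning the whole sequence -/

namespace Expr

/-- Whether `p` is at most the number in the first memory word. -/
def guard : ℕ → Expr
  | 0 => lit 1
  | p + 1 => guard p * (lit 1 - op .eq (lit p) (ld (lit 0)))

def guardedSum (F : ℕ → Expr) (m : ℕ) : Expr := sum (fun p => guard p * F p) m

/-- Position 0 is excluded because memory word 0 holds `2 * n` and not the entry of the sequence
there, which is 0. -/
def posBelow (p : ℕ) (x e : Expr) : Expr :=
  match p with
  | 0 => lit 0
  | p + 1 => op .lt (lit (p + 1)) x * e

def scanSlab (m : ℕ) (k x : Expr) : Expr :=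
  guardedSum (fun p => posBelow p x (op .eq (ld (lit p) / lit 2) k)) m

def scanSide (m s : ℕ) (j x : Expr) : Expr :=
  guardedSum (fun p => posBelow p x (op .eq (ld (lit p) % lit 2) (lit s) *
    (op .lt (lit 0) (ld (lit p) / lit 2) * (lit 1 - op .lt j (ld (lit p) / lit 2))))) m

def bound (v : Convention) (i : Expr) : Expr :=
  match v with
  | .closed => i
  | .halfOpen => i + lit 1

def scanRank (m : ℕ) (v : Convention) (i j : Expr) : Expr :=
  scanSide m 0 j (i + lit 1) - scanSide m 1 j (bound v i)

def scan (m : ℕ) (v : Convention) : Op → Expr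
  | .slabSelect => guardedSum (fun k => op .lt (scanRank m v arg0 (lit k)) arg1) m
  | .slabRank => scanRank m v arg0 arg1
  | .endpointSelect => guardedSum (fun p => op .lt (scanSlab m arg0 (lit (p + 1))) arg1) m
  | .endpointRank => scanSlab m arg0 (arg1 + lit 1)

end Expr

theorem Ev.ind_mul {w : ℕ} {M : List (BitVec w)} {a b : BitVec w} {e f : Expr} {p q : Prop}
    [Decidable p] [Decidable q] (he : Ev M a b e (if p then 1 else 0))
    (hf : Ev M a b f (if q then 1 else 0)) : Ev M a b (e * f) (if p ∧ q then 1 else 0) := by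
  have h1 := hf.lt
  refine (he.mul hf ?_).congr ?_
  · split
    · simpa using h1
    · simp
  · split_ifs <;> first | rfl | tauto

structure IsScanMemory {w : ℕ} (n Δ : ℕ) (c : ℕ → ℕ) (M : List (BitVec w)) : Prop where
  isSeq : IsSeq n Δ c
  lt : 2 * n < 2 ^ w
  width : 2 ≤ w
  head : (M.getD 0 0).toNat = 2 * n
  get : ∀ p, 1 ≤ p → p ≤ 2 * n → (M.getD p 0).toNat = c p

namespace IsScanMemory

open SlabRep.Expr

variable {w n Δ m : ℕ} {c : ℕ → ℕ} {M : List (BitVec w)} {a b : BitVec w}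

theorem succ_lt (h : IsScanMemory n Δ c M) : 2 * n + 1 < 2 ^ w := by
  have h1 := h.lt
  have h2 : 2 ∣ 2 ^ w := dvd_pow_self 2 (by have := h.width; omega)
  omega

theorem four_le (h : IsScanMemory n Δ c M) : 4 ≤ 2 ^ w :=
  (Nat.pow_le_pow_right two_pos h.width)

/-- A direct comparison with the literal `p` could fail, as literals are reduced modulo `2 ^ w` and
the program does not know `w`. The product turns 0 right after `2 * n`, while literals still fit,
and then remains 0. -/
theorem guard (h : IsScanMemory n Δ c M) (p : ℕ) :
    Ev M a b (guard p) (if p ≤ 2 * n then 1 else 0) := by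
  have h4 := h.four_le
  have hw := h.width
  induction p with
  | zero => exact (Ev.lit (by omega)).congr (by simp)
  | succ p ih =>
    by_cases hp : p ≤ 2 * n
    · have h1 : Ev M a b (.ld (.lit 0)) (2 * n) := Ev.ld (Ev.lit (by omega)) h.head
      have h2 := Ev.eqOp (by omega) (Ev.lit (M := M) (a := a) (b := b) (x := p)
        (by have := h.lt; omega)) h1
      have h3 := Ev.one_sub (by omega) h2
      rw [if_pos hp] at ih
      have h5 := h3.lt
      refine (ih.mul h3 (by simpa using h5)).congr ?_
      split_ifs <;> omega
    · rw [if_neg hp] at ih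
      exact (Ev.mul_zero_left ih _).congr (by rw [if_neg]; omega)

theorem guardedSum (h : IsScanMemory n Δ c M) (hm : 2 * n < m) {F : ℕ → Expr} {P : ℕ → Prop}
    [DecidablePred P] (hF : ∀ p ≤ 2 * n, Ev M a b (F p) (if P p then 1 else 0)) :
    Ev M a b (guardedSum F m) (Nat.count P (2 * n + 1)) := by
  have h4 := h.four_le
  have hsum : ∑ i ∈ Finset.range m, (if i < 2 * n + 1 ∧ P i then 1 else 0)
      = Nat.count P (2 * n + 1) := by
    rw [← count_restrict P (show 2 * n + 1 ≤ m from hm), Nat.count_eq_card_filter_range,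
      Finset.card_filter]
  rw [← hsum]
  refine Ev.sum (fun p _ => ?_) ?_
  · have hg := h.guard (a := a) (b := b) p
    by_cases hp : p ≤ 2 * n
    · refine (hg.ind_mul (hF p hp)).congr ?_
      simp only [Nat.lt_succ_iff]
    · rw [if_neg hp] at hg
      exact (Ev.mul_zero_left hg _).congr (by rw [if_neg]; omega)
  · rw [hsum]
    exact (count_le _ _).trans_lt h.succ_lt

theorem posBelow (h : IsScanMemory n Δ c M) {p x : ℕ} {X e : Expr} {P : Prop} [Decidable P]
    (hX : Ev M a b X x) (hp : p ≤ 2 * n) (h0 : p = 0 → ¬ P)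
    (he : 1 ≤ p → Ev M a b e (if P then 1 else 0)) :
    Ev M a b (posBelow p X e) (if p < x ∧ P then 1 else 0) := by
  have := h.lt
  have hw := h.width
  cases p with
  | zero => exact (Ev.lit (by omega)).congr (by rw [if_neg]; exact fun h => h0 rfl h.2)
  | succ p => exact (Ev.ltOp (by omega) (Ev.lit (by omega)) hX).ind_mul (he (by omega))

theorem word (h : IsScanMemory n Δ c M) {p : ℕ} (h1 : 1 ≤ p) (hp : p ≤ 2 * n) :
    Ev M a b (.ld (.lit p)) (c p) :=
  Ev.ld (Ev.lit (by have := h.lt; omega)) (h.get p h1 hp)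

theorem scanSlab (h : IsScanMemory n Δ c M) (hm : 2 * n < m) {K X : Expr} {k x : ℕ} (hk : 1 ≤ k)
    (hx : x ≤ 2 * n + 1) (hK : Ev M a b K k) (hX : Ev M a b X x) :
    Ev M a b (scanSlab m K X) (cntSlab c k x) := by
  have h4 := h.four_le
  have hw := h.width
  rw [cntSlab, ← count_restrict _ hx]
  refine h.guardedSum hm fun p hp => h.posBelow hX hp ?_ fun h1 => ?_
  · rintro rfl
    rw [h.isSeq.zero]
    omega
  · exact Ev.eqOp (by omega) ((h.word h1 hp).div (Ev.lit (by omega))) hK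

theorem scanSide (h : IsScanMemory n Δ c M) (hm : 2 * n < m) {J X : Expr} {s j x : ℕ} (hs : s < 4)
    (hx : x ≤ 2 * n + 1) (hJ : Ev M a b J j) (hX : Ev M a b X x) :
    Ev M a b (scanSide m s J X)
      (Nat.count (fun p => c p % 2 = s ∧ 1 ≤ c p / 2 ∧ c p / 2 ≤ j) x) := by
  have h4 := h.four_le
  have hw := h.width
  have hw0 : 0 < w := by omega
  rw [← count_restrict _ hx]
  refine h.guardedSum hm fun p hp => h.posBelow hX hp ?_ fun h1 => ?_
  · rintro rfl
    rw [h.isSeq.zero]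
    omega
  · have hd := (h.word (a := a) (b := b) h1 hp).div (Ev.lit (x := 2) (by omega))
    have hm := (h.word (a := a) (b := b) h1 hp).mod (Ev.lit (x := 2) (by omega))
    refine (Ev.eqOp hw0 hm (Ev.lit (by omega))).ind_mul
      ((Ev.ltOp hw0 (Ev.lit (by omega)) hd).ind_mul
        ((Ev.one_sub hw0 (Ev.ltOp hw0 hJ hd)).congr ?_))
    split_ifs <;> omega

theorem scanRank (h : IsScanMemory n Δ c M) (hm : 2 * n < m) (v : Convention) {I J : Expr}
    {i j : ℕ} (hi : i ≤ 2 * n) (hI : Ev M a b I i) (hJ : Ev M a b J j) :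
    Ev M a b (scanRank m v I J) (rank c v i j) := by
  have h4 := h.four_le
  have h5 := h.succ_lt
  have hI' := hI.add (Ev.lit (x := 1) (by omega)) (by omega)
  refine (h.scanSide hm (by omega) (by omega) hJ hI').sub
    (h.scanSide hm (by omega) ?_ hJ (x := v.bound i) ?_) (h.isSeq.cntRight_le j (v.bound_le i))
  · have := v.bound_le i; omega
  · cases v
    · exact hI
    · exact hI'

/-- A selection is the number of arguments at which a monotone rank is still below the target. `Δ ≤
2 * n` puts every slab into the range of the sum. -/
theorem scan (h : IsScanMemory n Δ c M) (hm : 2 * n < m) (hΔ : Δ ≤ 2 * n) (v : Convention)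
    {o : Op} {x y z : ℕ} (ho : Spec n Δ c v o x y z) :
    Ev M (BitVec.ofNat w x) (BitVec.ofNat w y) (scan m v o) z := by
  have h4 := h.four_le
  have h5 := h.succ_lt
  have hw : 0 < w := by have := h.width; omega
  cases o with
  | slabSelect =>
    obtain ⟨hx, hy1, hy, hz1, hz, hlt, hle⟩ := ho
    refine (h.guardedSum hm (P := fun k => rank c v x k < y) fun k hk => Ev.ltOp hw
      (h.scanRank hm v hx (Ev.arg0 (by omega)) (Ev.lit (by omega)))
      (Ev.arg1 (by omega))).congr ?_
    refine count_eq_of_iff_lt (by omega) fun k _ => ?_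
    constructor
    · intro hk
      by_contra hzk
      exact absurd (h.isSeq.rank_mono v x (not_lt.1 hzk)) (by omega)
    · intro hk
      exact (h.isSeq.rank_mono v x (show k ≤ z - 1 by omega)).trans_lt hlt
  | slabRank =>
    obtain ⟨hx, hy, rfl⟩ := ho
    exact h.scanRank hm v hx (Ev.arg0 (by omega)) (Ev.arg1 (by omega))
  | endpointSelect =>
    obtain ⟨hx1, hx, hy1, hy, hz, h1, h2⟩ := ho
    refine (h.guardedSum hm (P := fun p => cntSlab c x (p + 1) < y) fun p hp => Ev.ltOp hw
      (h.scanSlab hm hx1 (by omega) (Ev.arg0 (by omega)) (Ev.lit (by omega)))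
      (Ev.arg1 (by omega))).congr ?_
    refine count_eq_of_iff_lt (by omega) fun p _ => ?_
    constructor
    · intro hk
      by_contra hzk
      have := cntSlab_mono c x (show z + 1 ≤ p + 1 by omega)
      omega
    · intro hk
      have := cntSlab_mono c x (show p + 1 ≤ z by omega)
      omega
  | endpointRank =>
    obtain ⟨hx1, hx, hy, rfl⟩ := ho
    exact h.scanSlab hm hx1 (by omega) (Ev.arg0 (by omega))
      ((Ev.arg1 (by omega)).add (Ev.lit (by omega)) (by omega))

end IsScanMemory

theorem exists_isScanMemory {w n Δ : ℕ} {c : ℕ → ℕ} (hc : IsSeq n Δ c) (hn : 2 * n < 2 ^ w)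
    (hw : 2 ≤ w) (hΔ : 2 * Δ + 1 < 2 ^ w) :
    ∃ M : List (BitVec w), M.length = 2 * n + 1 ∧ IsScanMemory n Δ c M := by
  refine ⟨(List.range (2 * n + 1)).map fun p => BitVec.ofNat w (if p = 0 then 2 * n else c p),
    by simp, hc, hn, hw, ?_, fun p hp hpn => ?_⟩
  · rw [List.getD_eq_getElem _ _ (by simp)]
    simp [Nat.mod_eq_of_lt hn]
  · rw [List.getD_eq_getElem _ _ (by simp; omega)]
    have := hc.le p
    simp only [List.getElem_map, List.getElem_range, BitVec.toNat_ofNat]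
    rw [if_neg (by omega), Nat.mod_eq_of_lt (by omega)]

end SlabRep

namespace SlabRep

/-! ### The data structure for many segments -/

/-- The parameters: `b` bits per endpoint and `G` endpoints per block, counters of `u` bits,
table arguments of `β` bits, groups of `s` endpoints to be looked up at once, `f` blocks per
superblock, and every `t`th endpoint of a slab is sampled. -/
structure Shape where
  (n w Δ b u β s G f t : ℕ)

namespace Shape

variable (S : Shape)

/-- The number of endpoints in the largest units. -/
def span : ℕ := S.G * S.f * S.f * S.f

def units : ℕ := 2 * S.n / S.span + 2

def samples : ℕ := 2 * S.n / S.t + 1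

/-- The lengths of the arrays that make up the data structure. -/
def len : ℕ → ℕ
  | 0 => 32
  | 1 => 16 * (2 ^ S.β) ^ 5
  | 2 => S.units * S.f * S.f * S.f
  | 3 => S.units * S.f * S.f * (S.Δ + 2) * 4
  | 4 => S.units * (S.Δ + 1)
  | 5 => S.units * S.f * (S.Δ + 1)
  | 6 => S.units * S.f * S.f * (S.Δ + 1)
  | 7 => S.units * (S.Δ + 1) * S.t
  | 8 => (S.Δ + 1) * S.samples
  | _ => 0

def base (i : ℕ) : ℕ := ∑ j ∈ Finset.range i, S.len j

def header : ℕ → ℕ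
  | 0 => 0
  | 1 => S.β
  | 2 => 2 ^ S.β
  | 3 => S.b
  | 4 => S.G
  | 5 => S.b * S.G
  | 6 => S.b * S.s
  | 7 => 2 ^ (S.b * S.s)
  | 8 => S.f
  | 9 => 2 ^ (S.b * S.G)
  | 10 => 2 ^ S.u - 1
  | 11 => S.t
  | 12 => S.Δ + 1
  | 13 => S.Δ + 2
  | 14 => S.samples
  | i => S.base (i - 16)

/-- The conditions on the parameters; `K` bounds the number of table lookups for one word. -/
structure Valid (K : ℕ) : Prop where
  slabs_pos : 1 ≤ S.Δ
  code_lt : 2 * S.Δ + 2 ≤ 2 ^ S.b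
  group_le : S.b * S.s ≤ S.β
  block_le_groups : S.G ≤ K * S.s
  block_pos : 0 < S.G
  word_bits : S.b * S.G + S.u * (2 * S.Δ + 2) ≤ S.w
  fan_pos : 0 < S.f
  fan_le : S.u * S.f ≤ S.β
  counters_le : S.u * (2 * S.Δ + 2) ≤ S.β
  span_lt : S.span + 1 < 2 ^ S.u
  width_lt : S.w < 2 ^ S.u
  arg_lt : 2 * S.n < 2 ^ (K * S.β)
  lookups_lt : K < 2 ^ S.β
  shift_lt : K * S.β < 2 ^ S.w
  n_lt : 2 * S.n < 2 ^ S.w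
  sample_pos : 0 < S.t
  total_lt : S.base 9 < 2 ^ S.w
  field_lt : S.β < S.w
  sample_lt : S.t < 2 ^ S.w

end Shape

/-- Letter 0 is not counted: masking a word to its first letters leaves zeros behind that would be
taken for occurrences. -/
def relCount (c : ℕ → ℕ) (X x q : ℕ) : ℕ :=
  if q = 0 then 0 else Nat.count (fun p => c p = q) x - Nat.count (fun p => c p = q) X

/-- The number of segments in the slabs `1, …, k` that begin but do not end before `X`. -/
def openCount (c : ℕ → ℕ) (X k : ℕ) : ℕ := cntLeft c k X - cntRight c k X

/-- The position of the endpoint of slab `k` that is preceded by `i` others. -/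
noncomputable def position (c : ℕ → ℕ) (k i : ℕ) : ℕ := sInf {p | i < cntSlab c k (p + 1)}

def sumLeft (u V j : ℕ) : ℕ := ∑ k ∈ Finset.range j, digit u V (2 * (k + 1))

def sumRight (u V j : ℕ) : ℕ := ∑ k ∈ Finset.range j, digit u V (2 * (k + 1) + 1)

def gapSum (u g i j : ℕ) : ℕ := ∑ l ∈ Finset.Ico i j, digit u g l

namespace Shape

variable (S : Shape) (c : ℕ → ℕ) (v : Convention)

open Classical in
/-- The functions that are tabulated. -/
noncomputable def table : ℕ → ℕ → ℕ → ℕ → ℕ → ℕ → ℕ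
  | 0, x, _, _, _, _ => pack S.u (fun q => if q = 0 then 0 else
      Nat.count (fun p => digit S.b x p = q) S.s) (2 * S.Δ + 2)
  | 1, V, k, _, _, _ => digit S.u V (2 * k) + digit S.u V (2 * k + 1)
  | 2, V, V', _, _, _ => pack S.u (fun q => if q % 2 = 0 then digit S.u V' q else
      digit S.u (match v with | .closed => V | .halfOpen => V') q) (2 * S.Δ + 2)
  | 3, V, j, _, _, _ => sumLeft S.u V j
  | 4, V, j, _, _, _ => sumRight S.u V j
  | 5, D, t, x, _, _ => bits (fun p => 0 < digit S.u D p ∧ (digit S.u D p - 1) / S.β = t ∧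
      x.testBit ((digit S.u D p - 1) % S.β) = true) S.Δ
  | 6, D, σ, _, _, _ => if h : ∃ i, IsLeaf (digit S.u D) (fun p => σ.testBit p = true) S.Δ i
      then h.choose else 0
  | 7, D, t, x, _, _ => bits (fun p => ∃ e < S.β, x.testBit e = true ∧
      digit S.u D p ≤ t * S.β + e + 1) S.Δ
  | 8, D, i, τ, b, _ => Nat.count (fun j =>
      (b = 1 ∧ (j ≤ i ∨ ∀ l, i ≤ l → l < j → digit S.u D l = 0 ∨ τ.testBit l = true)) ∨
      (b ≠ 1 ∧ j < i ∧ ¬ ∀ l, j ≤ l → l < i → digit S.u D l = 0 ∨ τ.testBit l = true))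
      (S.Δ + 1)
  | 9, g, k, x, x', V => Nat.count (fun j =>
      if j < k then sumLeft S.u V j < x + gapSum S.u g j (k - 1) + sumRight S.u V j
      else sumLeft S.u V j + (x' + gapSum S.u g k j) < sumRight S.u V j) (S.Δ + 1)
  | 10, x, r, _, _, _ => Nat.findGreatest (fun q => digit S.u x q ≤ r) (S.f - 1)
  | 11, x, k, _, _, _ => Nat.count (fun p => digit S.b x p / 2 = k) S.s
  | 12, x, k, r, _, _ => Nat.count (fun p =>
      Nat.count (fun p => digit S.b x p / 2 = k) (p + 1) < r) S.s
  | 13, x, i, _, _, _ => digit S.u x i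
  | _, _, _, _, _, _ => 0

noncomputable def tableEntry (i : ℕ) : ℕ :=
  let N := 2 ^ S.β
  S.table v (i % 16) (i / 16 % N) (i / 16 / N % N) (i / 16 / N / N % N) (i / 16 / N / N / N % N)
    (i / 16 / N / N / N / N % N)

def counters (X x : ℕ) : ℕ := pack S.u (relCount c X x) (2 * S.Δ + 2)

/-- The letters occupy the low part and the counters at the start of the block the high part, so one
read yields both. -/
def block (i : ℕ) : ℕ := pack S.b (fun p => c (i * S.G + p)) S.G +
  S.counters c (i / S.f * (S.G * S.f)) (i * S.G) * 2 ^ (S.b * S.G)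

/-- `X` is the start of the superblock. Rows 2 and 3 do not depend on `k` and are read at `k = 0`;
row 3 holds the gaps between consecutive keys, cut off at the largest value of a counter. -/
def superblock (X k : ℕ) : ℕ → ℕ
  | 0 => cntSlab c k X
  | 1 => openCount c X k
  | 2 => pack S.u (branch (openCount c X)) S.Δ
  | _ => pack S.u (fun l => min (openCount c X (l + 1) - openCount c X l) (2 ^ S.u - 1)) S.Δ

def node (size i k : ℕ) : ℕ := pack S.u (fun q =>
  cntSlab c k (i * (size * S.f) + q * size) - cntSlab c k (i * (size * S.f))) S.f

/-- Arrays 4, 5 and 6 are the levels of the tree inside the units. Array 7 lists, for each unit and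
slab, the positions of the `t` endpoints that follow the end of the unit; array 8 names the unit of
every `t`th endpoint of a slab. -/
noncomputable def entry : ℕ → ℕ → ℕ
  | 0, i => S.header i
  | 1, i => S.tableEntry v i
  | 2, i => S.block c i
  | 3, i => S.superblock c (i / 4 / (S.Δ + 2) * (S.G * S.f)) (i / 4 % (S.Δ + 2)) (i % 4)
  | 4, i => S.node c (S.G * S.f * S.f) (i / (S.Δ + 1)) (i % (S.Δ + 1))
  | 5, i => S.node c (S.G * S.f) (i / (S.Δ + 1)) (i % (S.Δ + 1))
  | 6, i => S.node c S.G (i / (S.Δ + 1)) (i % (S.Δ + 1))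
  | 7, i => position c (i / S.t % (S.Δ + 1))
      (cntSlab c (i / S.t % (S.Δ + 1)) ((i / S.t / (S.Δ + 1) + 1) * S.span) + i % S.t)
  | 8, i => position c (i / S.samples) (i % S.samples * S.t) / S.span
  | _, _ => 0

noncomputable def memory (k : ℕ) : List (BitVec S.w) :=
  (List.range k).flatMap fun i => (List.range (S.len i)).map fun j => BitVec.ofNat S.w (S.entry c v i j)

theorem length_memory (k : ℕ) : (S.memory c v k).length = S.base k := by
  induction k with
  | zero => rfl
  | succ k ih =>
    rw [memory, List.range_succ, List.flatMap_append, List.length_append]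
    rw [memory] at ih
    rw [ih, base, base, Finset.sum_range_succ]
    simp

theorem getD_memory {k i j : ℕ} (hi : i < k) (hj : j < S.len i) :
    (S.memory c v k).getD (S.base i + j) 0 = BitVec.ofNat S.w (S.entry c v i j) := by
  induction k with
  | zero => omega
  | succ k ih =>
    have hl := S.length_memory c v k
    have hm : S.memory c v (k + 1) = S.memory c v k ++
        (List.range (S.len k)).map fun j => BitVec.ofNat S.w (S.entry c v k j) := by
      simp [memory, List.range_succ, List.flatMap_append]
    rw [hm]
    rcases Nat.lt_succ_iff_lt_or_eq.1 hi with h | rfl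
    · rw [List.getD_append _ _ _ _ ?_, ih h]
      rw [hl]
      have h1 : S.base (i + 1) ≤ S.base k :=
        Finset.sum_le_sum_of_subset (Finset.range_mono h)
      rw [base, Finset.sum_range_succ, ← base] at h1
      omega
    · rw [List.getD_append_right _ _ _ _ (by omega), hl, Nat.add_sub_cancel_left,
        List.getD_eq_getElem _ _ (by simpa using hj)]
      simp

end Shape

namespace Expr

def hd (i : ℕ) : Expr := ld (lit i)

/-- Access to array `i`. -/
def acc (i : ℕ) (e : Expr) : Expr := ld (hd (16 + i) + e)

def look (i : ℕ) (e₁ : Expr) (e₂ e₃ e₄ e₅ : Expr := lit 0) : Expr :=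
  acc 1 ((e₁ + (e₂ + (e₃ + (e₄ + e₅ * hd 2) * hd 2) * hd 2) * hd 2) * lit 16 + lit i)

end Expr

/-- The data structure for many segments, in memory. -/
structure IsTableMemory (S : Shape) (K : ℕ) (c : ℕ → ℕ) (v : Convention)
    (M : List (BitVec S.w)) : Prop where
  valid : S.Valid K
  isSeq : IsSeq S.n S.Δ c
  eq : M = S.memory c v 9

namespace IsTableMemory

open SlabRep.Expr

variable {S : Shape} {K : ℕ} {c : ℕ → ℕ} {v : Convention} {M : List (BitVec S.w)}
  {a b : BitVec S.w}

theorem base_add_lt (h : IsTableMemory S K c v M) {i j : ℕ} (hi : i < 9) (hj : j < S.len i) :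
    S.base i + j < 2 ^ S.w := by
  have h1 : S.base (i + 1) ≤ S.base 9 :=
    Finset.sum_le_sum_of_subset (Finset.range_mono hi)
  rw [Shape.base, Finset.sum_range_succ, ← Shape.base] at h1
  have := h.valid.total_lt
  omega

theorem hd (h : IsTableMemory S K c v M) {i : ℕ} (hi : i < 32) (hv : S.header i < 2 ^ S.w) :
    Ev M a b (hd i) (S.header i) := by
  have h1 := h.base_add_lt (i := 0) (j := i) (by omega) hi
  have h0 : S.base 0 = 0 := rfl
  rw [h0, zero_add] at h1
  refine Ev.ld (Ev.lit h1) ?_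
  have h2 := S.getD_memory c v (k := 9) (i := 0) (j := i) (by omega) hi
  rw [h0, zero_add] at h2
  rw [h.eq, h2, BitVec.toNat_ofNat]
  exact Nat.mod_eq_of_lt hv

theorem acc (h : IsTableMemory S K c v M) {i j : ℕ} {e : Expr} (hi : i < 9) (hj : j < S.len i)
    (he : Ev M a b e j) (hv : S.entry c v i j < 2 ^ S.w) :
    Ev M a b (acc i e) (S.entry c v i j) := by
  have h1 := h.base_add_lt hi hj
  have h2 : S.header (16 + i) = S.base i := by
    have : 16 + i - 16 = i := by omega
    interval_cases i <;> rfl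
  refine Ev.ld (((h.hd (by omega) (by rw [h2]; omega)).congr h2).add he h1) ?_
  rw [h.eq, S.getD_memory c v hi hj, BitVec.toNat_ofNat, Nat.mod_eq_of_lt hv]

theorem width_pos (h : IsTableMemory S K c v M) : 0 < S.w := by
  have := h.valid.field_lt; omega

theorem field_lt (h : IsTableMemory S K c v M) : 2 ^ S.β < 2 ^ S.w :=
  Nat.pow_lt_pow_right one_lt_two h.valid.field_lt

theorem len_one_lt (h : IsTableMemory S K c v M) : 16 * (2 ^ S.β) ^ 5 < 2 ^ S.w := by
  have h1 : S.len 0 + S.len 1 ≤ S.base 9 := by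
    rw [show S.len 0 + S.len 1 = S.base 2 by simp [Shape.base, Finset.sum_range_succ]]
    exact Finset.sum_le_sum_of_subset (Finset.range_mono (by omega))
  have := h.valid.total_lt
  have h3 : S.len 1 = 16 * (2 ^ S.β) ^ 5 := rfl
  have h4 : S.len 0 = 32 := rfl
  omega

theorem thirtyTwo_lt (h : IsTableMemory S K c v M) : 32 < 2 ^ S.w := by
  have h1 : S.base 1 ≤ S.base 9 := Finset.sum_le_sum_of_subset (Finset.range_mono (by omega))
  have h2 : S.base 1 = 32 := by simp [Shape.base, Shape.len]
  have := h.valid.total_lt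
  omega

theorem step_index {i N r m : ℕ} (hi : i < N) (hr : r < m) : i + r * N < m * N := by
  have : (r + 1) * N ≤ m * N := Nat.mul_le_mul_right N hr
  rw [Nat.succ_mul] at this
  omega

theorem look (h : IsTableMemory S K c v M) {i x₁ x₂ x₃ x₄ x₅ : ℕ} {e₁ e₂ e₃ e₄ e₅ : Expr}
    (hi : i < 16) (h₁ : Ev M a b e₁ x₁) (l₁ : x₁ < 2 ^ S.β) (h₂ : Ev M a b e₂ x₂)
    (l₂ : x₂ < 2 ^ S.β) (h₃ : Ev M a b e₃ x₃) (l₃ : x₃ < 2 ^ S.β) (h₄ : Ev M a b e₄ x₄)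
    (l₄ : x₄ < 2 ^ S.β) (h₅ : Ev M a b e₅ x₅) (l₅ : x₅ < 2 ^ S.β)
    (hv : S.table v i x₁ x₂ x₃ x₄ x₅ < 2 ^ S.w) :
    Ev M a b (look i e₁ e₂ e₃ e₄ e₅) (S.table v i x₁ x₂ x₃ x₄ x₅) := by
  have hN := h.field_lt
  have hL := h.len_one_lt
  have h32 := h.thirtyTwo_lt
  have hhd : Ev M a b (Expr.hd 2) (2 ^ S.β) := h.hd (i := 2) (by omega) hN
  have hpos : 0 < 2 ^ S.β := by positivity
  set N := 2 ^ S.β with hNdef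
  have b4 := step_index l₄ l₅
  have b3 := step_index l₃ b4
  have b2 := step_index l₂ b3
  have b1 := step_index l₁ b2
  have b0 := step_index hi b1
  have hbig : N * N * N * N * N * 16 < 2 ^ S.w := by
    rwa [show N * N * N * N * N * 16 = 16 * N ^ 5 by ring]
  have c1 : N * N * N * N * N ≤ N * N * N * N * N * 16 := Nat.le_mul_of_pos_right _ (by omega)
  have c2 : N * N * N * N ≤ N * N * N * N * N := Nat.le_mul_of_pos_right _ hpos
  have c3 : N * N * N ≤ N * N * N * N := Nat.le_mul_of_pos_right _ hpos
  have c4 : N * N ≤ N * N * N := Nat.le_mul_of_pos_right _ hpos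
  have e4 := h₄.add (h₅.mul hhd (by omega)) (by omega)
  have e3 := h₃.add (e4.mul hhd (by omega)) (by omega)
  have e2 := h₂.add (e3.mul hhd (by omega)) (by omega)
  have e1 := h₁.add (e2.mul hhd (by omega)) (by omega)
  have e0 := (e1.mul (Ev.lit (x := 16) (by omega)) (by omega)).add (Ev.lit (x := i) (by omega))
    (by omega)
  have key : S.entry c v 1 ((x₁ + (x₂ + (x₃ + (x₄ + x₅ * N) * N) * N) * N) * 16 + i)
      = S.table v i x₁ x₂ x₃ x₄ x₅ := by
    have aux : ∀ x y : ℕ, x < N → (x + y * N) % N = x ∧ (x + y * N) / N = y := fun x y hx =>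
      ⟨by rw [Nat.add_mul_mod_self_right, Nat.mod_eq_of_lt hx],
        by rw [Nat.add_mul_div_right _ _ hpos, Nat.div_eq_of_lt hx, zero_add]⟩
    simp only [Shape.entry, Shape.tableEntry, ← hNdef]
    rw [show ((x₁ + (x₂ + (x₃ + (x₄ + x₅ * N) * N) * N) * N) * 16 + i) % 16 = i by omega,
      show ((x₁ + (x₂ + (x₃ + (x₄ + x₅ * N) * N) * N) * N) * 16 + i) / 16
        = x₁ + (x₂ + (x₃ + (x₄ + x₅ * N) * N) * N) * N by omega]
    rw [(aux x₁ _ l₁).1, (aux x₁ _ l₁).2, (aux x₂ _ l₂).1, (aux x₂ _ l₂).2, (aux x₃ _ l₃).1,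
      (aux x₃ _ l₃).2, (aux x₄ _ l₄).1, (aux x₄ _ l₄).2, Nat.mod_eq_of_lt l₅]
  rw [← key] at hv ⊢
  refine h.acc (by omega) ?_ e0 hv
  have : S.len 1 = N * N * N * N * N * 16 := by
    change 16 * N ^ 5 = _
    ring
  rw [this]
  omega

theorem lit_zero : Ev M a b (.lit 0) 0 := Ev.lit (by positivity)

end IsTableMemory

end SlabRep

/-! ### The rank operations -/

namespace SlabRep

namespace Expr

/-- The block that contains entry `i`. -/
def word (i : Expr) : Expr := acc 2 (i / hd 4)

/-- The first `o` digits of a word. -/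
def low (x o : Expr) : Expr := x % op .shl (lit 1) (hd 3 * o)

def group (x : Expr) (t : ℕ) : Expr := op .shr x (lit t * hd 6) % hd 7

/-- The counters for the entries from the beginning of the superblock of `i` through the first `o`
entries of the block of `i`. -/
def counters (K : ℕ) (i o : Expr) : Expr :=
  op .shr (word i) (hd 5) + sum (fun t => look 0 (group (low (word i) o) t)) K

def super (id : ℕ) (sb k : Expr) : Expr := acc 3 ((k + sb * hd 13) * lit 4 + lit id)

def endpointRank (K : ℕ) (k i : Expr) : Expr :=
  super 0 (i / hd 4 / hd 8) k + look 1 (counters K i (i % hd 4 + lit 1)) k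

/-- Table 2 merges the counters before and through position `i`: left endpoints always include `i`,
right endpoints according to the convention. -/
def mixed (K : ℕ) (i : Expr) : Expr :=
  look 2 (counters K i (i % hd 4)) (counters K i (i % hd 4 + lit 1))

def slabRank (K : ℕ) (i j : Expr) : Expr :=
  super 1 (i / hd 4 / hd 8) j + look 3 (mixed K i) j - look 4 (mixed K i) j

end Expr

namespace Shape

variable {S : Shape} {K : ℕ} {c : ℕ → ℕ} {v : Convention}

theorem Valid.counter_pos (hS : S.Valid K) : 0 < S.u := by
  by_contra h
  have := hS.width_lt
  have h2 := hS.field_lt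
  rw [Nat.eq_zero_of_not_pos h] at this
  omega

theorem Valid.slabs_le (hS : S.Valid K) : 2 * S.Δ + 2 ≤ S.β :=
  (Nat.le_mul_of_pos_left _ hS.counter_pos).trans hS.counters_le

theorem Valid.slabs_lt (hS : S.Valid K) : 2 * S.Δ + 2 < 2 ^ S.β :=
  hS.slabs_le.trans_lt Nat.lt_two_pow_self

theorem Valid.counter_lt_field (hS : S.Valid K) : 2 ^ S.u ≤ 2 ^ S.β := by
  refine Nat.pow_le_pow_right two_pos ((Nat.le_mul_of_pos_right _ ?_).trans hS.counters_le)
  omega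

theorem Valid.superblock_lt (hS : S.Valid K) : S.G * S.f + 1 < 2 ^ S.u := by
  refine lt_of_le_of_lt (Nat.succ_le_succ ?_) hS.span_lt
  rw [span, mul_assoc (S.G * S.f)]
  exact Nat.le_mul_of_pos_right _ (Nat.mul_pos hS.fan_pos hS.fan_pos)

theorem Valid.superblock_pos (hS : S.Valid K) : 0 < S.G * S.f :=
  Nat.mul_pos hS.block_pos hS.fan_pos

theorem Valid.span_pos (hS : S.Valid K) : 0 < S.span :=
  Nat.mul_pos (Nat.mul_pos hS.superblock_pos hS.fan_pos) hS.fan_pos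

theorem relCount_le (c : ℕ → ℕ) (X x q : ℕ) : relCount c X x q ≤ x - X := by
  unfold relCount
  split
  · omega
  · exact count_sub_le _ _ _

theorem Valid.relCount_lt (hS : S.Valid K) {X x : ℕ} (h : x ≤ X + S.G * S.f) (q : ℕ) :
    relCount c X x q < 2 ^ S.u := by
  have := relCount_le c X x q
  have := hS.superblock_lt
  omega

theorem Valid.counters_lt (hS : S.Valid K) {X x : ℕ} (h : x ≤ X + S.G * S.f) :
    S.counters c X x < 2 ^ (S.u * (2 * S.Δ + 2)) :=
  pack_lt fun q _ => hS.relCount_lt h q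

theorem Valid.digit_counters (hS : S.Valid K) {X x q : ℕ} (h : x ≤ X + S.G * S.f)
    (hq : q < 2 * S.Δ + 2) : digit S.u (S.counters c X x) q = relCount c X x q :=
  digit_pack (fun q _ => hS.relCount_lt h q) hq

theorem Valid.char_lt (hS : S.Valid K) (hc : IsSeq S.n S.Δ c) (p : ℕ) : c p < 2 ^ S.b := by
  have := hc.le p
  have := hS.code_lt
  omega

theorem block_start_le (S : Shape) (B : ℕ) : B / S.f * (S.G * S.f) ≤ B * S.G := by
  rw [mul_comm S.G, ← mul_assoc]
  exact Nat.mul_le_mul_right _ (Nat.div_mul_le_self _ _)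

theorem Valid.block_end_le (hS : S.Valid K) (B : ℕ) :
    B * S.G + S.G ≤ B / S.f * (S.G * S.f) + S.G * S.f := by
  rw [mul_comm S.G S.f, ← mul_assoc, ← Nat.succ_mul, ← Nat.add_mul]
  exact Nat.mul_le_mul_right _ (Nat.lt_div_mul_add hS.fan_pos)

theorem Valid.block_lt (hS : S.Valid K) (hc : IsSeq S.n S.Δ c) (B : ℕ) : S.block c B < 2 ^ S.w := by
  have h1 : pack S.b (fun p => c (B * S.G + p)) S.G < 2 ^ (S.b * S.G) :=
    pack_lt fun p _ => hS.char_lt hc _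
  have h2 := hS.counters_lt (c := c) (X := B / S.f * (S.G * S.f)) (x := B * S.G)
    (by have := hS.block_end_le B; omega)
  refine lt_of_lt_of_le ?_ (Nat.pow_le_pow_right two_pos hS.word_bits)
  rw [pow_add, mul_comm (2 ^ (S.b * S.G))]
  exact IsTableMemory.step_index h1 h2

theorem Valid.block_div (hS : S.Valid K) (hc : IsSeq S.n S.Δ c) (B : ℕ) :
    S.block c B / 2 ^ (S.b * S.G) = S.counters c (B / S.f * (S.G * S.f)) (B * S.G) := by
  have h1 : pack S.b (fun p => c (B * S.G + p)) S.G < 2 ^ (S.b * S.G) :=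
    pack_lt fun p _ => hS.char_lt hc _
  rw [block, Nat.add_mul_div_right _ _ (by positivity), Nat.div_eq_of_lt h1, zero_add]

theorem Valid.block_mod (hS : S.Valid K) (hc : IsSeq S.n S.Δ c) (B : ℕ) {o : ℕ} (ho : o ≤ S.G) :
    S.block c B % 2 ^ (S.b * o) = pack S.b (fun p => c (B * S.G + p)) o := by
  have : 2 ^ (S.b * o) ∣ S.counters c (B / S.f * (S.G * S.f)) (B * S.G) * 2 ^ (S.b * S.G) :=
    Dvd.dvd.mul_left (pow_dvd_pow 2 (Nat.mul_le_mul_left _ ho)) _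
  obtain ⟨d, hd⟩ := this
  rw [block, hd, Nat.add_mul_mod_self_left, pack_mod (fun p _ => hS.char_lt hc _) ho]

/-- The `K` groups reach beyond the block, but the digits after the first `o` are 0 and are not
counted by `Q`. -/
theorem Valid.count_digit (hS : S.Valid K) (hc : IsSeq S.n S.Δ c) (x : ℕ) {o : ℕ} (ho : o ≤ S.G)
    (Q : ℕ → Prop) [DecidablePred Q] (hQ : ¬ Q 0) :
    Nat.count (fun p => Q (digit S.b (pack S.b (fun p => c (x + p)) o) p)) (K * S.s)
      = Nat.count (fun p => Q (c (x + p))) o := by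
  have h : ∀ p < o, c (x + p) < 2 ^ S.b := fun p _ => hS.char_lt hc _
  rw [count_of_le (ho.trans hS.block_le_groups) fun p hp _ => by
    rwa [digit_pack_of_le h hp]]
  exact count_congr fun p hp => by rw [digit_pack h hp]

theorem Valid.add_span_lt (hS : S.Valid K) {i : ℕ} (hi : i ≤ 2 * S.n) :
    i + S.span < S.units * S.span := by
  have h1 := Nat.lt_div_mul_add (a := i) hS.span_pos
  have h2 := Nat.mul_le_mul_right S.span (Nat.div_le_div_right (c := S.span) hi)
  rw [units, Nat.add_mul]
  omega

theorem Valid.lt_units (hS : S.Valid K) {i : ℕ} (hi : i ≤ 2 * S.n) : i / S.span < S.units := by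
  rw [Nat.div_lt_iff_lt_mul hS.span_pos]
  have := hS.add_span_lt hi
  omega

theorem Valid.block_index_lt (hS : S.Valid K) {i : ℕ} (hi : i ≤ 2 * S.n) :
    i / S.G < S.units * S.f * S.f * S.f := by
  rw [Nat.div_lt_iff_lt_mul hS.block_pos]
  have h1 := hS.add_span_lt hi
  have h2 : S.units * S.span = S.units * S.f * S.f * S.f * S.G := by unfold span; ring
  omega

theorem Valid.superblock_index_lt (hS : S.Valid K) {i : ℕ} (hi : i ≤ 2 * S.n) :
    i / S.G / S.f < S.units * S.f * S.f := by
  rw [Nat.div_lt_iff_lt_mul hS.fan_pos]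
  exact hS.block_index_lt hi

theorem sumLeft_counters {f : ℕ → ℕ} {x X : ℕ} {u m V : ℕ} (hXx : X ≤ x)
    (hV : ∀ q < m, digit u V q = f q) {j : ℕ} (hj : 2 * j < m)
    (hf : ∀ q, 0 < q → q % 2 = 0 → f q = relCount c X x q) :
    cntLeft c j X + sumLeft u V j = cntLeft c j x := by
  induction j with
  | zero => simp [cntLeft_zero, sumLeft]
  | succ j ih =>
    have := ih (by omega)
    have h1 := Nat.count_monotone (fun p => c p = 2 * (j + 1)) hXx
    rw [cntLeft_succ, cntLeft_succ, sumLeft, Finset.sum_range_succ, hV _ (by omega),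
      hf _ (by omega) (by omega), relCount, if_neg (by omega), ← sumLeft]
    omega

theorem sumRight_counters {f : ℕ → ℕ} {x X : ℕ} {u m V : ℕ} (hXx : X ≤ x)
    (hV : ∀ q < m, digit u V q = f q) {j : ℕ} (hj : 2 * j + 1 < m)
    (hf : ∀ q, q % 2 = 1 → f q = relCount c X x q) :
    cntRight c j X + sumRight u V j = cntRight c j x := by
  induction j with
  | zero => simp [cntRight_zero, sumRight]
  | succ j ih =>
    have := ih (by omega)
    have h1 := Nat.count_monotone (fun p => c p = 2 * (j + 1) + 1) hXx
    rw [cntRight_succ, cntRight_succ, sumRight, Finset.sum_range_succ, hV _ (by omega),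
      hf _ (by omega), relCount, if_neg (by omega), ← sumRight]
    omega

/-- The counters on which the segments crossing the line at `i` depend. -/
def mixedCount (c : ℕ → ℕ) (v : Convention) (X i q : ℕ) : ℕ :=
  if q % 2 = 0 then relCount c X (i + 1) q else relCount c X (v.bound i) q

end Shape

namespace IsTableMemory

open SlabRep.Expr

variable {S : Shape} {K : ℕ} {c : ℕ → ℕ} {v : Convention} {M : List (BitVec S.w)}
  {a b : BitVec S.w}

theorem two_le_pow (h : IsTableMemory S K c v M) : 1 < 2 ^ S.w :=
  Nat.one_lt_two_pow h.width_pos.ne'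

theorem hd_fan (h : IsTableMemory S K c v M) : Ev M a b (Expr.hd 8) S.f := by
  refine h.hd (i := 8) (by omega) (lt_of_le_of_lt ?_ h.field_lt)
  exact ((Nat.le_mul_of_pos_left _ h.valid.counter_pos).trans h.valid.fan_le).trans
    Nat.lt_two_pow_self.le

theorem block_lt_width (h : IsTableMemory S K c v M) : S.b * S.G < S.w := by
  refine lt_of_lt_of_le ?_ h.valid.word_bits
  exact Nat.lt_add_of_pos_right (Nat.mul_pos h.valid.counter_pos (by omega))

theorem bits_pos (h : IsTableMemory S K c v M) : 0 < S.b := by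
  by_contra h0
  have := h.valid.code_lt
  have := h.valid.slabs_pos
  rw [Nat.eq_zero_of_not_pos h0] at *
  omega

theorem hd_block (h : IsTableMemory S K c v M) : Ev M a b (Expr.hd 4) S.G := by
  refine h.hd (i := 4) (by omega) (lt_of_le_of_lt (Nat.le_mul_of_pos_left _ h.bits_pos) ?_)
  exact h.block_lt_width.trans Nat.lt_two_pow_self

theorem hd_blockBits (h : IsTableMemory S K c v M) : Ev M a b (Expr.hd 5) (S.b * S.G) :=
  h.hd (i := 5) (by omega) (h.block_lt_width.trans Nat.lt_two_pow_self)

theorem word (h : IsTableMemory S K c v M) {I : Expr} {i : ℕ} (hi : i ≤ 2 * S.n)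
    (hI : Ev M a b I i) : Ev M a b (word I) (S.block c (i / S.G)) :=
  h.acc (i := 2) (by omega) (h.valid.block_index_lt hi) (hI.div h.hd_block)
    (h.valid.block_lt h.isSeq _)

theorem low (h : IsTableMemory S K c v M) {x : ℕ} {X O : Expr} {o : ℕ} (ho : o ≤ S.G)
    (hX : Ev M a b X x) (hO : Ev M a b O o) :
    Ev M a b (low X O) (x % 2 ^ (S.b * o)) := by
  have h1 : S.b * o ≤ S.b * S.G := Nat.mul_le_mul_left _ ho
  have h2 := h.block_lt_width
  have h3 : S.b < S.w := lt_of_le_of_lt (Nat.le_mul_of_pos_right _ h.valid.block_pos) h2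
  have h4 : S.w < 2 ^ S.w := Nat.lt_two_pow_self
  have h5 : 2 ^ (S.b * o) < 2 ^ S.w := Nat.pow_lt_pow_right one_lt_two (by omega)
  refine hX.mod (((Ev.lit h.two_le_pow).shl
    ((h.hd (i := 3) (by omega) (h3.trans h4)).mul hO ?_) (by rw [one_mul]; exact h5)).congr
    (one_mul _))
  change S.b * o < _
  omega

theorem group (h : IsTableMemory S K c v M) {x t : ℕ} {X : Expr} (hX : Ev M a b X x) (ht : t < K) :
    Ev M a b (group X t) (chunk S.b S.s x t) := by
  have h1 := h.valid.group_le
  have h2 := h.field_lt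
  have h3 := h.valid.field_lt
  have h4 : S.w < 2 ^ S.w := Nat.lt_two_pow_self
  have h5 : t * (S.b * S.s) ≤ K * S.β := Nat.mul_le_mul ht.le h1
  have h6 := h.valid.shift_lt
  have h7 := h.valid.lookups_lt
  refine (hX.shr ((Ev.lit (by omega)).mul (h.hd (i := 6) (by omega) ?_) ?_)).mod
    (h.hd (i := 7) (by omega) ?_)
  · change S.b * S.s < _
    omega
  · change t * (S.b * S.s) < _
    omega
  · exact lt_of_le_of_lt (Nat.pow_le_pow_right two_pos h1) h2

theorem chunk_lt_field (h : IsTableMemory S K c v M) (x t : ℕ) : chunk S.b S.s x t < 2 ^ S.β :=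
  (chunk_lt _ _ _ _).trans_le (Nat.pow_le_pow_right two_pos h.valid.group_le)

theorem groupSize_lt (h : IsTableMemory S K c v M) : S.s < 2 ^ S.β :=
  lt_of_le_of_lt ((Nat.le_mul_of_pos_left _ h.bits_pos).trans h.valid.group_le)
    Nat.lt_two_pow_self

theorem sum_table_zero (h : IsTableMemory S K c v M) (B : ℕ) {o : ℕ} (ho : o ≤ S.G) :
    ∑ t ∈ Finset.range K, S.table v 0
      (chunk S.b S.s (pack S.b (fun p => c (B * S.G + p)) o) t) 0 0 0 0
    = pack S.u (fun q => if q = 0 then 0 else Nat.count (fun p => c (B * S.G + p) = q) o)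
      (2 * S.Δ + 2) := by
  simp only [Shape.table]
  rw [sum_pack]
  refine pack_congr fun q _ => ?_
  by_cases hq : q = 0
  · simp [hq]
  · simp only [if_neg hq]
    rw [sum_count_chunk (fun x => x = q)]
    exact h.valid.count_digit h.isSeq _ ho (fun x => x = q) (Ne.symm hq)

/-- The counters stored at the start of the block and the packed counts of all groups are added as
whole words. No carries arise, as the totals stay within a superblock and hence below `2 ^ u`. -/
theorem counters (h : IsTableMemory S K c v M) {I O : Expr} {i o : ℕ} (hi : i ≤ 2 * S.n)
    (ho : o ≤ S.G) (hI : Ev M a b I i) (hO : Ev M a b O o) :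
    Ev M a b (counters K I O)
      (S.counters c (i / S.G / S.f * (S.G * S.f)) (i / S.G * S.G + o)) := by
  set B := i / S.G
  set X := B / S.f * (S.G * S.f)
  have hX : X ≤ B * S.G := S.block_start_le B
  have hend := h.valid.block_end_le B
  have hlow := h.low ho (h.word hi hI) hO
  rw [h.valid.block_mod h.isSeq _ ho] at hlow
  have h1 := ((h.word hi hI).shr h.hd_blockBits).congr (h.valid.block_div h.isSeq B)
  have hsum : S.counters c X (B * S.G) + ∑ t ∈ Finset.range K, S.table v 0
      (chunk S.b S.s (pack S.b (fun p => c (B * S.G + p)) o) t) 0 0 0 0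
      = S.counters c X (B * S.G + o) := by
    rw [h.sum_table_zero B ho, Shape.counters, pack_add, Shape.counters]
    refine pack_congr fun q _ => ?_
    unfold relCount
    split
    · rfl
    · rw [Nat.count_add]
      have := Nat.count_monotone (fun p => c p = q) hX
      omega
  have hlt : S.counters c X (B * S.G + o) < 2 ^ S.w :=
    (h.valid.counters_lt (by omega)).trans_le (Nat.pow_le_pow_right two_pos
      (h.valid.counters_le.trans h.valid.field_lt.le))
  rw [← hsum] at hlt ⊢
  refine h1.add (Ev.sum (fun t ht => ?_) (by omega)) hlt
  refine h.look (by omega) (h.group hlow ht) (h.chunk_lt_field _ _) lit_zero (by positivity)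
    lit_zero (by positivity) lit_zero (by positivity) lit_zero (by positivity) ?_
  have := Finset.single_le_sum (f := fun t => S.table v 0
      (chunk S.b S.s (pack S.b (fun p => c (B * S.G + p)) o) t) 0 0 0 0)
    (fun i _ => Nat.zero_le _) (Finset.mem_range.2 ht)
  omega

theorem super (h : IsTableMemory S K c v M) {E J : Expr} {id sb k : ℕ} (hid : id < 4)
    (hsb : sb < S.units * S.f * S.f) (hk : k < S.Δ + 2) (hE : Ev M a b E sb) (hJ : Ev M a b J k)
    (hv : S.superblock c (sb * (S.G * S.f)) k id < 2 ^ S.w) :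
    Ev M a b (super id E J) (S.superblock c (sb * (S.G * S.f)) k id) := by
  have h1 := step_index hk hsb
  have h2 := step_index hid h1
  have h3 : (k + sb * (S.Δ + 2)) * 4 + id < S.len 3 := by
    change _ < S.units * S.f * S.f * (S.Δ + 2) * 4
    omega
  have h4 := h.base_add_lt (i := 3) (by omega) h3
  have h5 : S.Δ + 2 < 2 ^ S.w := by
    have := h.valid.slabs_lt
    have := h.field_lt
    omega
  have h6 := h.thirtyTwo_lt
  have he := ((hJ.add (hE.mul (h.hd (i := 13) (by omega) h5) (by
    change sb * (S.Δ + 2) < _; omega)) (by change k + sb * (S.Δ + 2) < _; omega)).mul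
    (Ev.lit (x := 4) (by omega)) (by change (k + sb * (S.Δ + 2)) * 4 < _; omega)).add
    (Ev.lit (x := id) (by omega)) (by change (k + sb * (S.Δ + 2)) * 4 + id < _; omega)
  have key : S.entry c v 3 ((k + sb * (S.Δ + 2)) * 4 + id)
      = S.superblock c (sb * (S.G * S.f)) k id := by
    simp only [Shape.entry]
    rw [show ((k + sb * (S.Δ + 2)) * 4 + id) / 4 = k + sb * (S.Δ + 2) by omega,
      show ((k + sb * (S.Δ + 2)) * 4 + id) % 4 = id by omega,
      Nat.add_mul_div_right _ _ (by omega), Nat.div_eq_of_lt hk, zero_add,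
      Nat.add_mul_mod_self_right, Nat.mod_eq_of_lt hk]
  rw [← key] at hv ⊢
  exact h.acc (by omega) h3 he hv

theorem offset_lt (h : IsTableMemory S K c v M) (i : ℕ) : i % S.G < S.G :=
  Nat.mod_lt _ h.valid.block_pos

theorem counters_incl (h : IsTableMemory S K c v M) {I : Expr} {i : ℕ} (hi : i ≤ 2 * S.n)
    (hI : Ev M a b I i) : Ev M a b (Expr.counters K I (I % Expr.hd 4 + lit 1))
      (S.counters c (i / S.G / S.f * (S.G * S.f)) (i + 1)) := by
  have h1 := h.offset_lt i
  have h2 := h.hd_block (a := a) (b := b)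
  have h3 := h2.lt
  refine (h.counters hi (o := i % S.G + 1) h1 hI ((hI.mod h2).add (Ev.lit h.two_le_pow)
    (by omega))).congr ?_
  rw [← add_assoc, Nat.div_add_mod' i S.G]

theorem counters_excl (h : IsTableMemory S K c v M) {I : Expr} {i : ℕ} (hi : i ≤ 2 * S.n)
    (hI : Ev M a b I i) : Ev M a b (Expr.counters K I (I % Expr.hd 4))
      (S.counters c (i / S.G / S.f * (S.G * S.f)) i) := by
  refine (h.counters hi (h.offset_lt i).le hI (hI.mod h.hd_block)).congr ?_
  rw [Nat.div_add_mod' i S.G]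

theorem superblock_start_le (i : ℕ) : i / S.G / S.f * (S.G * S.f) ≤ i := by
  rw [Nat.div_div_eq_div_mul]
  exact Nat.div_mul_le_self _ _

theorem superblock_end_le (h : IsTableMemory S K c v M) (i : ℕ) :
    i + 1 ≤ i / S.G / S.f * (S.G * S.f) + S.G * S.f := by
  rw [Nat.div_div_eq_div_mul]
  exact Nat.lt_div_mul_add h.valid.superblock_pos

theorem counters_lt_field (h : IsTableMemory S K c v M) {X x : ℕ} (hx : x ≤ X + S.G * S.f) :
    S.counters c X x < 2 ^ S.β :=
  (h.valid.counters_lt hx).trans_le (Nat.pow_le_pow_right two_pos h.valid.counters_le)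

theorem superIndex (h : IsTableMemory S K c v M) {I : Expr} {i : ℕ} (hI : Ev M a b I i) :
    Ev M a b (I / Expr.hd 4 / Expr.hd 8) (i / S.G / S.f) := (hI.div h.hd_block).div h.hd_fan

theorem endpointRank (h : IsTableMemory S K c v M) {I J : Expr} {i k : ℕ} (hi : i ≤ 2 * S.n)
    (hk1 : 1 ≤ k) (hk : k ≤ S.Δ) (hI : Ev M a b I i) (hJ : Ev M a b J k) :
    Ev M a b (endpointRank K J I) (cntSlab c k (i + 1)) := by
  have hn := h.valid.n_lt
  have hle := h.isSeq.cntSlab_le hk1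
  have e1 := h.super (id := 0) (by omega) (h.valid.superblock_index_lt hi) (by omega)
    (h.superIndex hI) hJ (by
      have := hle (i / S.G / S.f * (S.G * S.f)); change cntSlab c k _ < _; omega)
  have hend := h.superblock_end_le i
  have hinc := h.counters_incl hi hI
  set X := i / S.G / S.f * (S.G * S.f) with hX
  have hXi : X ≤ i := superblock_start_le i
  have hval : cntSlab c k X + S.table v 1 (S.counters c X (i + 1)) k 0 0 0
      = cntSlab c k (i + 1) := by
    simp only [Shape.table]
    rw [h.valid.digit_counters hend (by omega), h.valid.digit_counters hend (by omega),
      cntSlab_eq, cntSlab_eq, relCount, relCount, if_neg (by omega), if_neg (by omega)]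
    have h1 := Nat.count_monotone (fun p => c p = 2 * k) (show X ≤ i + 1 by omega)
    have h2 := Nat.count_monotone (fun p => c p = 2 * k + 1) (show X ≤ i + 1 by omega)
    omega
  have hlt := hle (i + 1)
  have hs := h.valid.slabs_lt
  refine (e1.add (h.look (i := 1) (by omega) hinc
    (h.counters_lt_field hend) hJ (by omega) lit_zero (by positivity) lit_zero (by positivity)
    lit_zero (by positivity) (by omega)) ?_).congr hval
  change cntSlab c k X + _ < _
  omega

theorem mixedCount_lt (h : IsTableMemory S K c v M) (i q : ℕ) :
    Shape.mixedCount c v (i / S.G / S.f * (S.G * S.f)) i q < 2 ^ S.u := by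
  have hend := h.superblock_end_le i
  have := v.bound_le i
  unfold Shape.mixedCount
  split <;> exact h.valid.relCount_lt (by omega) q

theorem mixed (h : IsTableMemory S K c v M) {I : Expr} {i : ℕ} (hi : i ≤ 2 * S.n)
    (hI : Ev M a b I i) : ∃ V, Ev M a b (mixed K I) V ∧ V < 2 ^ S.β ∧
      ∀ q < 2 * S.Δ + 2, digit S.u V q =
        Shape.mixedCount c v (i / S.G / S.f * (S.G * S.f)) i q := by
  set X := i / S.G / S.f * (S.G * S.f) with hX
  have hend := h.superblock_end_le i
  have hval : S.table v 2 (S.counters c X i) (S.counters c X (i + 1)) 0 0 0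
      = pack S.u (Shape.mixedCount c v X i) (2 * S.Δ + 2) := by
    simp only [Shape.table]
    refine pack_congr fun q hq => ?_
    rw [Shape.mixedCount]
    split
    · exact h.valid.digit_counters hend hq
    · cases v
      · exact h.valid.digit_counters (by omega) hq
      · exact h.valid.digit_counters hend hq
  have hlt : pack S.u (Shape.mixedCount c v X i) (2 * S.Δ + 2) < 2 ^ S.β :=
    (pack_lt fun q _ => h.mixedCount_lt i q).trans_le
      (Nat.pow_le_pow_right two_pos h.valid.counters_le)
  refine ⟨_, (h.look (i := 2) (by omega) (h.counters_excl hi hI) (h.counters_lt_field (by omega))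
    (h.counters_incl hi hI) (h.counters_lt_field hend) lit_zero (by positivity) lit_zero
    (by positivity) lit_zero (by positivity) ?_).congr hval, hlt, fun q hq => ?_⟩
  · rw [hval]; exact hlt.trans h.field_lt
  · exact digit_pack (fun q _ => h.mixedCount_lt i q) hq

/-- The number of segments crossing the line at `i` is obtained from those that are open at the
beginning of the superblock. -/
theorem rank_eq (h : IsTableMemory S K c v M) {i j V : ℕ} (hj : j ≤ S.Δ)
    (hV : ∀ q < 2 * S.Δ + 2, digit S.u V q =
        Shape.mixedCount c v (i / S.G / S.f * (S.G * S.f)) i q) :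
    rank c v i j = openCount c (i / S.G / S.f * (S.G * S.f)) j + sumLeft S.u V j
        - sumRight S.u V j ∧
      sumRight S.u V j ≤ openCount c (i / S.G / S.f * (S.G * S.f)) j + sumLeft S.u V j ∧
      openCount c (i / S.G / S.f * (S.G * S.f)) j + sumLeft S.u V j ≤ 2 * S.n ∧
      sumLeft S.u V j + 1 < 2 ^ S.u ∧ sumRight S.u V j < 2 ^ S.u := by
  set X := i / S.G / S.f * (S.G * S.f) with hX
  have hXi : X ≤ i := superblock_start_le i
  have hend := h.superblock_end_le i
  have hb := v.le_bound i
  have hb' := v.bound_le i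
  have h1 := Shape.sumLeft_counters (c := c) (X := X) (x := i + 1) (j := j) (by omega) hV
    (by omega) (fun q hq hq2 => by rw [Shape.mixedCount, if_pos hq2])
  have h2 := Shape.sumRight_counters (c := c) (X := X) (x := v.bound i) (j := j) (by omega) hV
    (by omega) (fun q hq2 => by rw [Shape.mixedCount, if_neg (by omega)])
  have h3 := h.isSeq.cntRight_le j (le_refl X)
  have h4 := h.isSeq.cntRight_le j hb'
  have h5 := h.isSeq.cntLeft_le j (i + 1)
  have h6 : cntLeft c j (i + 1) - cntLeft c j X ≤ i + 1 - X := count_sub_le _ _ _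
  have h7 : cntRight c j (v.bound i) - cntRight c j X ≤ v.bound i - X := count_sub_le _ _ _
  have h8 := h.valid.superblock_lt
  unfold rank openCount
  omega

theorem slabRank (h : IsTableMemory S K c v M) {I J : Expr} {i j : ℕ} (hi : i ≤ 2 * S.n)
    (hj : j ≤ S.Δ) (hI : Ev M a b I i) (hJ : Ev M a b J j) :
    Ev M a b (slabRank K I J) (rank c v i j) := by
  obtain ⟨V, hV, hlt, hdig⟩ := h.mixed hi hI
  obtain ⟨h1, h2, h3, h4, h5⟩ := h.rank_eq hj hdig
  have hn := h.valid.n_lt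
  have hs := h.valid.slabs_lt
  have hN := h.field_lt
  have hu := h.valid.counter_lt_field
  have e1 := h.super (id := 1) (by omega) (h.valid.superblock_index_lt hi) (by omega)
    (h.superIndex hI) hJ (by
      change openCount c (i / S.G / S.f * (S.G * S.f)) j < _; omega)
  have e2 := h.look (i := 3) (by omega) hV hlt hJ (by omega) lit_zero (by positivity)
    lit_zero (by positivity) lit_zero (by positivity) (by
      change sumLeft S.u V j < _; omega)
  have e3 := h.look (i := 4) (by omega) hV hlt hJ (by omega) lit_zero (by positivity)
    lit_zero (by positivity) lit_zero (by positivity) (by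
      change sumRight S.u V j < _; omega)
  rw [h1]
  exact (e1.add e2 (by
    change openCount c (i / S.G / S.f * (S.G * S.f)) j + sumLeft S.u V j < _; omega)).sub e3 h2

end IsTableMemory

end SlabRep

/-! ### Slab-select: searching the open counts -/

namespace SlabRep

namespace Expr

def field (x : Expr) (t : ℕ) : Expr := op .shr x (lit t * hd 1) % hd 2

def leaf (K : ℕ) (sb q : Expr) : Expr :=
  look 6 (super 2 sb (lit 0))
    (bor (fun t => look 5 (super 2 sb (lit 0)) (lit t) (field q t)) K)

/-- The number of slabs `k` such that less than `q` segments in the slabs `1, …, k` are open at the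
beginning of the superblock. -/
def search (K : ℕ) (sb q : Expr) : Expr :=
  let y := super 1 sb (leaf K sb q)
  look 8 (super 2 sb (lit 0)) (leaf K sb q)
    (bor (fun t => look 7 (super 2 sb (lit 0)) (lit t) (field (op .xor q y) t)) K) (op .lt y q)

def slabSelect (K : ℕ) (i q : Expr) : Expr :=
  let sb := i / hd 4 / hd 8
  let k := search K sb q
  look 9 (super 3 sb (lit 0)) k (min (q - super 1 sb (k - lit 1)) (hd 10))
    (min (tsub (super 1 sb k) q) (hd 10)) (mixed K i)

end Expr

/-- Only `r` branchings and the bits inspected at the nonzero ones matter, so packed data suffice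
for a table to pick a leaf. -/
theorem IsLeaf.congr {d d' : ℕ → ℕ} {σ σ' : ℕ → Prop} {r i : ℕ} (h : IsLeaf d σ r i)
    (hd : ∀ p < r, d p = d' p) (hσ : ∀ p < r, 0 < d p → (σ p ↔ σ' p)) : IsLeaf d' σ' r i := by
  obtain ⟨hi, h1, h2⟩ := h
  refine ⟨hi, fun p hip hpr hp hl => ?_, fun p hpi hp hl => ?_⟩
  · rw [← hd p hpr] at hp
    rw [← hσ p hpr hp]
    refine h1 p hip hpr hp fun l hl1 hl2 => ?_
    rw [hd p hpr, hd l (by omega)]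
    exact hl l hl1 hl2
  · rw [← hd p (by omega)] at hp
    rw [← hσ p (by omega) hp]
    refine h2 p hpi hp fun l hl1 hl2 => ?_
    rw [hd p (by omega), hd l (by omega)]
    exact hl l hl1 hl2

/-- The right side can be tested piece by piece on `x`. The case `d = 0` stands apart because `x =
0` has no set bit to witness it. -/
theorem le_size_iff {d x : ℕ} : d ≤ x.size ↔ d = 0 ∨ ∃ e, x.testBit e = true ∧ d ≤ e + 1 := by
  rcases Nat.eq_zero_or_eq_succ_pred d with rfl | hd
  · simp
  · rw [hd, Nat.succ_le_iff, Nat.lt_size]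
    constructor
    · intro h
      obtain ⟨e, he, hb⟩ := Nat.exists_ge_and_testBit_of_ge_two_pow h
      exact Or.inr ⟨e, hb, by omega⟩
    · rintro (h | ⟨e, hb, he⟩)
      · omega
      · exact (Nat.pow_le_pow_right two_pos (by omega)).trans (Nat.ge_two_pow_of_testBit hb)

/-- A condition that is inherited downwards holds exactly below the number of its instances. -/
theorem iff_lt_count {P : ℕ → Prop} [DecidablePred P] (hP : ∀ i j, i ≤ j → P j → P i) {n j : ℕ}
    (hj : j < n) : P j ↔ j < Nat.count P n := by
  constructor
  · intro h
    have h1 : Nat.count P (j + 1) = j + 1 :=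
      count_eq_of_iff_lt le_rfl fun k hk => ⟨fun _ => hk, fun _ => hP k j (by omega) h⟩
    have := Nat.count_monotone P (show j + 1 ≤ n from hj)
    omega
  · intro h
    by_contra hn
    rw [count_of_le hj.le fun i hi _ hPi => hn (hP j i hi hPi)] at h
    have := count_le P j
    omega

/-- The truncated summands either give the exact distance, or both the sum and the distance are at
least `m`, which decides every comparison with smaller quantities. -/
theorem truncated_sum {A g : ℕ → ℕ} (hA : Monotone A) {m x i j : ℕ} (hij : i ≤ j)
    (hg : ∀ l < j, g l = min (A (l + 1) - A l) m) :
    min x m + ∑ l ∈ Finset.Ico i j, g l = x + (A j - A i) ∨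
      (m ≤ min x m + ∑ l ∈ Finset.Ico i j, g l ∧ m ≤ x + (A j - A i)) := by
  induction j, hij using Nat.le_induction with
  | base => simp; omega
  | succ j hj ih =>
    have h1 := ih fun l hl => hg l (by omega)
    have h2 := hA hj
    have h3 := hA (Nat.le_succ j)
    rw [Finset.sum_Ico_succ_top hj, hg j (by omega)]
    simp only [Nat.succ_eq_add_one] at h3
    omega

namespace IsTableMemory

open SlabRep.Expr

variable {S : Shape} {K : ℕ} {c : ℕ → ℕ} {v : Convention} {M : List (BitVec S.w)}
  {a b : BitVec S.w}

theorem field (h : IsTableMemory S K c v M) {x t : ℕ} {X : Expr} (hX : Ev M a b X x) (ht : t < K) :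
    Ev M a b (field X t) (chunk 1 S.β x t) := by
  have h2 := h.field_lt
  have h3 := h.valid.field_lt
  have h4 : S.w < 2 ^ S.w := Nat.lt_two_pow_self
  have h5 : t * S.β ≤ K * S.β := Nat.mul_le_mul_right _ ht.le
  have h6 := h.valid.shift_lt
  have h7 := h.valid.lookups_lt
  refine ((hX.shr ((Ev.lit (x := t) (by omega)).mul (h.hd (i := 1) (by omega) ?_) ?_)).mod
    (h.hd (i := 2) (by omega) h2)).congr ?_
  · change S.β < _
    omega
  · change t * S.β < _
    omega
  · rw [chunk, one_mul]; rfl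

theorem open_mono (h : IsTableMemory S K c v M) (X : ℕ) : Monotone (openCount c X) :=
  h.isSeq.diff_mono le_rfl

theorem open_le (h : IsTableMemory S K c v M) (X k : ℕ) : openCount c X k ≤ 2 * S.n :=
  (Nat.sub_le _ _).trans (h.isSeq.cntLeft_le k X)

/-- This keeps the branching bits within the `K` pieces of a query; `branch_lt` makes their
positions fit into counters. -/
theorem branch_le (h : IsTableMemory S K c v M) (X p : ℕ) :
    branch (openCount c X) p ≤ K * S.β := by
  rw [branch, Nat.size_le]
  have h1 := h.open_le X p
  have h2 := h.open_le X (p + 1)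
  have h3 := h.valid.arg_lt
  exact Nat.xor_lt_two_pow (by omega) (by omega)

theorem branch_lt (h : IsTableMemory S K c v M) (X p : ℕ) :
    branch (openCount c X) p < 2 ^ S.u := by
  refine lt_of_le_of_lt ?_ h.valid.width_lt
  rw [branch, Nat.size_le]
  have h1 := h.open_le X p
  have h2 := h.open_le X (p + 1)
  have h3 := h.valid.n_lt
  exact Nat.xor_lt_two_pow (by omega) (by omega)

theorem pow_slabs_le (h : IsTableMemory S K c v M) : 2 ^ (S.u * S.Δ) ≤ 2 ^ S.β := by
  refine Nat.pow_le_pow_right two_pos ((Nat.mul_le_mul_left _ ?_).trans h.valid.counters_le)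
  omega

theorem two_pow_slabs_le (h : IsTableMemory S K c v M) : 2 ^ S.Δ ≤ 2 ^ S.β := by
  have := h.valid.slabs_le
  exact Nat.pow_le_pow_right two_pos (by omega)

variable {sb q : ℕ} {E Q : Expr}

theorem branches (h : IsTableMemory S K c v M) (hsb : sb < S.units * S.f * S.f)
    (hE : Ev M a b E sb) : ∃ D, Ev M a b (.super 2 E (.lit 0)) D ∧ D < 2 ^ S.β ∧
      ∀ p < S.Δ, digit S.u D p = branch (openCount c (sb * (S.G * S.f))) p := by
  have h1 : pack S.u (branch (openCount c (sb * (S.G * S.f)))) S.Δ < 2 ^ S.β :=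
    (pack_lt fun p _ => h.branch_lt _ p).trans_le h.pow_slabs_le
  exact ⟨_, h.super (id := 2) (by omega) hsb (k := 0) (by omega) hE lit_zero
    (h1.trans h.field_lt), h1, fun p hp => digit_pack (fun p _ => h.branch_lt _ p) hp⟩

/-- Piece `t` of the query contributes the inspected bits that lie in it. Their disjunction `σ` has
only `Δ` bits and is again a table argument; `exists_isLeaf` ensures that the table has a leaf to
return. -/
theorem leaf (h : IsTableMemory S K c v M) (hsb : sb < S.units * S.f * S.f)
    (hE : Ev M a b E sb) (hQ : Ev M a b Q q) :
    ∃ i, Ev M a b (leaf K E Q) i ∧ IsLeaf (branch (openCount c (sb * (S.G * S.f))))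
      (fun p => q.testBit (branch (openCount c (sb * (S.G * S.f))) p - 1) = true) S.Δ i := by
  obtain ⟨D, hD, hDlt, hdig⟩ := h.branches hsb hE
  set y := openCount c (sb * (S.G * S.f))
  have hK := h.valid.lookups_lt
  have hN := h.field_lt
  have hs := h.two_pow_slabs_le
  have hβ : 0 < S.β := by have := h.valid.slabs_le; omega
  obtain ⟨σ, hσ, hbit⟩ := Ev.testBit_bor (M := M) (a := a) (b := b) (k := K)
    (F := fun t => Expr.look 5 (Expr.super 2 E (lit 0)) (lit t) (Expr.field Q t))
    (φ := fun t => S.table v 5 D t (chunk 1 S.β q t) 0 0) (fun t ht =>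
      h.look (by omega) hD hDlt (Ev.lit (by omega)) (by omega) (h.field hQ ht)
        ((chunk_lt _ _ _ _).trans_le (by rw [one_mul])) lit_zero (by positivity) lit_zero
        (by positivity) ((bits_lt _ _).trans_le (by omega)))
  have hσbit : ∀ p, σ.testBit p = true ↔
      p < S.Δ ∧ 0 < branch y p ∧ q.testBit (branch y p - 1) = true := by
    intro p
    rw [hbit]
    simp only [Shape.table, testBit_bits, testBit_chunk]
    constructor
    · rintro ⟨t, ht, hp, hd, hdt, -, hb⟩
      rw [hdig p hp] at hd hdt hb
      refine ⟨hp, hd, ?_⟩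
      rwa [← hdt, Nat.div_add_mod'] at hb
    · rintro ⟨hp, hd, hb⟩
      have := h.branch_le (sb * (S.G * S.f)) p
      rw [hdig p hp]
      refine ⟨(branch y p - 1) / S.β, ?_, hp, hd, rfl, Nat.mod_lt _ hβ, ?_⟩
      · rw [Nat.div_lt_iff_lt_mul hβ]
        change branch y p ≤ _ at this
        omega
      · rwa [Nat.div_add_mod']
  have hσlt : σ < 2 ^ S.Δ := by
    refine Nat.lt_pow_two_of_testBit _ fun p hp => ?_
    by_contra hne
    rw [Bool.not_eq_false, hσbit] at hne
    omega
  have hex : ∃ i, IsLeaf (digit S.u D) (fun p => σ.testBit p = true) S.Δ i := by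
    obtain ⟨i, hi⟩ := exists_isLeaf (h.open_mono (sb * (S.G * S.f))) q S.Δ
    exact ⟨i, hi.congr (fun p hp => (hdig p hp).symm) fun p hp hd => by
      rw [hσbit]; exact ⟨fun hb => ⟨hp, hd, hb⟩, fun hb => hb.2.2⟩⟩
  have hval : S.table v 6 D σ 0 0 0 = hex.choose := by
    simp only [Shape.table]
    rw [dif_pos hex]
  have hle := hex.choose_spec.1
  have hsl := h.valid.slabs_lt
  refine ⟨_, (h.look (by omega) hD hDlt hσ (by omega) lit_zero (by positivity) lit_zero
    (by positivity) lit_zero (by positivity) (by rw [hval]; omega)).congr hval,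
    hex.choose_spec.congr hdig fun p hp hd => ?_⟩
  rw [hσbit]
  rw [hdig p hp] at hd
  exact ⟨fun hb => hb.2.2, fun hb => ⟨hp, hd, hb⟩⟩

/-- By `IsLeaf.lt_iff`, the keys below the query are determined by the leaf, by one comparison with
its key, and by which branchings are at most as high as the first difference. The last are the `Δ`
bits of `τ`. -/
theorem search (h : IsTableMemory S K c v M) (hsb : sb < S.units * S.f * S.f)
    (hq : q ≤ 2 * S.n) (hE : Ev M a b E sb) (hQ : Ev M a b Q q) :
    Ev M a b (search K E Q)
      (Nat.count (fun k => openCount c (sb * (S.G * S.f)) k < q) (S.Δ + 1)) := by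
  obtain ⟨D, hD, hDlt, hdig⟩ := h.branches hsb hE
  obtain ⟨i, hi, hleaf⟩ := h.leaf hsb hE hQ
  have hmono := h.open_mono (sb * (S.G * S.f))
  have hle := h.open_le (sb * (S.G * S.f))
  have hn := h.valid.n_lt
  have harg := h.valid.arg_lt
  have hY := h.super (id := 1) (by omega) hsb (k := i) (by have := hleaf.1; omega) hE hi
    (by have := hle i; change openCount c (sb * (S.G * S.f)) i < _; omega)
  change Ev M a b _ (openCount c (sb * (S.G * S.f)) i) at hY
  set y := openCount c (sb * (S.G * S.f))
  have hK := h.valid.lookups_lt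
  have hN := h.field_lt
  have hs := h.two_pow_slabs_le
  have hsl := h.valid.slabs_lt
  have hβ : 0 < S.β := by have := h.valid.slabs_le; omega
  have hX := hQ.xor hY
  have hxlt : q ^^^ y i < 2 ^ (K * S.β) :=
    Nat.xor_lt_two_pow (by omega) (by have := hle i; omega)
  obtain ⟨τ, hτ, hbit⟩ := Ev.testBit_bor (M := M) (a := a) (b := b) (k := K)
    (F := fun t => Expr.look 7 (Expr.super 2 E (lit 0)) (lit t)
      (Expr.field (op .xor Q (Expr.super 1 E (Expr.leaf K E Q))) t))
    (φ := fun t => S.table v 7 D t (chunk 1 S.β (q ^^^ y i) t) 0 0) (fun t ht =>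
      h.look (by omega) hD hDlt (Ev.lit (by omega)) (by omega) (h.field hX ht)
        ((chunk_lt _ _ _ _).trans_le (by rw [one_mul])) lit_zero (by positivity) lit_zero
        (by positivity) ((bits_lt _ _).trans_le (by omega)))
  have hτbit : ∀ p, τ.testBit p = true ↔
      p < S.Δ ∧ ∃ e, (q ^^^ y i).testBit e = true ∧ branch y p ≤ e + 1 := by
    intro p
    rw [hbit]
    simp only [Shape.table, testBit_bits, testBit_chunk]
    constructor
    · rintro ⟨t, ht, hp, e, he, ⟨-, hb⟩, hd⟩
      rw [hdig p hp] at hd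
      exact ⟨hp, t * S.β + e, hb, hd⟩
    · rintro ⟨hp, e, hb, hd⟩
      rw [hdig p hp]
      have he : e < K * S.β := by
        by_contra hge
        rw [Nat.testBit_lt_two_pow (hxlt.trans_le
          (Nat.pow_le_pow_right two_pos (not_lt.1 hge)))] at hb
        exact absurd hb (by simp)
      exact ⟨e / S.β, (Nat.div_lt_iff_lt_mul hβ).2 he, hp, e % S.β, Nat.mod_lt _ hβ,
        ⟨Nat.mod_lt _ hβ, by rwa [Nat.div_add_mod']⟩, by rwa [Nat.div_add_mod']⟩
  have hτlt : τ < 2 ^ S.Δ := by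
    refine Nat.lt_pow_two_of_testBit _ fun p hp => ?_
    by_contra hne
    rw [Bool.not_eq_false, hτbit] at hne
    omega
  have hsize : ∀ l < S.Δ, (digit S.u D l = 0 ∨ τ.testBit l = true) ↔
      branch y l ≤ (q ^^^ y i).size := by
    intro l hl
    rw [le_size_iff, hdig l hl, hτbit]
    simp [hl]
  have hlt := Ev.ltOp h.width_pos hY hQ
  have hval : S.table v 8 D i τ (if y i < q then 1 else 0) 0
      = Nat.count (fun k => y k < q) (S.Δ + 1) := by
    simp only [Shape.table]
    refine count_congr fun j hj => ?_
    have hj' : j ≤ S.Δ := by omega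
    have hiΔ := hleaf.1
    rw [hleaf.lt_iff hmono hj']
    have e1 : (∀ l, i ≤ l → l < j → digit S.u D l = 0 ∨ τ.testBit l = true) ↔
        ∀ l, i ≤ l → l < j → branch y l ≤ (q ^^^ y i).size :=
      forall_congr' fun l => forall_congr' fun _ => forall_congr' fun hl => hsize l (by omega)
    have e2 : (∀ l, j ≤ l → l < i → digit S.u D l = 0 ∨ τ.testBit l = true) ↔
        ∀ l, j ≤ l → l < i → branch y l ≤ (q ^^^ y i).size :=
      forall_congr' fun l => forall_congr' fun _ => forall_congr' fun hl => hsize l (by omega)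
    rw [e1, e2]
    by_cases hyq : y i < q <;> simp [hyq]
  have hc := count_le (fun k => y k < q) (S.Δ + 1)
  refine (h.look (by omega) hD hDlt hi (by have := hleaf.1; omega) hτ (by omega) hlt ?_
    lit_zero (by positivity) (by rw [hval]; omega)).congr hval
  split <;> omega

/-- The search locates `q` among the counts at the start of the superblock. The counts at `i` differ
from these by the small sums read from `V`, so table 9 needs only truncated distances of the old
counts from `q`. -/
theorem slabSelect (h : IsTableMemory S K c v M) {I : Expr} {i z : ℕ} (hi : i ≤ 2 * S.n)
    (hq : q ≤ 2 * S.n) (hz1 : 1 ≤ z) (hz : z ≤ S.Δ)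
    (hlt : rank c v i (z - 1) < q) (hle : q ≤ rank c v i z)
    (hI : Ev M a b I i) (hQ : Ev M a b Q q) :
    Ev M a b (slabSelect K I Q) z := by
  have hE := h.superIndex hI
  have hsb := h.valid.superblock_index_lt hi
  have hk := h.search hsb hq hE hQ
  obtain ⟨V, hV, hVlt, hVdig⟩ := h.mixed hi hI
  have hrank := fun j (hj : j ≤ S.Δ) => h.rank_eq (v := v) hj hVdig
  have hopen := h.open_le (i / S.G / S.f * (S.G * S.f))
  have hmono := h.open_mono (i / S.G / S.f * (S.G * S.f))
  have h0 : openCount c (i / S.G / S.f * (S.G * S.f)) 0 = 0 := by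
    simp [openCount, cntLeft_zero]
  -- The search may return `Δ + 1`, so a column beyond the last slab is stored. Its value may be
  -- below `q`, whence the truncated subtraction in `hoff'`.
  have hsuper := fun (k : ℕ) (J : Expr) (hJ : Ev M a b J k) (hk : k < S.Δ + 2) =>
    h.super (id := 1) (by omega) hsb hk hE hJ (by
      have := hopen k; have := h.valid.n_lt
      change openCount c (i / S.G / S.f * (S.G * S.f)) k < _; omega)
  have hgap := h.super (id := 3) (by omega) hsb (k := 0) (by omega) hE lit_zero
  simp only [Shape.superblock] at hsuper hgap
  set A := openCount c (i / S.G / S.f * (S.G * S.f)) with hA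
  have hN := h.field_lt
  have hsl := h.valid.slabs_lt
  have hn := h.valid.n_lt
  have hu := h.valid.counter_lt_field
  have hupos : 0 < 2 ^ S.u := by positivity
  have hglt : ∀ l < S.Δ, min (A (l + 1) - A l) (2 ^ S.u - 1) < 2 ^ S.u := fun l _ => by omega
  have hgpack := (pack_lt hglt).trans_le h.pow_slabs_le
  replace hgap := hgap (by omega)
  set k := Nat.count (fun k => A k < q) (S.Δ + 1) with hkdef
  have hkle : k ≤ S.Δ + 1 := count_le _ _
  have hkiff : ∀ j < S.Δ + 1, (A j < q ↔ j < k) := fun j hj =>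
    iff_lt_count (P := fun k => A k < q) (fun i j hij hj => (hmono hij).trans_lt hj) hj
  have hk1 : 1 ≤ k := (hkiff 0 (by omega)).1 (by omega)
  have hprev := (hkiff (k - 1) (by omega)).2 (by omega)
  have hcap : Ev M a b (Expr.hd 10) (2 ^ S.u - 1) :=
    h.hd (i := 10) (by omega) (by change 2 ^ S.u - 1 < _; omega)
  have hoff := Ev.min h.width_pos (hQ.sub (hsuper (k - 1) _ (hk.sub (Ev.lit h.two_le_pow) hk1)
    (by omega)) hprev.le) hcap
  have hoff' := Ev.min h.width_pos (Ev.tsub h.width_pos (hsuper k _ hk (by omega)) hQ) hcap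
  set g := pack S.u (fun l => min (A (l + 1) - A l) (2 ^ S.u - 1)) S.Δ
  have hgdig : ∀ l < S.Δ, digit S.u g l = min (A (l + 1) - A l) (2 ^ S.u - 1) :=
    fun l hl => digit_pack hglt hl
  have hval : S.table v 9 g k (min (q - A (k - 1)) (2 ^ S.u - 1))
      (min (A k - q) (2 ^ S.u - 1)) V = z := by
    simp only [Shape.table]
    have hrm := h.isSeq.rank_mono v i
    refine count_eq_of_iff_lt (by omega) fun j hj => ?_
    obtain ⟨r1, r2, r3, r4, r5⟩ := hrank j (by omega)
    have hiff : rank c v i j < q ↔ j < z := by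
      constructor
      · intro hjq
        by_contra hzj
        exact absurd (hrm (not_lt.1 hzj)) (by omega)
      · intro hjz
        exact (hrm (show j ≤ z - 1 by omega)).trans_lt hlt
    rw [← hiff, r1]
    split_ifs with hjk
    -- For an old count below `q`, a distance of at least `2 ^ u - 1` exceeds the left endpoints
    -- added, by the strict bound `r4`; the count at `i` stays below `q`.
    · have ht := truncated_sum (g := digit S.u g) hmono (m := 2 ^ S.u - 1) (x := q - A (k - 1))
        (show j ≤ k - 1 by omega) (fun l hl => hgdig l (by omega))
      have := hmono (show j ≤ k - 1 by omega)
      rw [gapSum]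
      omega
    -- For an old count of at least `q`, an excess of at least `2 ^ u - 1` cannot be undone by the
    -- right endpoints removed, which number at most that by `r5`.
    · have ht := truncated_sum (g := digit S.u g) hmono (m := 2 ^ S.u - 1) (x := A k - q)
        (show k ≤ j by omega) (fun l hl => hgdig l (by omega))
      have := hmono (show k ≤ j by omega)
      have := mt (hkiff k (by omega)).1 (lt_irrefl k)
      rw [gapSum]
      omega
  refine (h.look (by omega) hgap hgpack hk (by omega) hoff (by omega) hoff' (by omega) hV hVlt
    (by rw [hval]; omega)).congr hval

end IsTableMemory

end SlabRep

/-! ### Endpoint-select: samples and the tree inside a unit -/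

namespace SlabRep

namespace Expr

/-- The child, of the node `N`, that contains the endpoint of slab `k` preceded by `r` others in
this node. -/
def child (id : ℕ) (k N r : Expr) : Expr :=
  N * hd 8 + look 10 (acc id (k + N * hd 12)) r

def rest (id : ℕ) (k N r : Expr) : Expr :=
  r - look 13 (acc id (k + N * hd 12)) (look 10 (acc id (k + N * hd 12)) r)

/-- The position in the block `B` of the endpoint of slab `k` preceded by `r` others in this
block. -/
def blockSelect (K : ℕ) (k B r : Expr) : Expr :=
  let x := low (acc 2 B) (hd 4)
  B * hd 4 + sum (fun t => look 12 (group x t) k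
    (tsub (r + lit 1) (sum (fun t => look 11 (group x t) k) t))) K

def descend (K : ℕ) (k B r : Expr) : Expr :=
  let B₁ := child 4 k B r
  let r₁ := rest 4 k B r
  let B₂ := child 5 k B₁ r₁
  let r₂ := rest 5 k B₁ r₁
  blockSelect K k (child 6 k B₂ r₂) (rest 6 k B₂ r₂)

def endpointSelect (K : ℕ) (k i : Expr) : Expr :=
  let B := acc 8 (i / hd 11 + k * hd 14)
  let e := super 0 ((B + lit 1) * hd 8 * hd 8) k
  ite (op .lt i e) (descend K k B (i - super 0 (B * hd 8 * hd 8) k))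
    (acc 7 ((i - e) + (k + B * hd 12) * hd 11))

end Expr

theorem position_eq {c : ℕ → ℕ} {k i p : ℕ} (h1 : cntSlab c k p ≤ i)
    (h2 : i < cntSlab c k (p + 1)) : position c k i = p := by
  refine le_antisymm (Nat.sInf_le h2) ?_
  have hne : {p | i < cntSlab c k (p + 1)}.Nonempty := ⟨p, h2⟩
  by_contra hlt
  have h3 : i < cntSlab c k (position c k i + 1) := Nat.sInf_mem hne
  have h4 := cntSlab_mono c k (show position c k i + 1 ≤ p by omega)
  omega

/-- A position precedes the sought occurrence when the inclusive rank there is still too small.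
Truncated subtraction is right here: groups after the occurrence contribute 0. -/
theorem sum_count_chunk_lt (P : ℕ → Prop) [DecidablePred P] (s r m : ℕ) :
    ∑ t ∈ Finset.range m, Nat.count (fun p => Nat.count (fun p => P (t * s + p)) (p + 1) <
      r - Nat.count P (t * s)) s = Nat.count (fun p => Nat.count P (p + 1) < r) (m * s) := by
  induction m with
  | zero => simp
  | succ m ih =>
    rw [Finset.sum_range_succ, ih, Nat.succ_mul, Nat.count_add]
    congr 1
    refine count_congr fun p _ => ?_
    rw [add_assoc, Nat.count_add P (m * s) (p + 1)]
    omega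

namespace IsTableMemory

open SlabRep.Expr

variable {S : Shape} {K : ℕ} {c : ℕ → ℕ} {v : Convention} {M : List (BitVec S.w)}
  {a b : BitVec S.w} {k p i : ℕ} {J N R : Expr}

theorem hd_slabs (h : IsTableMemory S K c v M) : Ev M a b (Expr.hd 12) (S.Δ + 1) :=
  h.hd (i := 12) (by omega) (by
    have := h.valid.slabs_lt; have := h.field_lt; change S.Δ + 1 < _; omega)

theorem hd_sample (h : IsTableMemory S K c v M) : Ev M a b (Expr.hd 11) S.t :=
  h.hd (i := 11) (by omega) h.valid.sample_lt

/-- Data of the target of a descent in the tree of units. -/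
structure Target (S : Shape) (c : ℕ → ℕ) (k i p : ℕ) : Prop where
  one_le : 1 ≤ k
  le : k ≤ S.Δ
  le_two_mul : p ≤ 2 * S.n
  before : cntSlab c k p ≤ i
  after : i < cntSlab c k (p + 1)

/-- One level of the descent. The cumulative counts before the `f` children fit into one table
argument, and so does the remaining rank, since a node has at most `span` positions. -/
theorem node_spec (h : IsTableMemory S K c v M) (hT : Target S c k i p) {id size : ℕ}
    (hid : id < 9) (hsize : 0 < size) (hspan : size * S.f ≤ S.span)
    (hlen : k + p / (size * S.f) * (S.Δ + 1) < S.len id)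
    (hentry : S.entry c v id (k + p / (size * S.f) * (S.Δ + 1))
      = S.node c size (p / (size * S.f)) k)
    (hJ : Ev M a b J k) (hN : Ev M a b N (p / (size * S.f)))
    (hR : Ev M a b R (i - cntSlab c k (p / (size * S.f) * (size * S.f)))) :
    Ev M a b (child id J N R) (p / size) ∧
      Ev M a b (rest id J N R) (i - cntSlab c k (p / size * size)) := by
  have hf := h.valid.fan_pos
  have hpos : 0 < size * S.f := Nat.mul_pos hsize hf
  set B := p / (size * S.f) with hB
  have hq : p / size = B * S.f + p / size % S.f := by
    rw [hB, ← Nat.div_div_eq_div_mul, Nat.div_add_mod']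
  set q := p / size % S.f with hqdef
  have hqf : q < S.f := Nat.mod_lt _ hf
  have hst : ∀ l, B * (size * S.f) + l * size = (B * S.f + l) * size := fun l => by ring
  have hstart : B * (size * S.f) ≤ p := Nat.div_mul_le_self _ _
  have hend : p < B * (size * S.f) + size * S.f := Nat.lt_div_mul_add hpos
  have hdiff : ∀ x, cntSlab c k x - cntSlab c k (B * (size * S.f)) ≤ x - B * (size * S.f) :=
    fun x => count_sub_le _ _ _
  have hu := h.valid.counter_lt_field
  have hspan' := h.valid.span_lt
  have hdig_lt : ∀ l < S.f, cntSlab c k (B * (size * S.f) + l * size) -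
      cntSlab c k (B * (size * S.f)) < 2 ^ S.u := by
    intro l hl
    have h1 := hdiff (B * (size * S.f) + l * size)
    have h2 : l * size ≤ S.f * size := Nat.mul_le_mul_right _ hl.le
    rw [mul_comm S.f] at h2
    omega
  have hXlt : S.node c size B k < 2 ^ S.β :=
    (pack_lt hdig_lt).trans_le (Nat.pow_le_pow_right two_pos h.valid.fan_le)
  have hNw := h.field_lt
  have hn := h.valid.n_lt
  have hdig : ∀ l < S.f, digit S.u (S.node c size B k) l =
      cntSlab c k ((B * S.f + l) * size) - cntSlab c k (B * (size * S.f)) := by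
    intro l hl
    rw [Shape.node, digit_pack hdig_lt hl, hst]
  have hlenlt := h.base_add_lt hid hlen
  have hX : Ev M a b (Expr.acc id (J + N * Expr.hd 12)) (S.node c size B k) := by
    rw [← hentry] at hXlt ⊢
    exact h.acc hid hlen (hJ.add (hN.mul h.hd_slabs (by omega)) (by omega)) (by omega)
  have hbefore : cntSlab c k ((B * S.f + q) * size) ≤ i := by
    refine le_trans (cntSlab_mono c k ?_) hT.before
    rw [← hq]
    exact Nat.div_mul_le_self _ _
  have hmono : cntSlab c k (B * (size * S.f)) ≤ cntSlab c k ((B * S.f + q) * size) := by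
    refine cntSlab_mono c k ?_
    rw [← hst]
    omega
  have hRlt : i - cntSlab c k (B * (size * S.f)) < 2 ^ S.β := by
    have h1 := hdiff (p + 1)
    have h2 := hT.after
    omega
  -- The child is the last one before which at most the remaining rank of endpoints occurs; empty
  -- children are skipped by taking the last.
  have hchild : S.table v 10 (S.node c size B k) (i - cntSlab c k (B * (size * S.f))) 0 0 0
      = q := by
    simp only [Shape.table]
    rw [Nat.findGreatest_eq_iff]
    refine ⟨by omega, fun _ => ?_, fun l hl hl' => ?_⟩
    · rw [hdig q hqf]
      omega
    · rw [hdig l (by omega)]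
      have h1 : cntSlab c k (p + 1) ≤ cntSlab c k ((B * S.f + l) * size) := by
        refine cntSlab_mono c k ?_
        have h2 : p < (p / size + 1) * size := by
          rw [Nat.succ_mul]; exact Nat.lt_div_mul_add hsize
        have h3 : (p / size + 1) * size ≤ (B * S.f + l) * size :=
          Nat.mul_le_mul_right _ (by omega)
        omega
      have := hT.after
      omega
  have hfN : S.f < 2 ^ S.β :=
    ((Nat.le_mul_of_pos_left _ h.valid.counter_pos).trans h.valid.fan_le).trans_lt
      Nat.lt_two_pow_self
  have hc := (h.look (by omega) hX hXlt hR hRlt lit_zero (by positivity) lit_zero (by positivity)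
    lit_zero (by positivity) (by rw [hchild]; omega)).congr hchild
  have hple : p / size ≤ 2 * S.n := (Nat.div_le_self _ _).trans hT.le_two_mul
  refine ⟨((hN.mul h.hd_fan (by omega)).add hc (by omega)).congr hq.symm, ?_⟩
  have hd := (h.look (i := 13) (by omega) hX hXlt hc (by omega) lit_zero (by positivity) lit_zero
    (by positivity) lit_zero (by positivity) ((digit_lt _ _ _).trans (by omega))).congr
    (hdig q hqf)
  refine (hR.sub hd (by omega)).congr ?_
  rw [hq]
  omega

theorem blockSelect (h : IsTableMemory S K c v M) (hT : Target S c k i p)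
    (hJ : Ev M a b J k) (hN : Ev M a b N (p / S.G))
    (hR : Ev M a b R (i - cntSlab c k (p / S.G * S.G))) :
    Ev M a b (blockSelect K J N R) p := by
  have hG := h.valid.block_pos
  have hn := h.valid.n_lt
  have hp := hT.le_two_mul
  have hX := h.low le_rfl (h.acc (i := 2) (by omega) (h.valid.block_index_lt hp) hN
    (h.valid.block_lt h.isSeq _)) h.hd_block
  change Ev M a b _ (S.block c (p / S.G) % _) at hX
  rw [h.valid.block_mod h.isSeq _ le_rfl] at hX
  set B := p / S.G with hB
  set x := pack S.b (fun q => c (B * S.G + q)) S.G with hx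
  set r := i - cntSlab c k (B * S.G) with hr
  have hoff : p % S.G < S.G := h.offset_lt p
  have hBp : B * S.G + p % S.G = p := Nat.div_add_mod' p S.G
  have hdig : ∀ o ≤ S.G, cntSlab c k (B * S.G) +
      Nat.count (fun q => digit S.b x q / 2 = k) o = cntSlab c k (B * S.G + o) := by
    intro o ho
    rw [cntSlab, cntSlab, Nat.count_add]
    congr 1
    refine count_congr fun q hq => ?_
    rw [hx, digit_pack (fun p _ => h.valid.char_lt h.isSeq _) (by omega)]
  have hmono := Nat.count_monotone (fun q => digit S.b x q / 2 = k)
  have hKs := h.valid.block_le_groups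
  have hGw := h.hd_block.lt (a := a) (b := b)
  have htotal : Nat.count (fun q => digit S.b x q / 2 = k) (K * S.s) ≤ S.G := by
    have := h.valid.count_digit h.isSeq (B * S.G) le_rfl (fun q => q / 2 = k)
      (by have := hT.one_le; omega)
    rw [this]
    exact count_le _ _
  have hrlt : r + 1 < 2 ^ S.u := by
    have h1 : cntSlab c k (p + 1) - cntSlab c k (B * S.G) ≤ p + 1 - B * S.G :=
      count_sub_le _ _ _
    have h2 := hT.after
    have h3 := h.valid.superblock_lt
    have h4 : S.G ≤ S.G * S.f := Nat.le_mul_of_pos_right _ h.valid.fan_pos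
    omega
  have hu := h.valid.counter_lt_field
  have hNw := h.field_lt
  have hsN := h.groupSize_lt
  have hsl := h.valid.slabs_lt
  have hkle := hT.le
  have hpre : ∀ t ≤ K, Ev M a b (Expr.sum (fun t => Expr.look 11
      (Expr.group (Expr.low (Expr.acc 2 N) (Expr.hd 4)) t) J) t)
      (Nat.count (fun q => digit S.b x q / 2 = k) (t * S.s)) := by
    intro t ht
    rw [← sum_count_chunk (fun q => q / 2 = k)]
    refine Ev.sum (φ := fun t => Nat.count (fun p => digit S.b (chunk S.b S.s x t) p / 2 = k) S.s)
      (fun t' ht' => ?_) ?_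
    · refine h.look (i := 11) (by omega) (h.group hX (by omega)) (h.chunk_lt_field _ _) hJ
        (by omega) lit_zero (by positivity) lit_zero (by positivity) lit_zero (by positivity) ?_
      exact (count_le _ _).trans_lt (hsN.trans hNw)
    · rw [sum_count_chunk (fun q => q / 2 = k)]
      have := hmono (Nat.mul_le_mul_right S.s ht)
      omega
  have hchunk : ∀ t, S.table v 12 (chunk S.b S.s x t) k
      (r + 1 - Nat.count (fun q => digit S.b x q / 2 = k) (t * S.s)) 0 0 =
      Nat.count (fun p => Nat.count (fun p => digit S.b x (t * S.s + p) / 2 = k) (p + 1) <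
      r + 1 - Nat.count (fun q => digit S.b x q / 2 = k) (t * S.s)) S.s := by
    intro t
    simp only [Shape.table]
    refine count_congr fun p hp => ?_
    rw [count_congr (P := fun p => digit S.b (chunk S.b S.s x t) p / 2 = k)
      (Q := fun p => digit S.b x (t * S.s + p) / 2 = k)
      fun q hq => by rw [digit_chunk (by omega)]]
  have hsum : ∑ t ∈ Finset.range K, S.table v 12 (chunk S.b S.s x t) k
      (r + 1 - Nat.count (fun q => digit S.b x q / 2 = k) (t * S.s)) 0 0 = p % S.G := by
    rw [Finset.sum_congr rfl fun t _ => hchunk t,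
      sum_count_chunk_lt (fun q => digit S.b x q / 2 = k)]
    refine count_eq_of_iff_lt (by omega) fun q _ => ?_
    have hb := hT.before
    have ha := hT.after
    have d1 := hdig (p % S.G) hoff.le
    have d2 := hdig (p % S.G + 1) hoff
    rw [← add_assoc, hBp] at d2
    rw [hBp] at d1
    constructor
    · intro hlt
      by_contra hge
      have := hmono (show p % S.G + 1 ≤ q + 1 by omega)
      omega
    · intro hlt
      have := hmono (show q + 1 ≤ p % S.G by omega)
      omega
  have hadd := hN.mul (h.hd_block (a := a) (b := b)) (by omega)
  have hpos := Ev.sum (M := M) (a := a) (b := b) (k := K)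
    (F := fun t => Expr.look 12 (Expr.group (Expr.low (Expr.acc 2 N) (Expr.hd 4)) t) J
      (Expr.tsub (R + lit 1) (Expr.sum (fun t => Expr.look 11
        (Expr.group (Expr.low (Expr.acc 2 N) (Expr.hd 4)) t) J) t)))
    (φ := fun t => S.table v 12 (chunk S.b S.s x t) k
      (r + 1 - Nat.count (fun q => digit S.b x q / 2 = k) (t * S.s)) 0 0) (fun t ht => ?_)
    (by rw [hsum]; omega)
  · exact (hadd.add hpos (by rw [hsum]; omega)).congr (by rw [hsum, hBp])
  · refine h.look (i := 12) (by omega) (h.group hX ht) (h.chunk_lt_field _ _) hJ (by omega)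
      (Ev.tsub h.width_pos (hR.add (Ev.lit h.two_le_pow) (by omega)) (hpre t ht.le)) (by omega)
      lit_zero (by positivity) lit_zero (by positivity) ?_
    exact (count_le _ _).trans_lt (hsN.trans hNw)

theorem descend (h : IsTableMemory S K c v M) (hT : Target S c k i p)
    (hJ : Ev M a b J k) (hN : Ev M a b N (p / S.span))
    (hR : Ev M a b R (i - cntSlab c k (p / S.span * S.span))) :
    Ev M a b (descend K J N R) p := by
  have hf := h.valid.fan_pos
  have hG := h.valid.block_pos
  have hk : k < S.Δ + 1 := Nat.lt_succ_of_le hT.le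
  have h3 := h.valid.lt_units hT.le_two_mul
  have hdec : ∀ B, (k + B * (S.Δ + 1)) / (S.Δ + 1) = B ∧ (k + B * (S.Δ + 1)) % (S.Δ + 1) = k :=
    fun B => ⟨by rw [Nat.add_mul_div_right _ _ (by omega), Nat.div_eq_of_lt hk, zero_add],
      by rw [Nat.add_mul_mod_self_right, Nat.mod_eq_of_lt hk]⟩
  have hdiv : ∀ z, p / z / S.f = p / (z * S.f) := fun z => Nat.div_div_eq_div_mul _ _ _
  have h2 : p / (S.G * S.f * S.f) < S.units * S.f := by
    rw [← Nat.div_lt_iff_lt_mul hf, hdiv]; exact h3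
  have h1 : p / (S.G * S.f) < S.units * S.f * S.f := by
    rw [← Nat.div_lt_iff_lt_mul hf, hdiv]; exact h2
  have l2 : S.G * S.f * S.f ≤ S.span := Nat.le_mul_of_pos_right _ hf
  have l1 : S.G * S.f ≤ S.G * S.f * S.f := Nat.le_mul_of_pos_right _ hf
  obtain ⟨n3, r3⟩ := h.node_spec hT (id := 4) (size := S.G * S.f * S.f) (by omega)
    (by positivity) le_rfl (step_index hk h3)
    (by simp only [Shape.entry]; rw [(hdec _).1, (hdec _).2]) hJ hN hR
  obtain ⟨n2, r2⟩ := h.node_spec hT (id := 5) (size := S.G * S.f) (by omega)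
    (by positivity) l2 (step_index hk h2)
    (by simp only [Shape.entry]; rw [(hdec _).1, (hdec _).2]) hJ n3 r3
  obtain ⟨n1, r1⟩ := h.node_spec hT (id := 6) (size := S.G) (by omega)
    hG (l1.trans l2) (step_index hk h1)
    (by simp only [Shape.entry]; rw [(hdec _).1, (hdec _).2]) hJ n2 r2
  exact h.blockSelect hT hJ n1 r1

/-- Counts at the two ends of the sample's unit `B` come from the superblocks starting there. They
tell whether the target is still in `B`, where the tree applies, or later, where array 7 does. -/
theorem endpointSelect (h : IsTableMemory S K c v M) (hT : Target S c k i p) {I : Expr}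
    (hi : i ≤ 2 * S.n) (hJ : Ev M a b J k) (hI : Ev M a b I i) :
    Ev M a b (endpointSelect K J I) p := by
  have hk : k < S.Δ + 1 := Nat.lt_succ_of_le hT.le
  have hn := h.valid.n_lt
  have ht := h.valid.sample_pos
  have hspos := h.valid.span_pos
  have hcle := h.isSeq.cntSlab_le hT.one_le
  have hw := h.width_pos
  -- the sampled endpoint before the target
  have hg : i / S.t < S.samples := Nat.lt_succ_of_le (Nat.div_le_div_right hi)
  have hg0 := Nat.zero_le (i / S.t)
  have hsamples : Ev M a b (Expr.hd 14) S.samples := by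
    refine h.hd (i := 14) (by omega) ?_
    have h1 := h.base_add_lt (i := 8) (j := S.samples - 1) (by omega)
      (by
        change _ < (S.Δ + 1) * S.samples
        have : 1 * S.samples ≤ (S.Δ + 1) * S.samples := Nat.mul_le_mul_right _ (by omega)
        omega)
    have h2 : 32 ≤ S.base 8 := by
      have : S.base 1 ≤ S.base 8 := Finset.sum_le_sum_of_subset (Finset.range_mono (by omega))
      simpa [Shape.base, Shape.len] using this
    change S.samples < _
    omega
  have hlen8 : i / S.t + k * S.samples < S.len 8 := step_index hg hk
  have hsample : cntSlab c k (position c k (i / S.t * S.t)) ≤ i / S.t * S.t ∧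
      i / S.t * S.t < cntSlab c k (position c k (i / S.t * S.t) + 1) ∧
      position c k (i / S.t * S.t) ≤ p := by
    have hgi : i / S.t * S.t ≤ i := Nat.div_mul_le_self _ _
    have hmem : p ∈ {p | i / S.t * S.t < cntSlab c k (p + 1)} := lt_of_le_of_lt hgi hT.after
    refine ⟨?_, Nat.sInf_mem ⟨p, hmem⟩, Nat.sInf_le hmem⟩
    by_contra hlt
    rw [not_le] at hlt
    rcases Nat.eq_zero_or_eq_succ_pred (position c k (i / S.t * S.t)) with h0 | h0
    · rw [h0] at hlt
      simp [cntSlab] at hlt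
    · rw [h0] at hlt
      have := Nat.sInf_le (show (position c k (i / S.t * S.t)).pred ∈
        {p | i / S.t * S.t < cntSlab c k (p + 1)} from hlt)
      change position c k (i / S.t * S.t) ≤ _ at this
      simp only [Nat.succ_eq_add_one] at h0
      omega
  have hentry8 : S.entry c v 8 (i / S.t + k * S.samples)
      = position c k (i / S.t * S.t) / S.span := by
    simp only [Shape.entry]
    rw [Nat.add_mul_div_right _ _ (by omega), Nat.div_eq_of_lt hg, zero_add,
      Nat.add_mul_mod_self_right, Nat.mod_eq_of_lt hg]
  obtain ⟨s1, s2, s3⟩ := hsample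
  set p₀ := position c k (i / S.t * S.t)
  have hp := hT.le_two_mul
  set B := p₀ / S.span with hB
  have hBle : B ≤ 2 * S.n := (Nat.div_le_self _ _).trans (by omega)
  have hBe : Ev M a b (Expr.acc 8 (I / Expr.hd 11 + J * Expr.hd 14)) B := by
    have hb := h.base_add_lt (by omega) hlen8
    rw [← hentry8] at hBle ⊢
    exact h.acc (by omega) hlen8 ((hI.div h.hd_sample).add (hJ.mul hsamples (by omega))
      (by omega)) (by omega)
  -- superblocks at the boundaries of large units
  have hBu : B + 1 < S.units := by
    have h1 := h.valid.add_span_lt (show p₀ ≤ 2 * S.n by omega)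
    have h2 : (B + 1) * S.span < S.units * S.span := by
      have : B * S.span ≤ p₀ := Nat.div_mul_le_self _ _
      rw [Nat.succ_mul]
      omega
    exact lt_of_mul_lt_mul_right h2 (Nat.zero_le _)
  have hffpos : 0 < S.f * S.f := Nat.mul_pos h.valid.fan_pos h.valid.fan_pos
  have hunit : ∀ (C : ℕ) (E : Expr), C < S.units → Ev M a b E C →
      Ev M a b (Expr.super 0 (E * Expr.hd 8 * Expr.hd 8) J) (cntSlab c k (C * S.span)) := by
    intro C E hC hE
    have hidx : C * S.f * S.f < S.units * S.f * S.f :=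
      Nat.mul_lt_mul_of_pos_right (Nat.mul_lt_mul_of_pos_right hC h.valid.fan_pos) h.valid.fan_pos
    have hlen3 : C * S.f * S.f < S.len 2 :=
      hidx.trans_le (Nat.le_mul_of_pos_right _ h.valid.fan_pos)
    have hb := h.base_add_lt (i := 2) (by omega) hlen3
    have h1 : C * S.f ≤ C * S.f * S.f := Nat.le_mul_of_pos_right _ h.valid.fan_pos
    have heq : C * S.f * S.f * (S.G * S.f) = C * S.span := by
      unfold Shape.span; ring
    rw [← heq]
    refine h.super (id := 0) (by omega) hidx (by omega)
      ((hE.mul h.hd_fan (by omega)).mul h.hd_fan (by omega)) hJ ?_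
    have := hcle (C * S.f * S.f * (S.G * S.f))
    change cntSlab c k _ < _
    omega
  have he := hunit (B + 1) _ hBu (hBe.add (Ev.lit h.two_le_pow)
    (by have := h.valid.lt_units hp; have := h.valid.n_lt; have := h.field_lt
        have hb := h.base_add_lt (i := 4) (j := B + 1) (by omega) (by
          change _ < S.units * (S.Δ + 1)
          exact hBu.trans_le (Nat.le_mul_of_pos_right _ (by omega)))
        omega))
  have hp₀lt : p₀ + 1 ≤ (B + 1) * S.span := by
    rw [Nat.succ_mul]
    exact Nat.lt_div_mul_add hspos
  refine Ev.ite hw (Ev.ltOp hw hI he) (fun hlt => ?_) fun hge => ?_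
  · have hpB : p / S.span = B := by
      refine le_antisymm ?_ (Nat.div_le_div_right s3)
      by_contra hgt
      rw [not_le] at hgt
      have h1 : (B + 1) * S.span ≤ p := by
        have := Nat.mul_le_mul_right S.span (show B + 1 ≤ p / S.span from hgt)
        exact this.trans (Nat.div_mul_le_self _ _)
      have h2 := cntSlab_mono c k h1
      have h3 := hT.before
      omega
    have hN : Ev M a b (Expr.acc 8 (I / Expr.hd 11 + J * Expr.hd 14)) (p / S.span) := by
      rw [hpB]; exact hBe
    refine h.descend hT hJ hN (hI.sub ?_ ?_)
    · rw [hpB]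
      exact hunit B _ (by omega) hBe
    · exact (cntSlab_mono c k (Nat.div_mul_le_self _ _)).trans hT.before
  · rw [not_lt] at hge
    have h1 := cntSlab_mono c k hp₀lt
    have h2 := Nat.lt_div_mul_add (a := i) ht
    -- The sample, of rank `i / t * t`, lies before the end of `B`, so fewer than `t` endpoints of
    -- the slab lie between this end and the target.
    have hr : i - cntSlab c k ((B + 1) * S.span) < S.t := by omega
    have hkB := step_index hk (show B < S.units by omega)
    have hlen7 : (i - cntSlab c k ((B + 1) * S.span)) + (k + B * (S.Δ + 1)) * S.t < S.len 7 :=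
      step_index hr hkB
    have hb := h.base_add_lt (by omega) hlen7
    have hkB' : k + B * (S.Δ + 1) ≤ (k + B * (S.Δ + 1)) * S.t := Nat.le_mul_of_pos_right _ ht
    have hentry7 : S.entry c v 7 ((i - cntSlab c k ((B + 1) * S.span)) +
        (k + B * (S.Δ + 1)) * S.t) = p := by
      simp only [Shape.entry]
      rw [Nat.add_mul_div_right _ _ ht, Nat.div_eq_of_lt hr, zero_add,
        Nat.add_mul_mod_self_right, Nat.mod_eq_of_lt hk, Nat.add_mul_mod_self_right,
        Nat.mod_eq_of_lt hr, Nat.add_mul_div_right _ _ (by omega), Nat.div_eq_of_lt hk, zero_add,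
        Nat.add_sub_cancel' hge]
      exact position_eq hT.before hT.after
    have := h.acc (by omega) hlen7 ((hI.sub he hge).add ((hJ.add (hBe.mul h.hd_slabs (by omega))
      (by omega)).mul h.hd_sample (by omega)) (by omega)) (by rw [hentry7]; omega)
    exact this.congr hentry7

end IsTableMemory

/-! ### The four queries together -/

namespace Expr

/-- The queries to the data structure for many segments. -/
def query (K : ℕ) : Op → Expr
  | .slabSelect => slabSelect K arg0 arg1
  | .slabRank => slabRank K arg0 arg1
  | .endpointSelect => endpointSelect K arg0 (arg1 - lit 1)
  | .endpointRank => endpointRank K arg0 arg1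

end Expr

theorem IsTableMemory.query {S : Shape} {K : ℕ} {c : ℕ → ℕ} {v : Convention}
    {M : List (BitVec S.w)} (h : IsTableMemory S K c v M) {o : Op} {x y z : ℕ}
    (ho : Spec S.n S.Δ c v o x y z) :
    Ev M (BitVec.ofNat S.w x) (BitVec.ofNat S.w y) (Expr.query K o) z := by
  have hn := h.valid.n_lt
  have hs := h.valid.slabs_lt
  have hN := h.field_lt
  cases o with
  | slabSelect =>
    obtain ⟨hx, hy1, hy, hz1, hz, hlt, hle⟩ := ho
    exact h.slabSelect hx hy hz1 hz hlt hle (Ev.arg0 (by omega)) (Ev.arg1 (by omega))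
  | slabRank =>
    obtain ⟨hx, hy, rfl⟩ := ho
    exact h.slabRank hx hy (Ev.arg0 (by omega)) (Ev.arg1 (by omega))
  | endpointSelect =>
    obtain ⟨hx1, hx, hy1, hy, hz, h1, h2⟩ := ho
    exact h.endpointSelect (i := y - 1) ⟨hx1, hx, hz, by omega, by omega⟩ (by omega)
      (Ev.arg0 (by omega)) ((Ev.arg1 (by omega)).sub (Ev.lit h.two_le_pow) hy1)
  | endpointRank =>
    obtain ⟨hx1, hx, hy, rfl⟩ := ho
    exact h.endpointRank hy hx1 hx (Ev.arg1 (by omega)) (Ev.arg0 (by omega))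

end SlabRep

namespace SlabRep

/-! ### The choice of the parameters -/

/-- The parameters for `2 ^ m ≤ n < 2 ^ (m + 1)` and `m < 2 ^ L`. -/
def shape (n w Δ m L : ℕ) : Shape where
  n := n
  w := w
  Δ := Δ
  b := Nat.clog 2 (2 * Δ + 2)
  u := 5 * L
  β := m / 8
  s := m / 8 / Nat.clog 2 (2 * Δ + 2)
  G := (w - 5 * L * (2 * Δ + 2)) / Nat.clog 2 (2 * Δ + 2)
  f := m / 8 / (5 * L)
  t := Δ * w

/-- All parameters are small compared to `m`. -/
structure IsLarge (κ n w Δ m L : ℕ) : Prop where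
  one_le_κ : 1 ≤ κ
  pow_le : 2 ^ m ≤ n
  lt_pow : n < 2 ^ (m + 1)
  lt_width : m + 2 ≤ w
  width_le : w ≤ κ * m
  n_lt : 2 * n < 2 ^ w
  lt_two_pow : m < 2 ^ L
  slabs_pos : 1 ≤ Δ
  large : 100000 * κ * Δ * L ^ 4 ≤ m

namespace IsLarge

variable {κ n w Δ m L : ℕ}

theorem size_pos (h : IsLarge κ n w Δ m L) : 1 ≤ L := by
  by_contra h0
  have h1 := h.lt_two_pow
  have h2 := h.lt_width
  have h3 := h.width_le
  rw [Nat.eq_zero_of_not_pos h0] at h1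
  have : m = 0 := by omega
  subst this
  omega

theorem large' (h : IsLarge κ n w Δ m L) : 100000 * (κ * Δ * L ^ 2) ≤ m := by
  refine le_trans ?_ h.large
  have : L ^ 2 ≤ L ^ 4 := Nat.pow_le_pow_right h.size_pos (by omega)
  calc 100000 * (κ * Δ * L ^ 2) = 100000 * κ * Δ * L ^ 2 := by ring
    _ ≤ _ := Nat.mul_le_mul_left _ this

theorem slabs_sq (h : IsLarge κ n w Δ m L) : 100000 * (Δ * L ^ 2) ≤ m := by
  refine le_trans (Nat.mul_le_mul_left _ ?_) h.large'
  rw [mul_assoc]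
  exact Nat.le_mul_of_pos_left _ h.one_le_κ

theorem slabs_size (h : IsLarge κ n w Δ m L) : 100000 * (Δ * L) ≤ m := by
  refine le_trans (Nat.mul_le_mul_left _ (Nat.mul_le_mul_left _ ?_)) h.slabs_sq
  exact Nat.le_self_pow (by omega) L

theorem size_le (h : IsLarge κ n w Δ m L) : 100000 * L ≤ m :=
  (Nat.mul_le_mul_left _ (Nat.le_mul_of_pos_left _ h.slabs_pos)).trans h.slabs_size

theorem slabs_le (h : IsLarge κ n w Δ m L) : 100000 * Δ ≤ m :=
  (Nat.mul_le_mul_left _ (Nat.le_mul_of_pos_right _ h.size_pos)).trans h.slabs_size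

theorem κ_le (h : IsLarge κ n w Δ m L) : 100000 * κ ≤ m := by
  refine (Nat.mul_le_mul_left _ ?_).trans h.large'
  rw [mul_assoc]
  exact Nat.le_mul_of_pos_right _ (Nat.mul_pos h.slabs_pos (Nat.pow_pos h.size_pos))

theorem clog_le (h : IsLarge κ n w Δ m L) : Nat.clog 2 (2 * Δ + 2) ≤ 2 * L := by
  have h1 := h.size_pos
  have h2 := h.slabs_le
  have h3 := h.lt_two_pow
  refine Nat.clog_le_of_le_pow (le_trans ?_ (Nat.pow_le_pow_right two_pos
    (show L + 1 ≤ 2 * L by omega)))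
  rw [pow_succ]
  omega

theorem clog_pos (Δ : ℕ) : 0 < Nat.clog 2 (2 * Δ + 2) := Nat.clog_pos one_lt_two (by omega)

theorem counters_le (h : IsLarge κ n w Δ m L) : 5 * L * (2 * Δ + 2) ≤ 20 * (Δ * L) := by
  have h1 := h.slabs_pos
  calc 5 * L * (2 * Δ + 2) ≤ 5 * L * (4 * Δ) := Nat.mul_le_mul_left _ (by omega)
    _ = _ := by ring

/-- Polynomial costs in `m` up to degree 8 can thus be charged to `n`. -/
theorem pow_eight_le (h : IsLarge κ n w Δ m L) : m ^ 8 ≤ n := by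
  refine le_trans ?_ h.pow_le
  have h1 := h.size_le
  calc m ^ 8 ≤ (2 ^ L) ^ 8 := Nat.pow_le_pow_left h.lt_two_pow.le 8
    _ = 2 ^ (L * 8) := by rw [← pow_mul]
    _ ≤ _ := Nat.pow_le_pow_right two_pos (by omega)

/-- The two roundings lose only a constant factor; 32 reappears as the number `32 * κ` of lookups
per word. -/
theorem mul_groups (h : IsLarge κ n w Δ m L) :
    m ≤ 32 * (Nat.clog 2 (2 * Δ + 2) * (m / 8 / Nat.clog 2 (2 * Δ + 2))) := by
  have h1 := Nat.lt_mul_div_succ (m / 8) (clog_pos Δ)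
  have h2 := h.clog_le
  have h3 := h.size_le
  rw [Nat.mul_succ] at h1
  have := h.size_pos
  omega

theorem lt_mul_div_add (x : ℕ) {b : ℕ} (hb : 0 < b) : x < b * (x / b) + b := by
  have := Nat.lt_mul_div_succ x hb
  rwa [Nat.mul_succ] at this

theorem block_mul (_h : IsLarge κ n w Δ m L) :
    w < Nat.clog 2 (2 * Δ + 2) * (shape n w Δ m L).G + Nat.clog 2 (2 * Δ + 2) +
      5 * L * (2 * Δ + 2) := by
  have h1 := lt_mul_div_add (w - 5 * L * (2 * Δ + 2)) (clog_pos Δ)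
  change w < _ * ((w - 5 * L * (2 * Δ + 2)) / _) + _ + _
  omega

/-- The part of a word not used for letters, by rounding and by counters, amounts to at most one bit
per letter of the block. -/
theorem block_pos (h : IsLarge κ n w Δ m L) :
    Nat.clog 2 (2 * Δ + 2) + 5 * L * (2 * Δ + 2) ≤ (shape n w Δ m L).G := by
  have hc := h.clog_le
  have hX := h.counters_le
  have h1 := h.slabs_sq
  have h2 := h.lt_width
  have h3 := h.size_pos
  have h4 := h.slabs_pos
  have h5 : L ≤ Δ * L := Nat.le_mul_of_pos_left _ h4
  have h6 : Δ * L ≤ Δ * L ^ 2 := Nat.mul_le_mul_left _ (Nat.le_self_pow (by omega) L)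
  refine (Nat.le_div_iff_mul_le (clog_pos Δ)).2 ?_
  have h7 : (Nat.clog 2 (2 * Δ + 2) + 5 * L * (2 * Δ + 2)) * Nat.clog 2 (2 * Δ + 2)
      ≤ 22 * (Δ * L) * (2 * L) := Nat.mul_le_mul (by omega) hc
  have h8 : 22 * (Δ * L) * (2 * L) = 44 * (Δ * L ^ 2) := by ring
  omega

theorem block_le (h : IsLarge κ n w Δ m L) : (shape n w Δ m L).G ≤ κ * m :=
  ((Nat.div_le_self _ _).trans (Nat.sub_le _ _)).trans h.width_le

theorem fan_le (n w Δ m L : ℕ) : (shape n w Δ m L).f ≤ m :=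
  (Nat.div_le_self _ _).trans (Nat.div_le_self _ _)

theorem fan_mul (h : IsLarge κ n w Δ m L) : m ≤ (shape n w Δ m L).f * (80 * L) := by
  have h0 := h.size_pos
  have h1 := Nat.lt_mul_div_succ (m / 8) (show 0 < 5 * L by omega)
  have h3 := h.size_le
  rw [Nat.mul_succ] at h1
  have h4 : (shape n w Δ m L).f * (80 * L) = 16 * (5 * L * (m / 8 / (5 * L))) := by
    change m / 8 / (5 * L) * (80 * L) = _
    ring
  omega

theorem span_le (h : IsLarge κ n w Δ m L) : (shape n w Δ m L).span ≤ κ * m ^ 4 := by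
  have h1 := fan_le n w Δ m L
  calc (shape n w Δ m L).span ≤ κ * m * m * m * m :=
      Nat.mul_le_mul (Nat.mul_le_mul (Nat.mul_le_mul h.block_le h1) h1) h1
    _ = _ := by ring

/-- This fixes `u = 5 * L`: a unit has at most `κ * m ^ 4 ≤ m ^ 5` positions, and `m < 2 ^ L`. -/
theorem span_lt (h : IsLarge κ n w Δ m L) : (shape n w Δ m L).span + 1 < 2 ^ (5 * L) := by
  have h1 := h.span_le
  have h2 : κ * m ^ 4 ≤ m * m ^ 4 := Nat.mul_le_mul_right _ (by have := h.κ_le; omega)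
  have h3 : (m + 1) ^ 5 ≤ (2 ^ L) ^ 5 := Nat.pow_le_pow_left h.lt_two_pow 5
  rw [← pow_mul, mul_comm L] at h3
  have h4 : m * m ^ 4 + 5 * m + 1 ≤ (m + 1) ^ 5 := by
    have : (m + 1) ^ 5 = m * m ^ 4 + 5 * m + 1 + (5 * m ^ 4 + 10 * m ^ 3 + 10 * m ^ 2) := by ring
    omega
  have := h.κ_le
  have := h.one_le_κ
  omega

/-- `G` is at least `w / (3 * L)` and `f` at least `m / (80 * L)`. A superblock can therefore pay
for its `(Δ + 2) * 4 ≤ 12 * Δ` words with one bit per position. -/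
theorem superblock_large (h : IsLarge κ n w Δ m L) :
    12 * (Δ * w) ≤ (shape n w Δ m L).G * (shape n w Δ m L).f := by
  have hb := h.block_mul
  have hf := h.fan_mul
  have hG := h.block_pos
  have hc := h.clog_le
  have hc0 := clog_pos Δ
  set G := (shape n w Δ m L).G
  set f := (shape n w Δ m L).f
  have h0 := h.size_pos
  have h1 : w ≤ G * (3 * L) := by
    have e1 : Nat.clog 2 (2 * Δ + 2) * G ≤ 2 * L * G := Nat.mul_le_mul_right _ hc
    have e2 : G ≤ L * G := Nat.le_mul_of_pos_left _ h0
    have e3 : G * (3 * L) = 2 * L * G + L * G := by ring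
    omega
  have h2 := h.slabs_sq
  have h3 : 12 * (Δ * w) * (240 * L ^ 2) ≤ G * f * (240 * L ^ 2) := by
    calc 12 * (Δ * w) * (240 * L ^ 2) = w * (2880 * (Δ * L ^ 2)) := by ring
      _ ≤ w * m := Nat.mul_le_mul_left _ (by omega)
      _ ≤ G * (3 * L) * (f * (80 * L)) := Nat.mul_le_mul h1 hf
      _ = _ := by ring
  exact Nat.le_of_mul_le_mul_right h3 (by positivity)

/-- Storing `t = Δ * w` positions per slab after each unit costs no more than a word per slab for
each of the `f * f` superblocks of the unit. -/
theorem fan_sq_large (h : IsLarge κ n w Δ m L) :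
    Δ * w ≤ (shape n w Δ m L).f * (shape n w Δ m L).f := by
  have hf := h.fan_mul
  set f := (shape n w Δ m L).f
  have h0 := h.size_pos
  have h2 := h.large'
  have h3 : Δ * w * (6400 * L ^ 2) ≤ f * f * (6400 * L ^ 2) := by
    calc Δ * w * (6400 * L ^ 2) ≤ Δ * (κ * m) * (6400 * L ^ 2) :=
          Nat.mul_le_mul_right _ (Nat.mul_le_mul_left _ h.width_le)
      _ = (6400 * (κ * Δ * L ^ 2)) * m := by ring
      _ ≤ m * m := Nat.mul_le_mul_right _ (by omega)
      _ ≤ f * (80 * L) * (f * (80 * L)) := Nat.mul_le_mul hf hf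
      _ = _ := by ring
  exact Nat.le_of_mul_le_mul_right h3 (by positivity)

theorem fan_pos (h : IsLarge κ n w Δ m L) : 1 ≤ (shape n w Δ m L).f := by
  by_contra h0
  have := h.fan_mul
  rw [Nat.eq_zero_of_not_pos h0] at this
  have := h.κ_le
  have := h.one_le_κ
  omega

theorem block_one_le (h : IsLarge κ n w Δ m L) : 1 ≤ (shape n w Δ m L).G := by
  have := h.block_pos
  have := clog_pos Δ
  omega

theorem units_mul_span (S : Shape) : S.units * S.span ≤ 2 * S.n + 2 * S.span := by
  rw [Shape.units, Nat.add_mul]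
  exact Nat.add_le_add_right (Nat.div_mul_le_self _ _) _

theorem bits_span_le (h : IsLarge κ n w Δ m L) :
    2 * (Nat.clog 2 (2 * Δ + 2) * (shape n w Δ m L).span) ≤ n := by
  refine le_trans ?_ h.pow_eight_le
  have h1 := h.clog_le
  have h2 := h.size_le
  have h3 := h.κ_le
  have h4 := h.one_le_κ
  calc 2 * (Nat.clog 2 (2 * Δ + 2) * (shape n w Δ m L).span)
      ≤ 2 * (m * (m * m ^ 4)) := Nat.mul_le_mul_left _ (Nat.mul_le_mul (by omega)
        (h.span_le.trans (Nat.mul_le_mul_right _ (by omega))))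
    _ = 2 * m ^ 6 := by ring
    _ ≤ m * m * m ^ 6 := Nat.mul_le_mul_right _ (by nlinarith)
    _ = m ^ 8 := by ring

theorem span_le_n (h : IsLarge κ n w Δ m L) : 2 * (shape n w Δ m L).span ≤ n :=
  (Nat.mul_le_mul_left _ (Nat.le_mul_of_pos_left _ (clog_pos Δ))).trans h.bits_span_le

theorem units_mul_span_le (h : IsLarge κ n w Δ m L) :
    (shape n w Δ m L).units * (shape n w Δ m L).span ≤ 3 * n := by
  have h1 := units_mul_span (shape n w Δ m L)
  have h2 := h.span_le_n
  change _ ≤ 2 * n + _ at h1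
  omega

theorem m_le_n (h : IsLarge κ n w Δ m L) : m ≤ n :=
  (Nat.le_self_pow (by omega) m).trans h.pow_eight_le

/-- Five arguments of `m / 8` bits leave a factor of about `2 ^ (3 * m / 8)` for the word length. -/
theorem table_space (h : IsLarge κ n w Δ m L) : w * (16 * (2 ^ (m / 8)) ^ 5) ≤ 16 * κ * n := by
  have h1 := h.size_le
  calc w * (16 * (2 ^ (m / 8)) ^ 5) ≤ (κ * 2 ^ L) * (16 * (2 ^ (m / 8)) ^ 5) :=
        Nat.mul_le_mul_right _ (h.width_le.trans (Nat.mul_le_mul_left _ h.lt_two_pow.le))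
    _ = 16 * κ * (2 ^ (L + m / 8 * 5)) := by rw [pow_add, pow_mul]; ring
    _ ≤ 16 * κ * 2 ^ m := Nat.mul_le_mul_left _ (Nat.pow_le_pow_right two_pos (by omega))
    _ ≤ _ := Nat.mul_le_mul_left _ h.pow_le

/-- By `block_pos` a word has at most `B + 1` bits per letter. The extra bits give `3 * n`, and
padding the last units gives at most `n` by `bits_span_le`. -/
theorem block_space (h : IsLarge κ n w Δ m L) :
    w * ((shape n w Δ m L).len 2) ≤ 2 * n * Nat.clog 2 (2 * Δ + 2) + 4 * n := by
  have hb := h.block_mul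
  have hG := h.block_pos
  have hs := h.units_mul_span_le
  have hbs := h.bits_span_le
  have hus := units_mul_span (shape n w Δ m L)
  change _ ≤ 2 * n + _ at hus
  change w * ((shape n w Δ m L).units * _ * _ * _) ≤ _
  set S := shape n w Δ m L with hS
  set B := Nat.clog 2 (2 * Δ + 2)
  have e : S.units * S.span = S.units * S.f * S.f * S.f * S.G := by unfold Shape.span; ring
  set V := S.units * S.f * S.f * S.f
  have h1 : w * V ≤ (B * S.G + S.G) * V := Nat.mul_le_mul_right _ (by omega)
  have h2 : (B * S.G + S.G) * V = B * (S.units * S.span) + S.units * S.span := by rw [e]; ring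
  have h3 : B * (S.units * S.span) ≤ B * (2 * n + 2 * S.span) := Nat.mul_le_mul_left _ hus
  have h4 : B * (2 * n + 2 * S.span) = 2 * n * B + 2 * (B * S.span) := by ring
  omega

theorem super_space (h : IsLarge κ n w Δ m L) {x : ℕ}
    (hx : x ≤ (shape n w Δ m L).f * (shape n w Δ m L).f) {d : ℕ} (hd : d ≤ 12 * Δ) :
    w * ((shape n w Δ m L).units * x * d) ≤ 3 * n := by
  refine le_trans ?_ h.units_mul_span_le
  have h1 := h.superblock_large
  set S := shape n w Δ m L with hS
  calc w * (S.units * x * d) = S.units * x * (d * w) := by ring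
    _ ≤ S.units * (S.f * S.f) * (S.G * S.f) := by
      refine Nat.mul_le_mul (Nat.mul_le_mul_left _ hx) (le_trans ?_ h1)
      rw [← mul_assoc]
      exact Nat.mul_le_mul_right _ hd
    _ = S.units * S.span := by unfold Shape.span; ring

theorem sample_le (h : IsLarge κ n w Δ m L) : Δ * w ≤ m ^ 3 := by
  have h1 := h.slabs_le
  have h2 := h.κ_le
  calc Δ * w ≤ m * (m * m) := Nat.mul_le_mul (by omega)
        (h.width_le.trans (Nat.mul_le_mul_right _ (by omega)))
    _ = _ := by ring

/-- Each slab gets room for samples of all `2 * n` endpoints; the spacing `Δ * w` pays for both the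
number of slabs and the word length. -/
theorem sample_space (h : IsLarge κ n w Δ m L) :
    w * ((Δ + 1) * (2 * n / (Δ * w) + 1)) ≤ 6 * n := by
  have h1 : Δ * w ≤ n := h.sample_le.trans ((Nat.pow_le_pow_right (by
    have := h.κ_le; have := h.one_le_κ; omega) (by omega)).trans h.pow_eight_le)
  have h2 := Nat.mul_div_le (2 * n) (Δ * w)
  have h3 := h.slabs_pos
  calc w * ((Δ + 1) * (2 * n / (Δ * w) + 1)) ≤ w * (2 * Δ * (2 * n / (Δ * w) + 1)) :=
        Nat.mul_le_mul_left _ (Nat.mul_le_mul_right _ (by omega))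
    _ = 2 * (Δ * w * (2 * n / (Δ * w)) + Δ * w) := by ring
    _ ≤ _ := by omega

/-- The header and the tables give `48 * κ`; the constant 25 is 4 for the blocks, 3 for each of the
five arrays of superblocks, nodes and stored positions, and 6 for the samples. -/
theorem space (h : IsLarge κ n w Δ m L) :
    w * (shape n w Δ m L).base 9 ≤ 2 * n * Nat.clog 2 (2 * Δ + 2) + (48 * κ + 25) * n := by
  have hΔ := h.slabs_pos
  have hf := h.fan_pos
  have t0 : w * 32 ≤ 32 * κ * n := by
    have := h.m_le_n
    calc w * 32 ≤ κ * n * 32 :=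
          Nat.mul_le_mul_right _ (h.width_le.trans (Nat.mul_le_mul_left _ this))
      _ = _ := by ring
  have t1 := h.table_space
  have t2 := h.block_space
  have t8 := h.sample_space
  have hf2 : (shape n w Δ m L).f ≤ (shape n w Δ m L).f * (shape n w Δ m L).f :=
    Nat.le_mul_of_pos_left _ hf
  have t3 := h.super_space (x := (shape n w Δ m L).f * (shape n w Δ m L).f) le_rfl
    (d := (Δ + 2) * 4) (by omega)
  have t4 := h.super_space (x := 1) (by omega) (d := Δ + 1) (by omega)
  have t5 := h.super_space (x := (shape n w Δ m L).f) hf2 (d := Δ + 1) (by omega)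
  have t6 := h.super_space (x := (shape n w Δ m L).f * (shape n w Δ m L).f) le_rfl
    (d := Δ + 1) (by omega)
  have t7 : w * ((shape n w Δ m L).units * (Δ + 1) * (Δ * w)) ≤ 3 * n := by
    refine le_trans ?_ (h.super_space (x := (shape n w Δ m L).f * (shape n w Δ m L).f) le_rfl
      (d := 12 * Δ) le_rfl)
    refine Nat.mul_le_mul_left _ ?_
    rw [mul_assoc, mul_assoc]
    refine Nat.mul_le_mul_left _ ?_
    rw [mul_comm]
    exact Nat.mul_le_mul h.fan_sq_large (by omega)
  have hsum : w * (shape n w Δ m L).base 9 = w * 32 + w * (16 * (2 ^ (m / 8)) ^ 5)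
      + w * (shape n w Δ m L).len 2
      + w * ((shape n w Δ m L).units * ((shape n w Δ m L).f * (shape n w Δ m L).f) *
        ((Δ + 2) * 4))
      + w * ((shape n w Δ m L).units * 1 * (Δ + 1))
      + w * ((shape n w Δ m L).units * (shape n w Δ m L).f * (Δ + 1))
      + w * ((shape n w Δ m L).units * ((shape n w Δ m L).f * (shape n w Δ m L).f) * (Δ + 1))
      + w * ((shape n w Δ m L).units * (Δ + 1) * (Δ * w))
      + w * ((Δ + 1) * (2 * n / (Δ * w) + 1)) := by
    simp only [Shape.base, Finset.sum_range_succ, Finset.sum_range_zero, Shape.len,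
      Shape.samples]
    change w * (0 + 32 + 16 * (2 ^ (m / 8)) ^ 5 + _ + _ * (Δ + 2) * 4 + _ * (Δ + 1) +
      _ * (Δ + 1) + _ * (Δ + 1) + _ * (Δ + 1) * (Δ * w) +
      (Δ + 1) * (2 * n / (Δ * w) + 1)) = _
    ring
  rw [hsum]
  have : (48 * κ + 25) * n = 32 * κ * n + 16 * κ * n + 25 * n := by ring
  omega

theorem valid (h : IsLarge κ n w Δ m L) : (shape n w Δ m L).Valid (32 * κ) := by
  have hΔ := h.slabs_pos
  have hL := h.size_pos
  have hLm := h.size_le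
  have hκ := h.κ_le
  have hκ1 := h.one_le_κ
  have hw := h.lt_width
  have hX := h.counters_le
  have hX2 := h.slabs_size
  have hspan := h.span_lt
  have hu : 5 * L ≤ m / 8 := by omega
  have huβ : 2 ^ (5 * L) ≤ 2 ^ (m / 8) := Nat.pow_le_pow_right two_pos hu
  have hβw : 2 ^ (m / 8) < 2 ^ w := Nat.pow_lt_pow_right one_lt_two (by omega)
  have hβ : m / 8 < 2 ^ (m / 8) := Nat.lt_two_pow_self
  have hm5 : m ^ 3 < 2 ^ (5 * L) := by
    calc m ^ 3 < (2 ^ L) ^ 3 := Nat.pow_lt_pow_left h.lt_two_pow (by omega)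
      _ = 2 ^ (L * 3) := by rw [← pow_mul]
      _ ≤ _ := Nat.pow_le_pow_right two_pos (by omega)
  have hsample := h.sample_le
  have hspace := h.space
  have hc := h.clog_le
  refine ⟨hΔ, Nat.le_pow_clog one_lt_two _, Nat.mul_div_le _ _, ?_, h.block_one_le, ?_, h.fan_pos,
    Nat.mul_div_le _ _, ?_, hspan, ?_, ?_, ?_, ?_, h.n_lt, ?_, ?_, ?_, ?_⟩
  · have h1 := h.mul_groups
    have h2 : Nat.clog 2 (2 * Δ + 2) * (shape n w Δ m L).G ≤
        Nat.clog 2 (2 * Δ + 2) * (32 * κ * (m / 8 / Nat.clog 2 (2 * Δ + 2))) := by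
      calc Nat.clog 2 (2 * Δ + 2) * (shape n w Δ m L).G ≤ w :=
            (Nat.mul_div_le _ _).trans (Nat.sub_le _ _)
        _ ≤ κ * m := h.width_le
        _ ≤ κ * _ := Nat.mul_le_mul_left _ h1
        _ = _ := by ring
    exact Nat.le_of_mul_le_mul_left h2 (clog_pos Δ)
  · have := Nat.mul_div_le (w - 5 * L * (2 * Δ + 2)) (Nat.clog 2 (2 * Δ + 2))
    change Nat.clog 2 (2 * Δ + 2) * ((w - 5 * L * (2 * Δ + 2)) / Nat.clog 2 (2 * Δ + 2)) +
      5 * L * (2 * Δ + 2) ≤ w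
    omega
  · change 5 * L * (2 * Δ + 2) ≤ m / 8
    omega
  · change w < 2 ^ (5 * L)
    have : w ≤ Δ * w := Nat.le_mul_of_pos_left _ hΔ
    omega
  · change 2 * n < 2 ^ (32 * κ * (m / 8))
    have h1 : 2 * n < 2 ^ (m + 2) := by
      have := h.lt_pow
      rw [pow_succ]
      omega
    refine h1.trans_le (Nat.pow_le_pow_right two_pos ?_)
    have : 32 * 1 * (m / 8) ≤ 32 * κ * (m / 8) :=
      Nat.mul_le_mul_right _ (Nat.mul_le_mul_left _ hκ1)
    omega
  · change 32 * κ < 2 ^ (m / 8)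
    omega
  · change 32 * κ * (m / 8) < 2 ^ w
    calc 32 * κ * (m / 8) ≤ m * m := Nat.mul_le_mul (by omega) (Nat.div_le_self _ _)
      _ = m ^ 2 := by ring
      _ ≤ m ^ 3 := Nat.pow_le_pow_right (by omega) (by omega)
      _ < _ := by omega
  · exact Nat.mul_pos hΔ (by omega)
  -- Addresses fit into words because the space bound, divided by `w`, leaves fewer than `2 * n`
  -- words.
  · change (shape n w Δ m L).base 9 < 2 ^ w
    refine lt_trans ?_ h.n_lt
    have h1 : w * (shape n w Δ m L).base 9 < w * (2 * n) := by
      refine hspace.trans_lt ?_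
      have hn : 0 < n := lt_of_lt_of_le (by positivity) h.pow_le
      calc 2 * n * Nat.clog 2 (2 * Δ + 2) + (48 * κ + 25) * n
          = n * (2 * Nat.clog 2 (2 * Δ + 2) + 48 * κ + 25) := by ring
        _ < n * (2 * w) := Nat.mul_lt_mul_of_pos_left (by omega) hn
        _ = _ := by ring
    exact Nat.lt_of_mul_lt_mul_left h1
  · change m / 8 < w
    omega
  · change Δ * w < 2 ^ w
    omega

end IsLarge

end SlabRep

/-! ### Asymptotics and the choice between the two formats -/

namespace SlabRep

open Filter in
/-- The number of slabs is small compared to the logarithm. -/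
theorem exists_forall_mul_slabs_le (ε : ℝ) (hε0 : 0 < ε) (hε1 : ε < 1) (C : ℕ) :
    ∃ n₀ : ℕ, 2 ≤ n₀ ∧ ∀ n ≥ n₀, C * ⌈Real.logb 2 n ^ ε⌉₊ * (Nat.size (Nat.log 2 n)) ^ 4 ≤
      Nat.log 2 n := by
  have hlo := isLittleO_log_rpow_rpow_atTop (s := 1 - ε) (r := 4) (by linarith)
  -- 324 = 4 · 81: the number of slabs is at most `4 * m ^ ε`, and the size of `m` is at most `3 *
  -- log m`, taken to the fourth power.
  have hc : (0 : ℝ) < 1 / (324 * (C + 1)) := by positivity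
  have hev := (hlo.def hc).and (eventually_ge_atTop (3 : ℝ))
  have htend : Tendsto (fun n : ℕ => ((Nat.log 2 n : ℕ) : ℝ)) atTop atTop := by
    refine tendsto_natCast_atTop_atTop.comp ?_
    refine tendsto_atTop.2 fun k => ?_
    filter_upwards [eventually_ge_atTop (2 ^ k)] with n hn
    exact Nat.le_log_of_pow_le one_lt_two hn
  obtain ⟨n₀, hn₀⟩ := eventually_atTop.1 (htend.eventually hev)
  refine ⟨max 2 n₀, le_max_left _ _, fun n hn => ?_⟩
  obtain ⟨h1, h3⟩ := hn₀ n (le_trans (le_max_right _ _) hn)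
  have hn2 : 2 ≤ n := le_trans (le_max_left _ _) hn
  set m := Nat.log 2 n with hm
  have hm3 : 3 ≤ m := by exact_mod_cast h3
  have hmpos : (0 : ℝ) < m := by linarith
  have hlogm : 1 ≤ Real.log m := by
    rw [Real.le_log_iff_exp_le hmpos]
    linarith [Real.exp_one_lt_d9]
  rw [Real.norm_of_nonneg (by positivity), Real.norm_of_nonneg (by positivity)] at h1
  have hx1 : (1 : ℝ) ≤ Real.logb 2 n := by
    rw [Real.le_logb_iff_rpow_le one_lt_two (by positivity)]
    simpa using (by exact_mod_cast hn2 : (2 : ℝ) ≤ n)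
  have hx : Real.logb 2 n ≤ 2 * m := by
    have h4 : n < 2 ^ (m + 1) := Nat.lt_pow_succ_log_self one_lt_two n
    have h5 : Real.logb 2 n ≤ m + 1 := by
      rw [Real.logb_le_iff_le_rpow one_lt_two (by positivity)]
      have : (n : ℝ) ≤ 2 ^ (m + 1) := by exact_mod_cast h4.le
      refine this.trans_eq ?_
      rw [← Real.rpow_natCast]
      push_cast
      rfl
    linarith
  have hΔ : (⌈Real.logb 2 n ^ ε⌉₊ : ℝ) ≤ 4 * (m : ℝ) ^ ε := by
    have h4 := (Nat.ceil_lt_add_one (show 0 ≤ Real.logb 2 n ^ ε by positivity)).le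
    have h5 : Real.logb 2 n ^ ε ≤ (2 * m : ℝ) ^ ε :=
      Real.rpow_le_rpow (by linarith) hx hε0.le
    have h6 : (2 * m : ℝ) ^ ε ≤ 2 * (m : ℝ) ^ ε := by
      rw [Real.mul_rpow (by norm_num) (by positivity)]
      refine mul_le_mul_of_nonneg_right ?_ (by positivity)
      exact (Real.rpow_le_rpow_of_exponent_le (by norm_num) hε1.le).trans_eq (Real.rpow_one 2)
    have h7 : (1 : ℝ) ≤ (m : ℝ) ^ ε := Real.one_le_rpow (by linarith) hε0.le
    linarith
  have hsize : (Nat.size m : ℝ) ≤ 3 * Real.log m := by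
    have h4 : 2 ^ (Nat.size m - 1) ≤ m := by
      rw [← Nat.lt_size]
      have : 0 < Nat.size m := Nat.size_pos.2 (by omega)
      omega
    have h5 : ((Nat.size m - 1 : ℕ) : ℝ) * Real.log 2 ≤ Real.log m := by
      rw [← Real.log_pow]
      exact Real.log_le_log (by positivity) (by exact_mod_cast h4)
    have h6 : (Nat.size m : ℝ) ≤ ((Nat.size m - 1 : ℕ) : ℝ) + 1 := by
      exact_mod_cast (by omega : Nat.size m ≤ Nat.size m - 1 + 1)
    have h7 := Real.log_two_gt_d9
    have h8 : ((Nat.size m - 1 : ℕ) : ℝ) * (1 / 2) ≤ ((Nat.size m - 1 : ℕ) : ℝ) * Real.log 2 :=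
      mul_le_mul_of_nonneg_left (by linarith) (by positivity)
    linarith
  have hreal : (C : ℝ) * ⌈Real.logb 2 n ^ ε⌉₊ * (Nat.size m : ℝ) ^ 4 ≤ m := by
    have h4 : (Nat.size m : ℝ) ^ 4 ≤ 81 * Real.log m ^ (4 : ℝ) := by
      calc (Nat.size m : ℝ) ^ 4 ≤ (3 * Real.log m) ^ 4 := pow_le_pow_left₀ (by positivity) hsize 4
        _ = 81 * Real.log m ^ 4 := by ring
        _ = _ := by norm_cast
    have h5 : (m : ℝ) ^ ε * (m : ℝ) ^ (1 - ε) = m := by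
      rw [← Real.rpow_add hmpos]; simp
    calc (C : ℝ) * ⌈Real.logb 2 n ^ ε⌉₊ * (Nat.size m : ℝ) ^ 4
        ≤ (C + 1) * (4 * (m : ℝ) ^ ε) * (81 * (1 / (324 * (C + 1)) * (m : ℝ) ^ (1 - ε))) := by
          gcongr
          · linarith
          · exact h4.trans (mul_le_mul_of_nonneg_left h1 (by norm_num))
      _ = (m : ℝ) ^ ε * (m : ℝ) ^ (1 - ε) := by field_simp; ring
      _ = m := h5
  exact_mod_cast hreal

/-- The argument is at most `8 * x`, which costs 3, and rounding up costs 1. -/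
theorem clog_slabs_le {x : ℝ} (hx : 1 ≤ x) :
    (Nat.clog 2 (2 * ⌈x⌉₊ + 2) : ℝ) ≤ Real.logb 2 x + 4 := by
  set Δ := ⌈x⌉₊
  have h1 : (Δ : ℝ) ≤ 2 * x := by
    have := (Nat.ceil_lt_add_one (show 0 ≤ x by linarith)).le
    linarith
  have h2 : (2 * Δ + 2 : ℝ) ≤ 8 * x := by
    have := (Nat.ceil_lt_add_one (show 0 ≤ x by linarith)).le
    linarith
  have h3 : 2 ^ (Nat.clog 2 (2 * Δ + 2) - 1) < 2 * Δ + 2 :=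
    Nat.pow_pred_clog_lt_self one_lt_two (by omega : 1 < 2 * Δ + 2)
  have h4 : ((Nat.clog 2 (2 * Δ + 2) - 1 : ℕ) : ℝ) ≤ Real.logb 2 (8 * x) := by
    rw [Real.le_logb_iff_rpow_le one_lt_two (by linarith), Real.rpow_natCast]
    refine le_trans ?_ h2
    exact_mod_cast h3.le
  have h5 : Real.logb 2 (8 * x) = 3 + Real.logb 2 x := by
    rw [Real.logb_mul (by norm_num) (by linarith)]
    congr 1
    rw [show (8 : ℝ) = 2 ^ (3 : ℝ) by norm_num, Real.logb_rpow (by norm_num) (by norm_num)]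
  have h6 : (Nat.clog 2 (2 * Δ + 2) : ℝ) ≤ ((Nat.clog 2 (2 * Δ + 2) - 1 : ℕ) : ℝ) + 1 := by
    exact_mod_cast (by omega : Nat.clog 2 (2 * Δ + 2) ≤ Nat.clog 2 (2 * Δ + 2) - 1 + 1)
  linarith

/-- The expression that is evaluated for a query: the first memory word tells whether the
sequence of endpoints is to be scanned. -/
def queryExpr (m K : ℕ) (v : Convention) (o : Op) : Expr :=
  Expr.ite (.op .eq (.ld (.lit 0)) (.lit 0)) (Expr.query K o) (Expr.scan m v o)

/-- Header word 0 is 0, whereas the scanned format begins with `2 * n > 0`. -/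
theorem IsTableMemory.queryExpr {S : Shape} {K : ℕ} {c : ℕ → ℕ} {v : Convention}
    {M : List (BitVec S.w)} (h : IsTableMemory S K c v M) (m : ℕ) {o : Op} {x y z : ℕ}
    (ho : Spec S.n S.Δ c v o x y z) :
    Ev M (BitVec.ofNat S.w x) (BitVec.ofNat S.w y) (queryExpr m K v o) z :=
  Ev.ite h.width_pos (Ev.eqOp h.width_pos (h.hd (i := 0) (by omega)
    (by change 0 < _; positivity)) lit_zero) (fun _ => h.query ho) fun h0 => absurd rfl h0

theorem IsScanMemory.queryExpr {w n Δ m : ℕ} {c : ℕ → ℕ} {M : List (BitVec w)}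
    (h : IsScanMemory n Δ c M) (hn : 1 ≤ n) (hm : 2 * n < m) (hΔ : Δ ≤ 2 * n) (K : ℕ)
    (v : Convention) {o : Op} {x y z : ℕ} (ho : Spec n Δ c v o x y z) :
    Ev M (BitVec.ofNat w x) (BitVec.ofNat w y) (SlabRep.queryExpr m K v o) z := by
  have h4 := h.four_le
  have hw : 0 < w := by have := h.width; omega
  refine Ev.ite hw (Ev.eqOp hw (Ev.ld (Ev.lit (by omega)) h.head) (Ev.lit (by omega)))
    (fun h0 => by omega) fun _ => h.scan hm hΔ v ho

theorem computesWithin_of_ev {w : ℕ} {M : List (BitVec w)} {e : Expr} {T a b z : ℕ}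
    (hT : e.compile.length ≤ T) (h : Ev M (BitVec.ofNat w a) (BitVec.ofNat w b) e z) :
    ComputesWithin e.compile M T a b z := by
  rw [← show (e.eval M (BitVec.ofNat w a) (BitVec.ofNat w b)).toNat = z from h]
  exact computesWithin_compile M e T a b hT

theorem exists_large_memory {κ n w Δ m L : ℕ} (h : IsLarge κ n w Δ m L) {c : ℕ → ℕ}
    (hc : IsSeq n Δ c) (v : Convention) (m₀ : ℕ) :
    ∃ M : List (BitVec w),
      w * M.length ≤ 2 * n * Nat.clog 2 (2 * Δ + 2) + (48 * κ + 25) * n ∧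
      ∀ {o : Op} {x y z : ℕ}, Spec n Δ c v o x y z →
        Ev M (BitVec.ofNat w x) (BitVec.ofNat w y) (queryExpr m₀ (32 * κ) v o) z := by
  refine ⟨(shape n w Δ m L).memory c v 9, ?_, fun ho => ?_⟩
  · change w * ((shape n w Δ m L).memory c v 9).length ≤ _
    exact (congrArg (w * ·) ((shape n w Δ m L).length_memory c v 9)).trans_le h.space
  · exact IsTableMemory.queryExpr (S := shape n w Δ m L) ⟨h.valid, hc, rfl⟩ m₀ ho

theorem logb_le_sub_one {n w : ℕ} (hn : 2 ≤ n) (hw : 2 * n < 2 ^ w) :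
    Real.logb 2 n ≤ (w - 1 : ℕ) := by
  rw [Real.logb_le_iff_le_rpow one_lt_two (by positivity), Real.rpow_natCast]
  have h0 : w ≠ 0 := by rintro rfl; simp at hw; omega
  obtain ⟨k, rfl⟩ := Nat.exists_eq_succ_of_ne_zero h0
  rw [Nat.succ_eq_add_one, pow_succ] at hw
  exact_mod_cast (by simp; omega : n ≤ 2 ^ (k.succ - 1))

end SlabRep

theorem mainTheorem2 (ε : ℝ) (hε0 : 0 < ε) (hε1 : ε < 1) (κ : ℝ) (v : SlabRep.Convention) :
    ∃ (P : SlabRep.Op → SlabRep.Program) (T : ℕ) (C : ℝ),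
      ∀ n w : ℕ, 2 ≤ n → 2 * n < 2 ^ w → (w : ℝ) ≤ κ * Real.logb 2 n →
        ∀ (L : SlabRep.Segments n) (slab : Fin n → ℕ),
          SlabRep.IsSlabPartition ⌈Real.logb 2 n ^ ε⌉₊ slab →
          ∃ M : List (BitVec w),
            (w : ℝ) * M.length ≤ 2 * n * Real.logb 2 (Real.logb 2 n ^ ε) + C * n ∧
            ∀ (o : SlabRep.Op) (a b z : ℕ),
              SlabRep.IsAnswer L v ⌈Real.logb 2 n ^ ε⌉₊ slab o a b z →
              SlabRep.ComputesWithin (P o) M T a b z := by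
  -- The factor 2 passes from `Real.logb 2 n` to its integer part; adding 1 makes `k` positive.
  set k : ℕ := ⌈2 * κ⌉₊ + 1 with hk
  obtain ⟨n₀, hn₀, hlarge⟩ := SlabRep.exists_forall_mul_slabs_le ε hε0 hε1 (100000 * k)
  let E := SlabRep.queryExpr (2 * n₀) (32 * k) v
  refine ⟨fun o => (E o).compile, (E .slabSelect).compile.length + (E .slabRank).compile.length +
    (E .endpointSelect).compile.length + (E .endpointRank).compile.length,
    -- For large `n`, 33 = 25 + 8, the 8 coming from the surplus of 4 bits for each of `2 * n`
    -- letters. For `n < n₀` there are at most `3 * n` words of at most `|κ| * n₀` bits.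
    max (48 * (k : ℝ) + 33) (3 * (|κ| * n₀)), ?_⟩
  intro n w hn hw hwκ L slab hslab
  have hT : ∀ o, (E o).compile.length ≤ (E .slabSelect).compile.length +
      (E .slabRank).compile.length + (E .endpointSelect).compile.length +
      (E .endpointRank).compile.length := by
    intro o; cases o <;> omega
  have hseq := L.isSeq hslab
  have hx1 : (1 : ℝ) ≤ Real.logb 2 n := by
    rw [Real.le_logb_iff_rpow_le one_lt_two (by positivity)]
    simpa using (by exact_mod_cast hn : (2 : ℝ) ≤ n)
  have hxε : (1 : ℝ) ≤ Real.logb 2 n ^ ε := Real.one_le_rpow hx1 hε0.le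
  have hxw := SlabRep.logb_le_sub_one hn hw
  have hnpos : (0 : ℝ) < n := by positivity
  have hΔw : ⌈Real.logb 2 n ^ ε⌉₊ ≤ w - 1 := by
    refine Nat.ceil_le.2 (le_trans ?_ hxw)
    exact (Real.rpow_le_rpow_of_exponent_le hx1 hε1.le).trans_eq (Real.rpow_one _)
  have hΔ1 : 1 ≤ ⌈Real.logb 2 n ^ ε⌉₊ := Nat.one_le_ceil_iff.2 (by linarith)
  have hlogn : Real.logb 2 n ≤ n := by
    rw [Real.logb_le_iff_le_rpow one_lt_two hnpos, Real.rpow_natCast]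
    exact_mod_cast Nat.lt_two_pow_self.le
  by_cases hsmall : n < n₀
  · obtain ⟨M, hlen, hM⟩ := SlabRep.exists_isScanMemory hseq hw (by omega) (by
      have h1 : w - 1 < 2 ^ (w - 1) := Nat.lt_two_pow_self
      have h2 : 2 ^ w = 2 * 2 ^ (w - 1) := by rw [← pow_succ']; congr 1; omega
      omega)
    refine ⟨M, ?_, fun o a b z ho => SlabRep.computesWithin_of_ev (hT o)
      (hM.queryExpr (by omega) (by omega) ?_ _ v (SlabRep.spec_of_isAnswer hslab ho))⟩
    · have h1 : 0 ≤ Real.logb 2 (Real.logb 2 n ^ ε) := Real.logb_nonneg one_lt_two hxε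
      have h2 : (M.length : ℝ) ≤ 3 * n := by
        rw [hlen]; exact_mod_cast (by omega : 2 * n + 1 ≤ 3 * n)
      have h3 : (w : ℝ) ≤ |κ| * n₀ := by
        refine hwκ.trans (mul_le_mul (le_abs_self κ) (hlogn.trans ?_) (by linarith)
          (abs_nonneg κ))
        exact_mod_cast hsmall.le
      calc (w : ℝ) * M.length ≤ (|κ| * n₀) * (3 * n) :=
            mul_le_mul h3 h2 (by positivity) (by positivity)
        _ = (3 * (|κ| * n₀)) * n := by ring
        _ ≤ max (48 * (k : ℝ) + 33) (3 * (|κ| * n₀)) * n :=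
            mul_le_mul_of_nonneg_right (le_max_right _ _) hnpos.le
        _ ≤ _ := by
            have : 0 ≤ 2 * (n : ℝ) * Real.logb 2 (Real.logb 2 n ^ ε) := by positivity
            linarith
    · have : ⌈Real.logb 2 n ^ ε⌉₊ ≤ n := by
        refine Nat.ceil_le.2 (le_trans ?_ hlogn)
        exact (Real.rpow_le_rpow_of_exponent_le hx1 hε1.le).trans_eq (Real.rpow_one _)
      omega
  · have hm1 : 1 ≤ Nat.log 2 n := Nat.le_log_of_pow_le one_lt_two (by simpa using hn)
    have hpow := Nat.pow_log_le_self 2 (show n ≠ 0 by omega)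
    have hlt := Nat.lt_pow_succ_log_self one_lt_two n
    have hlogm : Real.logb 2 n ≤ 2 * Nat.log 2 n := by
      have h5 : Real.logb 2 n ≤ Nat.log 2 n + 1 := by
        rw [Real.logb_le_iff_le_rpow one_lt_two hnpos]
        have : (n : ℝ) ≤ 2 ^ (Nat.log 2 n + 1) := by exact_mod_cast hlt.le
        refine this.trans_eq ?_
        rw [← Real.rpow_natCast]
        push_cast
        rfl
      have : (1 : ℝ) ≤ Nat.log 2 n := by exact_mod_cast hm1
      linarith
    have hL : SlabRep.IsLarge k n w ⌈Real.logb 2 n ^ ε⌉₊ (Nat.log 2 n) (Nat.size (Nat.log 2 n)) := by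
      refine ⟨by omega, hpow, hlt, ?_, ?_, hw, Nat.lt_size_self _, hΔ1,
        hlarge n (by omega)⟩
      · have : 2 ^ (Nat.log 2 n + 1) < 2 ^ w := by rw [pow_succ]; omega
        exact (Nat.pow_lt_pow_iff_right one_lt_two).1 this
      · have hκ0 : 0 ≤ κ := by
          by_contra h0
          have : κ * Real.logb 2 n ≤ 0 :=
            mul_nonpos_of_nonpos_of_nonneg (not_le.1 h0).le (by linarith)
          have hw0 : (0 : ℝ) < w := by exact_mod_cast (by omega : 0 < w)
          linarith
        have h1 : (w : ℝ) ≤ k * Nat.log 2 n := by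
          calc (w : ℝ) ≤ κ * (2 * Nat.log 2 n) :=
                hwκ.trans (mul_le_mul_of_nonneg_left hlogm hκ0)
            _ = (2 * κ) * Nat.log 2 n := by ring
            _ ≤ k * Nat.log 2 n := by
                refine mul_le_mul_of_nonneg_right ((Nat.le_ceil _).trans ?_) (by positivity)
                exact_mod_cast (by omega : ⌈2 * κ⌉₊ ≤ k)
        exact_mod_cast h1
    obtain ⟨M, hlen, hM⟩ := SlabRep.exists_large_memory hL hseq v (2 * n₀)
    refine ⟨M, ?_, fun o a b z ho => SlabRep.computesWithin_of_ev (hT o)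
      (hM (SlabRep.spec_of_isAnswer hslab ho))⟩
    have h1 := SlabRep.clog_slabs_le hxε
    have h2 : (w : ℝ) * M.length ≤
        2 * n * Nat.clog 2 (2 * ⌈Real.logb 2 n ^ ε⌉₊ + 2) + (48 * k + 25) * n := by
      exact_mod_cast hlen
    calc (w : ℝ) * M.length ≤ 2 * n * (Real.logb 2 (Real.logb 2 n ^ ε) + 4) +
          (48 * k + 25) * n := by
          refine h2.trans (add_le_add_left (mul_le_mul_of_nonneg_left h1 (by positivity)) _)
      _ = 2 * n * Real.logb 2 (Real.logb 2 n ^ ε) + (48 * k + 33) * n := by ring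
      _ ≤ _ := by
          refine add_le_add_right (mul_le_mul_of_nonneg_right (le_max_left _ _) hnpos.le) _
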